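/- **Request process.** Let $(p_{ij})_{1\le i,j\le M}$ be an irreducible stochastic matrix and let $F_{ij}$ be probability laws on $(0,\infty)$ with finite means. Let $\{J_t\}_{t\in\mathbb R}$ be a stationary semi-Markov process with values in $\{1,\dots,M\}$ and with strictly increasing jump times $\{T_n\}_{n\in\mathbb Z}$, $T_0\le 0<T_1$: $J_t=J_{T_n}$ for $T_n\le t<T_{n+1}$, every $t\in\mathbb R$ lies in one of these intervals, and for $n\ge 1$, given the jump times and states up to index $n$, the event $\{J_{T_{n+1}}=j,\ T_{n+1}-T_n\in B\}$ has conditional probability $p_{ij}F_{ij}(B)$ with $i=J_{T_n}$. Let $\{\tau_n\}_{n\in\mathbb Z}$, $\tau_0\le 0<\tau_1$, be the points of a unit-rate Poisson process independent of $(J,\{T_n\})$. For each state $r$ let $(q^{(r)}_i)_{i\ge1}$ be a probability mass function on the documents $i=1,2,\dots$. Document $R_n$ is requested at time $\tau_n$; given $J$, $\{T_n\}$ and $\{\tau_n\}$, the requests are independent and $R_l$ has probability mass function $q^{(J_{\tau_l})}$. Let $q_i=\mathbb P[R_n=i]$, which does not depend on $n$, and assume $q_i>0$ for all $i\ge1$.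 **Policies.** Document $i$ has size $s_i>0$. A caching policy $\pi\in\mathcal P_c(x)$ for a cache of size $x$ chooses an initial content $\mathcal C^\pi_{\tau_1}$ and, after each request $R_n$, $n\ge1$, the next content $\mathcal C^\pi_{\tau_{n+1}}$, as a function of $R_1,\dots,R_n$, $\mathcal C^\pi_{\tau_1},\dots,\mathcal C^\pi_{\tau_n}$ (and possibly of a random seed that is independent of $J$, $\{T_n\}$, $\{\tau_n\}$ and $\{R_n\}$), so that $\mathcal C^\pi_{\tau_{n+1}}=\mathcal C^\pi_{\tau_n}$ if $R_n\in\mathcal C^\pi_{\tau_n}$, that $\mathcal C^\pi_{\tau_{n+1}}\subseteq\mathcal C^\pi_{\tau_n}\cup\{R_n\}$ otherwise, and that the total size of the content is always at most $x$. Its long-run fault probability is $$P(\pi,x)=\limsup_{T\to\infty}\frac1T\,\mathbb E\Big[\sum_{\tau_n\in[0,T]}\mathbf 1[R_n\notin\mathcal C^\pi_{\tau_n}]\Big].$$ The static policy permanently keeps the documents $1,\dots,k(x)$, where $k(x)$ is the largest $k$ with $\sum_{i\le k}s_i\le x$; let $P_s(x)$ be its long-run fault probability. **Theorem.** Assume that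 the sizes $s_i$ take only finitely many values, that the documents are enumerated so that $q_1/s_1\ge q_2/s_2\ge\cdots$, and that $\sum_{j>i}q_j\sim\sum_{j\ge i}q_j$ as $i\to\infty$. Then the static policy is asymptotically optimal: $$\lim_{x\to\infty}\frac{\inf_{\pi\in\mathcal P_c(x)}P(\pi,x)}{P_s(x)}=1 .$$ -/

import Mathlib

open MeasureTheory ProbabilityTheory Filter Topology
open scoped ENNReal NNReal unitInterval

noncomputable section

/-! ### Poisson request times -/

/-- The points `τ` (with `τ 0 ≤ 0 < τ 1`) with the origin inserted between `τ 0` and `τ 1`. -/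
def withOrigin {Ω : Type*} (τ : ℤ → Ω → ℝ) (n : ℤ) (ω : Ω) : ℝ :=
  if 0 < n then τ n ω else if n = 0 then 0 else τ (n + 1) ω

/-- `τ` enumerates, in increasing order and with `τ 0 ≤ 0 < τ 1`, a Poisson point process of
unit rate on the line: after insertion of the origin, all the spacings
(so `τ 1`, `-τ 0`, and `τ (n + 1) - τ n` for `n ≠ 0`) are independent and
exponentially distributed with mean one. -/
structure IsUnitPoisson {Ω : Type*} [MeasurableSpace Ω] (μ : Measure Ω)
    (τ : ℤ → Ω → ℝ) : Prop where
  measurable : ∀ n, Measurable (τ n)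
  law : ∀ n : ℤ, HasLaw (fun ω => withOrigin τ (n + 1) ω - withOrigin τ n ω) (expMeasure 1) μ
  indep : iIndepFun (fun (n : ℤ) ω => withOrigin τ (n + 1) ω - withOrigin τ n ω) μ

/-! ### Stationary semi-Markov processes -/

/-- The history up to the `n`-th jump: the jump times `T k` and the states `J (T k)`, `k ≤ n`. -/
abbrev jumpHistory {Ω : Type*} {M : ℕ} (T : ℤ → Ω → ℝ) (J : ℝ → Ω → Fin M) (n : ℤ) :
    MeasurableSpace Ω :=
  ⨆ k : Set.Iic n, MeasurableSpace.comap (T k) inferInstance ⊔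
    MeasurableSpace.comap (fun ω => J (T k ω) ω) inferInstance

/-- `J` is a stationary semi-Markov process with finitely many states and jump times
`⋯ < T 0 ≤ 0 < T 1 < ⋯`. The states at the jump times form a chain with irreducible transition
matrix `p`, and the time spent in state `i` before a jump to state `j` has law `F i j`, a
law on the positive half-line with finite mean.
The labelling `T 0 ≤ 0 < T 1` biases the interval that contains the origin, so
the transition rule `markov` is imposed from the first jump after the origin on. -/
structure IsStationarySemiMarkov {Ω : Type*} [MeasurableSpace Ω] (μ : Measure Ω) {M : ℕ}
    (p : Matrix (Fin M) (Fin M) ℝ) (F : Fin M → Fin M → Measure ℝ)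
    (T : ℤ → Ω → ℝ) (J : ℝ → Ω → Fin M) : Prop where
  /-- `p` is a stochastic matrix (nonnegative by irreducibility). -/
  row_sum : ∀ i, ∑ j, p i j = 1
  irreducible : p.IsIrreducible
  sojourn_prob : ∀ i j, IsProbabilityMeasure (F i j)
  sojourn_pos : ∀ i j, F i j (Set.Iic 0) = 0
  sojourn_mean : ∀ i j, Integrable (fun t : ℝ => t) (F i j)
  measurable_T : ∀ n, Measurable (T n)
  measurable_J : Measurable (fun z : ℝ × Ω => J z.1 z.2)
  strictMono : ∀ᵐ ω ∂μ, StrictMono (fun n => T n ω)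
  origin : ∀ᵐ ω ∂μ, T 0 ω ≤ 0 ∧ 0 < T 1 ω
  /-- `J` is constant on each `[T n, T (n + 1))`, and these intervals cover the line. -/
  piecewise : ∀ᵐ ω ∂μ, ∀ t : ℝ, ∃ n : ℤ,
    T n ω ≤ t ∧ t < T (n + 1) ω ∧ J t ω = J (T n ω) ω
  /-- Given the history up to the `n`-th jump, the next state is `j` and the time until
  the next jump is in `B` with probability `p i j * F i j B`, where `i` is the current state. -/
  markov : ∀ n : ℤ, 1 ≤ n → ∀ (j : Fin M) (B : Set ℝ), MeasurableSet B →
    μ⟦{ω | J (T (n + 1) ω) ω = j ∧ T (n + 1) ω - T n ω ∈ B} | jumpHistory T J n⟧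
      =ᵐ[μ] fun ω => p (J (T n ω) ω) j * (F (J (T n ω) ω) j).real B
  /-- The law of the process `J` is invariant under shifts of time. -/
  stationary : ∀ h : ℝ,
    μ.map (fun ω (t : ℝ) => J (t + h) ω) = μ.map (fun ω (t : ℝ) => J t ω)

/-! ### The semi-Markov modulated request process -/

/-- The information carried by the modulating process: all jump times and all states. -/
abbrev modulatingInfo {Ω : Type*} {M : ℕ} (T : ℤ → Ω → ℝ) (J : ℝ → Ω → Fin M) :
    MeasurableSpace Ω :=
  (⨆ n : ℤ, MeasurableSpace.comap (T n) inferInstance) ⊔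
    ⨆ t : ℝ, MeasurableSpace.comap (J t) inferInstance

/-- The information carried by the request times. -/
abbrev arrivalInfo {Ω : Type*} (τ : ℤ → Ω → ℝ) : MeasurableSpace Ω :=
  ⨆ n : ℤ, MeasurableSpace.comap (τ n) inferInstance

/-- `R n` is the document requested at time `τ n`. The request times are the points
of a unit-rate Poisson process independent of the stationary semi-Markov process `J`, and, given
`J` and the request times, the requests are independent, the one made at time `τ l`
having the probability mass function `Q r` when `J (τ l) = r`.
Documents are numbered `0, 1, 2, …`. -/
structure IsModulatedRequestProcess {Ω : Type*} [MeasurableSpace Ω] (μ : Measure Ω) {M : ℕ}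
    (p : Matrix (Fin M) (Fin M) ℝ) (F : Fin M → Fin M → Measure ℝ) (Q : Fin M → PMF ℕ)
    (T : ℤ → Ω → ℝ) (J : ℝ → Ω → Fin M) (τ : ℤ → Ω → ℝ) (R : ℤ → Ω → ℕ) : Prop where
  semiMarkov : IsStationarySemiMarkov μ p F T J
  poisson : IsUnitPoisson μ τ
  indep : Indep (modulatingInfo T J) (arrivalInfo τ) μ
  measurable_R : ∀ n, Measurable (R n)
  conditional_law : ∀ (S : Finset ℤ) (i : ℤ → ℕ),
    μ⟦{ω | ∀ l ∈ S, R l ω = i l} | modulatingInfo T J ⊔ arrivalInfo τ⟧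
      =ᵐ[μ] fun ω => ∏ l ∈ S, (Q (J (τ l ω) ω) (i l)).toReal

/-- The marginal popularity `q i = P[R n = i]` of document `i`, which by stationarity is the
same for all `n`. -/
def popularity {Ω : Type*} [MeasurableSpace Ω] (μ : Measure Ω) (R : ℤ → Ω → ℕ) (i : ℕ) : ℝ :=
  μ.real {ω | R 1 ω = i}

/-! ### Caching policies -/

/-- A caching policy for a cache of size `x`, document `i` having size `s i`.
`next u h C r` is the content of the cache after a request for document `r` that
found the content `C`; here `h` lists the contents and requests at all earlier request times
(latest first), and `u` is a uniform random seed, independent of everything else,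
which allows for randomized decisions. A policy that ignores `u` is deterministic.
* On a hit the content stays unchanged.
* On a fault, documents are evicted from the old content together with the missing document
  (possibly the missing document itself).
* The total size of the content never exceeds `x`. -/
structure CachingPolicy (s : ℕ → ℝ) (x : ℝ≥0) where
  init : I → Finset ℕ
  next : I → List (Finset ℕ × ℕ) → Finset ℕ → ℕ → Finset ℕ
  measurable_init : ∀ D, MeasurableSet {u | init u = D}
  measurable_next : ∀ h C r D, MeasurableSet {u | next u h C r = D}
  hit : ∀ u h C r, r ∈ C → next u h C r = C
  fault : ∀ u h C r, r ∉ C → next u h C r ⊆ insert r C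
  size_init : ∀ u, ∑ i ∈ init u, s i ≤ x
  size_next : ∀ u h C r, ∑ i ∈ C, s i ≤ x → ∑ i ∈ next u h C r, s i ≤ x

/-- The history and the cache content met by request number `k + 1`, when `r k` is the
document asked for by request number `k + 1`. -/
def CachingPolicy.state {s : ℕ → ℝ} {x : ℝ≥0} (π : CachingPolicy s x) (u : I) (r : ℕ → ℕ) :
    ℕ → List (Finset ℕ × ℕ) × Finset ℕ
  | 0 => ([], π.init u)
  | k + 1 =>
    let st := CachingPolicy.state π u r k
    ((st.2, r k) :: st.1, π.next u st.1 st.2 (r k))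

/-- The cache content at the time `τ n` of the `n`-th request, `n = k + 1 ≥ 1`. -/
def CachingPolicy.content {s : ℕ → ℝ} {x : ℝ≥0} (π : CachingPolicy s x) (u : I) (r : ℕ → ℕ)
    (k : ℕ) : Finset ℕ :=
  (π.state u r k).2

open Classical in
/-- The number of cache faults in the time interval `[0, t]`. -/
def CachingPolicy.faults {Ω : Type*} {s : ℕ → ℝ} {x : ℝ≥0} (π : CachingPolicy s x)
    (τ : ℤ → Ω → ℝ) (R : ℤ → Ω → ℕ) (t : ℝ) (u : I) (ω : Ω) : ℝ≥0∞ :=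
  ∑' k : ℕ, if τ (k + 1) ω ∈ Set.Icc 0 t ∧
      R (k + 1) ω ∉ π.content u (fun l : ℕ => R (l + 1) ω) k then 1 else 0

/-- The long-run cache fault probability: the upper limit, as `t → ∞`, of the expected number of
faults in `[0, t]` divided by `t`. -/
def CachingPolicy.faultProb {Ω : Type*} [MeasurableSpace Ω] {s : ℕ → ℝ} {x : ℝ≥0}
    (π : CachingPolicy s x) (μ : Measure Ω) (τ : ℤ → Ω → ℝ) (R : ℤ → Ω → ℕ) : ℝ≥0∞ :=
  limsup (fun t : ℝ => (∫⁻ u : I, ∫⁻ ω, π.faults τ R t u ω ∂μ) / ENNReal.ofReal t) atTop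

/-! ### The static policy -/

/-- The largest `k` such that the documents `0, …, k - 1` fit together into a cache of size `x`. -/
def staticCount (s : ℕ → ℝ) (x : ℝ≥0) : ℕ :=
  sSup {k : ℕ | ∑ i ∈ Finset.range k, s i ≤ x}

theorem sum_range_staticCount_le (s : ℕ → ℝ) (x : ℝ≥0) :
    ∑ i ∈ Finset.range (staticCount s x), s i ≤ x := by
  have h0 : (0 : ℕ) ∈ {k : ℕ | ∑ i ∈ Finset.range k, s i ≤ x} := by simp
  by_cases hb : BddAbove {k : ℕ | ∑ i ∈ Finset.range k, s i ≤ x}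
  · exact Nat.sSup_mem ⟨0, h0⟩ hb
  · have h : staticCount s x = 0 := by
      unfold staticCount
      rw [csSup_of_not_bddAbove hb]
      simp
    rw [h]
    exact h0

/-- The static policy: the documents of smallest index, as many as fit, are kept forever. -/
def staticPolicy (s : ℕ → ℝ) (x : ℝ≥0) : CachingPolicy s x where
  init _ := Finset.range (staticCount s x)
  next _ _ C _ := C
  measurable_init _ := MeasurableSet.const _
  measurable_next _ _ _ _ := MeasurableSet.const _
  hit _ _ _ _ _ := rfl
  fault _ _ C r _ := Finset.subset_insert r C
  size_init _ := sum_range_staticCount_le s x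
  size_next _ _ _ _ h := h

end

set_option linter.unusedSectionVars false

noncomputable section

/-! ### Sums of orthogonal random variables -/

/-! Let `S(x)` be the popularity `∑ q_j`, `j ≥ k(x)`, that the static policy leaves out. Its fault
probability is at most `S(x)` (`faultProb_staticPolicy_le`): a request misses the static content
with probability `S(x)` independently of its time, and the mean number of Poisson points in `[0, t]`
is at most `t`. The static policy is itself admissible, so only a lower bound is needed: for every
`ε` and all large `x`, every policy has fault probability at least `(1 - ε)^3 S(x)`
(`eventually_faultProb_ge`).

The difficulty is that a content depends on past requests, hence is correlated with the modulating
state. The remedy is to cut the requests into blocks of a length `B` that is fixed before `x`.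
Within a block the content gains only documents requested in that block, so a request for a document
missing at the start of the block is a fault unless it is a repetition. For documents of index at
least `i₀`, `B q_i` is so small that repetitions are negligible. Given the requests before the
block, document `i` is requested at the rate `Q_J(i)` and not `q_i`, but over a long block the
states average out: almost surely the rates sum to at least `q_i` times a random factor that does
not depend on `i` and has mean close to `B` (`ae_sum_requestRate_ge`). Hence the content may be
correlated with the state in any way, and neither mixing nor aperiodicity is needed
(`block_faults_ge`). What remains is deterministic: a content that fits misses popularity at least
`(1 - ε) S(x)` among the documents of index at least `i₀` (`eventually_exists_missed_ge`). This is
the fractional knapsack bound, whose boundary term `O(q_{k(x)})` is `o(S(x))` by the tail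
hypothesis.

The averaging over a block, uniform in its position (`exists_block_deviation`), joins two laws of
large numbers in `L¹`. Sampling a function at Poisson points differs from integrating it over time
by a sum of orthogonal increments, of order `√B` (`integral_abs_sampling_le`). The time spent in a
state has an asymptotic frequency (`tendsto_occupation`): the Poisson equation of the embedded chain
splits the centred occupation time into a martingale and a telescoping sum, after truncation of the
sojourn times, of which only the means are finite. Stationarity and independence carry this over to
windows that start at a random arrival time. -/

theorem integral_abs_sum_le_of_orthogonal {Ω : Type*} [MeasurableSpace Ω] {μ : Measure Ω}
    [IsProbabilityMeasure μ] {ι : Type*} (s : Finset ι) (Z : ι → Ω → ℝ)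
    (hZ : ∀ k ∈ s, MemLp (Z k) 2 μ)
    (horth : ∀ i ∈ s, ∀ j ∈ s, i ≠ j → ∫ ω, Z i ω * Z j ω ∂μ = 0)
    {V : ℝ} (hV : ∀ k ∈ s, ∫ ω, Z k ω * Z k ω ∂μ ≤ V) :
    ∫ ω, |∑ k ∈ s, Z k ω| ∂μ ≤ √(s.card * V) := by
  have hS : MemLp (fun ω => ∑ k ∈ s, Z k ω) 2 μ := memLp_finsetSum s hZ
  have hint : ∀ i ∈ s, ∀ j ∈ s, Integrable (fun ω => Z i ω * Z j ω) μ := fun i hi j hj =>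
    (hZ i hi).integrable_mul (hZ j hj)
  have hsq : ∫ ω, (∑ k ∈ s, Z k ω) ^ 2 ∂μ ≤ s.card * V := by
    have h1 : ∀ ω, (∑ k ∈ s, Z k ω) ^ 2 = ∑ i ∈ s, ∑ j ∈ s, Z i ω * Z j ω := fun ω => by
      rw [sq, Finset.sum_mul_sum]
    simp_rw [h1]
    rw [integral_finsetSum _ fun i hi => integrable_finsetSum _ fun j hj => hint i hi j hj]
    calc ∑ i ∈ s, ∫ ω, ∑ j ∈ s, Z i ω * Z j ω ∂μ
        = ∑ i ∈ s, ∑ j ∈ s, ∫ ω, Z i ω * Z j ω ∂μ :=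
          Finset.sum_congr rfl fun i hi => integral_finsetSum _ fun j hj => hint i hi j hj
      _ = ∑ i ∈ s, ∫ ω, Z i ω * Z i ω ∂μ := by
          refine Finset.sum_congr rfl fun i hi => ?_
          exact Finset.sum_eq_single_of_mem i hi fun j hj hji => horth i hi j hj hji.symm
      _ ≤ ∑ i ∈ s, V := Finset.sum_le_sum hV
      _ = s.card * V := by simp
  refine Real.le_sqrt_of_sq_le ((?_ : _ ≤ _).trans hsq)
  -- Nonnegativity of the variance of the absolute value is the comparison of the `L¹` and `L²`
  -- norms.
  have hv := variance_nonneg |fun ω => ∑ k ∈ s, Z k ω| μ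
  rw [variance_eq_sub hS.abs] at hv
  simp only [Pi.pow_apply, Pi.abs_apply, sq_abs] at hv
  linarith

/-- Fubini for the product law. It replaces conditional expectations in the Poisson part: `X` is the
past, `Y` the next spacing, and the increment has mean zero once the past is frozen. -/
theorem IndepFun.integral_eq_zero_of_section {Ω α β : Type*} [MeasurableSpace Ω]
    [MeasurableSpace α] [MeasurableSpace β] {μ : Measure Ω} [IsProbabilityMeasure μ]
    {X : Ω → α} {Y : Ω → β} (hX : Measurable X) (hY : Measurable Y) (hXY : IndepFun X Y μ)
    {H : α → β → ℝ} (hH : Measurable (Function.uncurry H))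
    (hint : Integrable (fun ω => H (X ω) (Y ω)) μ)
    (hzero : ∀ x, ∫ y, H x y ∂(μ.map Y) = 0) : ∫ ω, H (X ω) (Y ω) ∂μ = 0 := by
  have hmap := (indepFun_iff_map_prod_eq_prod_map_map hX.aemeasurable hY.aemeasurable).1 hXY
  have hm : Measurable fun ω => (X ω, Y ω) := hX.prodMk hY
  have := Measure.isProbabilityMeasure_map (μ := μ) hX.aemeasurable
  have := Measure.isProbabilityMeasure_map (μ := μ) hY.aemeasurable
  have hint' : Integrable (Function.uncurry H) ((μ.map X).prod (μ.map Y)) := by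
    rw [← hmap]
    exact (integrable_map_measure hH.aestronglyMeasurable hm.aemeasurable).2 hint
  calc ∫ ω, H (X ω) (Y ω) ∂μ = ∫ z, Function.uncurry H z ∂(μ.map fun ω => (X ω, Y ω)) :=
        (integral_map hm.aemeasurable hH.aestronglyMeasurable).symm
    _ = ∫ x, ∫ y, H x y ∂(μ.map Y) ∂(μ.map X) := by
        rw [hmap, integral_prod _ hint']; rfl
    _ = 0 := by simp [hzero]

/-! ### The exponential law -/

instance isProbabilityMeasure_expMeasure_one : IsProbabilityMeasure (expMeasure 1) :=
  isProbabilityMeasure_expMeasure one_pos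

theorem expMeasure_one_Iic {x : ℝ} (hx : 0 ≤ x) :
    expMeasure 1 (Set.Iic x) = ENNReal.ofReal (1 - Real.exp (-x)) := by
  rw [← ofReal_cdf, cdf_expMeasure_eq one_pos, if_pos hx, one_mul]

theorem expMeasure_one_Ici {x : ℝ} (hx : 0 ≤ x) :
    expMeasure 1 (Set.Ici x) = ENNReal.ofReal (Real.exp (-x)) := by
  have : NullSingletonClass (expMeasure 1) :=
    ⟨fun u => withDensity_absolutelyContinuous _ _ (measure_singleton u)⟩
  rw [← measure_congr Ioi_ae_eq_Ici, ← Set.compl_Iic, prob_compl_eq_one_sub measurableSet_Iic,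
    expMeasure_one_Iic hx, ← ENNReal.ofReal_one, ← ENNReal.ofReal_sub]
  · simp
  · simp [hx]

theorem expMeasure_one_ae_pos : ∀ᵐ u ∂(expMeasure 1), 0 < u := by
  rw [ae_iff]
  have h : {a : ℝ | ¬ 0 < a} = Set.Iic 0 := by ext; simp
  rw [h, expMeasure_one_Iic le_rfl]
  simp

theorem lintegral_expMeasure_one {g : ℝ → ℝ≥0∞} (hg : Measurable g) :
    ∫⁻ u, g u ∂(expMeasure 1) =
      ∫⁻ u in Set.Ici 0, ENNReal.ofReal (Real.exp (-u)) * g u := by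
  have h : expMeasure 1 = volume.withDensity (exponentialPDF 1) := rfl
  rw [h, lintegral_withDensity_eq_lintegral_mul _ (by
    exact (measurable_exponentialPDFReal 1).ennreal_ofReal) hg,
    ← lintegral_indicator measurableSet_Ici]
  refine lintegral_congr fun u => ?_
  by_cases hu : 0 ≤ u <;> simp [exponentialPDF_eq, hu]

/-- For `e` exponential of mean one, `∫ g` over `(0, e]` and `g e` have the same mean. -/
theorem lintegral_lintegral_Ioc_expMeasure {g : ℝ → ℝ≥0∞} (hg : Measurable g) :
    ∫⁻ u, (∫⁻ w in Set.Ioc 0 u, g w) ∂(expMeasure 1) = ∫⁻ u, g u ∂(expMeasure 1) := by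
  have hm : MeasurableSet {z : ℝ × ℝ | 0 < z.2 ∧ z.2 ≤ z.1} :=
    (measurableSet_lt measurable_const measurable_snd).inter
      (measurableSet_le measurable_snd measurable_fst)
  have h1 : ∀ u, ∫⁻ w in Set.Ioc 0 u, g w =
      ∫⁻ w, Function.uncurry (fun u w => ({z : ℝ × ℝ | 0 < z.2 ∧ z.2 ≤ z.1}.indicator
        (fun z => g z.2) (u, w))) (u, w) := fun u => by
    rw [← lintegral_indicator measurableSet_Ioc]
    rfl
  simp_rw [h1]
  rw [lintegral_lintegral_swap]
  swap
  · exact ((hg.comp measurable_snd).indicator hm).aemeasurable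
  rw [lintegral_expMeasure_one hg, ← lintegral_indicator measurableSet_Ici]
  refine lintegral_congr_ae ?_
  have h0 : ∀ᵐ w : ℝ, w ≠ 0 := by simp [ae_iff]
  filter_upwards [h0] with w hw
  rcases lt_or_gt_of_ne hw with h | h
  · simp [Set.indicator, h.not_gt, h.not_ge]
  · have h2 : ∀ u, Function.uncurry (fun u w => ({z : ℝ × ℝ | 0 < z.2 ∧ z.2 ≤ z.1}.indicator
        (fun z => g z.2) (u, w))) (u, w) = (Set.Ici w).indicator (fun _ => g w) u := fun u => by
      simp [Set.indicator, h]
    simp_rw [h2]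
    rw [lintegral_indicator measurableSet_Ici, setLIntegral_const, expMeasure_one_Ici h.le,
      Set.indicator_of_mem (by simpa using h.le), mul_comm]

theorem lintegral_id_expMeasure : ∫⁻ u, ENNReal.ofReal u ∂(expMeasure 1) = 1 := by
  have h := lintegral_lintegral_Ioc_expMeasure (g := fun _ => 1) measurable_const
  simpa using h

theorem memLp_two_id_expMeasure : MemLp (fun u : ℝ => u) 2 (expMeasure 1) := by
  rw [memLp_two_iff_integrable_sq (f := fun u : ℝ => u) measurable_id.aestronglyMeasurable]
  refine ⟨(measurable_id.pow_const 2).aestronglyMeasurable, ?_⟩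
  rw [hasFiniteIntegral_iff_ofReal (ae_of_all _ fun u => sq_nonneg u)]
  -- The choice `g u = 2u` has primitive `u²`, so the second moment is twice the mean.
  have h := lintegral_lintegral_Ioc_expMeasure (g := fun u => ENNReal.ofReal (2 * u))
    (by fun_prop)
  have h1 : ∀ᵐ u ∂(expMeasure 1),
      ENNReal.ofReal (u ^ 2) = ∫⁻ w in Set.Ioc 0 u, ENNReal.ofReal (2 * w) := by
    filter_upwards [expMeasure_one_ae_pos] with u hu
    rw [← ofReal_integral_eq_lintegral_ofReal, ← intervalIntegral.integral_of_le hu.le]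
    · congr 1
      rw [intervalIntegral.integral_const_mul, integral_id]; ring
    · exact (by fun_prop : Continuous fun w : ℝ => 2 * w).integrableOn_Ioc
    · refine (ae_restrict_iff' measurableSet_Ioc).2 (ae_of_all _ fun w hw => ?_)
      have := hw.1
      simp only [Pi.zero_apply]; positivity
  rw [lintegral_congr_ae h1, h]
  simp_rw [ENNReal.ofReal_mul zero_le_two]
  rw [lintegral_const_mul _ (by fun_prop), lintegral_id_expMeasure]
  simp

/-! ### Sampling a function at the points of a Poisson process -/

theorem abs_primitive_sub_le {f : ℝ → ℝ} (hf : Measurable f) (hf1 : ∀ x, |f x| ≤ 1) (x y : ℝ) :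
    |(∫ s in (0 : ℝ)..y, f s) - ∫ s in (0 : ℝ)..x, f s| ≤ |y - x| := by
  have hi : ∀ a b : ℝ, IntervalIntegrable f volume a b := fun a b =>
    (intervalIntegrable_const (c := (1 : ℝ))).mono_fun' hf.aestronglyMeasurable
      (ae_of_all _ hf1)
  rw [intervalIntegral.integral_interval_sub_left (hi _ _) (hi _ _)]
  simpa using intervalIntegral.norm_integral_le_of_norm_le_const (C := 1) (f := f)
    (a := x) (b := y) fun s _ => hf1 s

theorem continuous_primitive_of_bounded {f : ℝ → ℝ} (hf : Measurable f) (hf1 : ∀ x, |f x| ≤ 1) :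
    Continuous fun y => ∫ s in (0 : ℝ)..y, f s := by
  refine LipschitzWith.continuous (K := 1) (LipschitzWith.of_dist_le_mul fun x y => ?_)
  simpa [Real.dist_eq] using abs_primitive_sub_le hf hf1 y x

/-- The Poisson compensator over one spacing: `lintegral_lintegral_Ioc_expMeasure` for `w ↦ f (x +
w)` says that `f` at the next point and `f` integrated up to that point have the same mean. -/
theorem integral_sampling_expMeasure {f : ℝ → ℝ} (hf : Measurable f)
    (hf0 : ∀ x, 0 ≤ f x) (hf1 : ∀ x, f x ≤ 1) (x : ℝ) :
    ∫ u, (f (x + u) - (∫ s in (0 : ℝ)..(x + u), f s) + ∫ s in (0 : ℝ)..x, f s)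
      ∂(expMeasure 1) = 0 := by
  have habs : ∀ x, |f x| ≤ 1 := fun x => abs_le.2 ⟨by linarith [hf0 x], hf1 x⟩
  have hi : ∀ a b : ℝ, IntervalIntegrable f volume a b := fun a b =>
    (intervalIntegrable_const (c := (1 : ℝ))).mono_fun' hf.aestronglyMeasurable
      (ae_of_all _ habs)
  have hcont := continuous_primitive_of_bounded hf habs
  have hu : Integrable (fun u : ℝ => u) (expMeasure 1) :=
    memLp_two_id_expMeasure.integrable one_le_two
  have hint1 : Integrable (fun u => f (x + u)) (expMeasure 1) :=
    (integrable_const (1 : ℝ)).mono' (hf.comp (measurable_const_add x)).aestronglyMeasurable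
      (ae_of_all _ fun u => habs _)
  have hint2 : Integrable (fun u => (∫ s in (0 : ℝ)..(x + u), f s) - ∫ s in (0 : ℝ)..x, f s)
      (expMeasure 1) := by
    refine hu.abs.mono' ?_ (ae_of_all _ fun u => ?_)
    · exact ((hcont.comp (continuous_const_add x)).sub continuous_const).aestronglyMeasurable
    · simpa using abs_primitive_sub_le hf habs x (x + u)
  have key : ∫ u, ((∫ s in (0 : ℝ)..(x + u), f s) - ∫ s in (0 : ℝ)..x, f s) ∂(expMeasure 1) =
      ∫ u, f (x + u) ∂(expMeasure 1) := by
    have h := lintegral_lintegral_Ioc_expMeasure (g := fun u => ENNReal.ofReal (f (x + u)))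
      (by fun_prop)
    have h1 : ∀ᵐ u ∂(expMeasure 1),
        ENNReal.ofReal ((∫ s in (0 : ℝ)..(x + u), f s) - ∫ s in (0 : ℝ)..x, f s) =
          ∫⁻ w in Set.Ioc 0 u, ENNReal.ofReal (f (x + w)) := by
      filter_upwards [expMeasure_one_ae_pos] with u hu
      rw [intervalIntegral.integral_interval_sub_left (hi _ _) (hi _ _)]
      have h2 : ∫ s in x..(x + u), f s = ∫ s in (0 : ℝ)..u, f (x + s) := by
        rw [intervalIntegral.integral_comp_add_left]; simp
      rw [h2, intervalIntegral.integral_of_le hu.le, ofReal_integral_eq_lintegral_ofReal]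
      · exact ((integrable_const (1 : ℝ)).mono'
          (hf.comp (measurable_const_add x)).aestronglyMeasurable
          (ae_of_all _ fun u => habs _))
      · exact ae_of_all _ fun w => hf0 _
    rw [integral_eq_lintegral_of_nonneg_ae, integral_eq_lintegral_of_nonneg_ae,
      lintegral_congr_ae h1, h]
    · exact ae_of_all _ fun u => hf0 _
    · exact hint1.1
    · filter_upwards [expMeasure_one_ae_pos] with u hu
      rw [intervalIntegral.integral_interval_sub_left (hi _ _) (hi _ _)]
      exact intervalIntegral.integral_nonneg (by linarith) fun s _ => hf0 s
    · exact hint2.1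
  have : ∀ u, f (x + u) - (∫ s in (0 : ℝ)..(x + u), f s) + (∫ s in (0 : ℝ)..x, f s) =
      f (x + u) - ((∫ s in (0 : ℝ)..(x + u), f s) - ∫ s in (0 : ℝ)..x, f s) := fun u => by ring
  simp_rw [this]
  rw [integral_sub hint1 hint2, key, sub_self]

/-- The mean of `(1 + |u|) ^ 2` under the exponential law of mean one. -/
def samplingVariance : ℝ := ∫ u, (1 + |u|) * (1 + |u|) ∂(expMeasure 1)

section Sampling

variable {Ω : Type*} [MeasurableSpace Ω] {μ : Measure Ω} [IsProbabilityMeasure μ]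
  {e : ℕ → Ω → ℝ} {f : ℝ → ℝ}

/-- The compensated increment of `f` sampled at the `(k + 1)`-st partial sum. -/
def samplingIncrement (f : ℝ → ℝ) (x u : ℝ) : ℝ :=
  f (x + u) - (∫ s in (0 : ℝ)..(x + u), f s) + ∫ s in (0 : ℝ)..x, f s

theorem measurable_samplingIncrement (hf : Measurable f) (hf1 : ∀ x, |f x| ≤ 1) :
    Measurable (Function.uncurry (samplingIncrement f)) := by
  have hc := (continuous_primitive_of_bounded hf hf1).measurable
  unfold samplingIncrement Function.uncurry
  exact ((hf.comp (measurable_fst.add measurable_snd)).sub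
    (hc.comp (measurable_fst.add measurable_snd))).add (hc.comp measurable_fst)

theorem abs_samplingIncrement_le (hf : Measurable f) (hf1 : ∀ x, |f x| ≤ 1) (x u : ℝ) :
    |samplingIncrement f x u| ≤ 1 + |u| := by
  have h1 := hf1 (x + u)
  have h2 := abs_primitive_sub_le hf hf1 x (x + u)
  rw [add_sub_cancel_left] at h2
  unfold samplingIncrement
  rw [abs_le] at *
  constructor <;> linarith [h1.1, h1.2, h2.1, h2.2]

theorem memLp_one_add_abs_expMeasure : MemLp (fun u : ℝ => 1 + |u|) 2 (expMeasure 1) := by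
  have h1 : MemLp (fun _ : ℝ => (1 : ℝ)) 2 (expMeasure 1) := memLp_const 1
  have h2 : MemLp (fun u : ℝ => |u|) 2 (expMeasure 1) := memLp_two_id_expMeasure.abs
  exact h1.add h2

theorem memLp_one_add_abs (he : ∀ n, Measurable (e n))
    (hlaw : ∀ n, HasLaw (e n) (expMeasure 1) μ) (k : ℕ) :
    MemLp (fun ω => 1 + |e k ω|) 2 μ := by
  have h := memLp_one_add_abs_expMeasure
  rw [← (hlaw k).map_eq] at h
  exact (memLp_map_measure_iff h.1 (he k).aemeasurable).1 h

theorem memLp_samplingIncrement (he : ∀ n, Measurable (e n))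
    (hlaw : ∀ n, HasLaw (e n) (expMeasure 1) μ) (hf : Measurable f) (hf1 : ∀ x, |f x| ≤ 1)
    {X : Ω → ℝ} (hX : Measurable X) (k : ℕ) :
    MemLp (fun ω => samplingIncrement f (X ω) (e k ω)) 2 μ := by
  have h2 := memLp_one_add_abs he hlaw k
  refine h2.mono ((measurable_samplingIncrement hf hf1).comp
    (hX.prodMk (he k))).aestronglyMeasurable (ae_of_all _ fun ω => ?_)
  rw [Real.norm_eq_abs, Real.norm_eq_abs]
  exact (abs_samplingIncrement_le hf hf1 _ _).trans (le_abs_self _)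

theorem indepFun_past_next (he : ∀ n, Measurable (e n)) (hindep : iIndepFun e μ) (j : ℕ)
    {β : Type*} [MeasurableSpace β] {φ : (Finset.range j → ℝ) → β} (hφ : Measurable φ) :
    IndepFun (fun ω => φ fun k => e k ω) (e j) μ := by
  have h := hindep.indepFun_finset (Finset.range j) {j} (by simp) he
  exact h.comp hφ (measurable_pi_apply (⟨j, by simp⟩ : ({j} : Finset ℕ)))

theorem sum_range_eq_sum_subtype (v : ℕ → ℝ) (i j : ℕ) (hij : i ≤ j) :
    ∑ k ∈ Finset.range i, v k = ∑ k : Finset.range j, if (k : ℕ) < i then v k else 0 := by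
  rw [Finset.sum_coe_sort (Finset.range j) fun k => if k < i then v k else 0,
    ← Finset.sum_filter]
  congr 1
  ext k
  simp only [Finset.mem_range, Finset.mem_filter]
  omega

/-- The past enters through two functions of the first `j` spacings, a weight and a starting point.
The weight one yields mean zero, and an earlier increment as weight yields orthogonality. -/
theorem integral_samplingIncrement (he : ∀ n, Measurable (e n))
    (hlaw : ∀ n, HasLaw (e n) (expMeasure 1) μ) (hindep : iIndepFun e μ)
    (hf : Measurable f) (hf0 : ∀ x, 0 ≤ f x) (hf1 : ∀ x, f x ≤ 1) (j : ℕ)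
    {φ : (Finset.range j → ℝ) → ℝ × ℝ} (hφ : Measurable φ)
    (hint : Integrable (fun ω => (φ fun k => e k ω).1 *
      samplingIncrement f (φ fun k => e k ω).2 (e j ω)) μ) :
    ∫ ω, (φ fun k => e k ω).1 * samplingIncrement f (φ fun k => e k ω).2 (e j ω) ∂μ = 0 := by
  have habs : ∀ x, |f x| ≤ 1 := fun x => abs_le.2 ⟨by linarith [hf0 x], hf1 x⟩
  have hX : Measurable fun ω => φ fun k : Finset.range j => e k ω :=
    hφ.comp (measurable_pi_lambda _ fun k => he k)
  refine IndepFun.integral_eq_zero_of_section (H := fun z u => z.1 * samplingIncrement f z.2 u)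
    hX (he j) (indepFun_past_next he hindep j hφ) ?_ hint fun z => ?_
  · exact (measurable_fst.comp measurable_fst).mul ((measurable_samplingIncrement hf habs).comp
      ((measurable_snd.comp measurable_fst).prodMk measurable_snd))
  · rw [(hlaw j).map_eq, integral_const_mul]
    unfold samplingIncrement
    rw [integral_sampling_expMeasure hf hf0 hf1, mul_zero]

theorem integral_samplingIncrement_sum (he : ∀ n, Measurable (e n))
    (hlaw : ∀ n, HasLaw (e n) (expMeasure 1) μ) (hindep : iIndepFun e μ)
    (hf : Measurable f) (hf0 : ∀ x, 0 ≤ f x) (hf1 : ∀ x, f x ≤ 1) (j : ℕ) :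
    ∫ ω, samplingIncrement f (∑ k ∈ Finset.range j, e k ω) (e j ω) ∂μ = 0 := by
  have habs : ∀ x, |f x| ≤ 1 := fun x => abs_le.2 ⟨by linarith [hf0 x], hf1 x⟩
  have h := integral_samplingIncrement he hlaw hindep hf hf0 hf1 j
    (φ := fun v => (1, ∑ k, v k)) (by fun_prop)
  have hs : ∀ ω, ∑ k : Finset.range j, e k ω = ∑ k ∈ Finset.range j, e k ω := fun ω =>
    Finset.sum_coe_sort (Finset.range j) fun k => e k ω
  simp only [one_mul, hs] at h
  exact h ((memLp_samplingIncrement he hlaw hf habs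
    (Finset.measurable_sum _ fun k _ => he k) j).integrable one_le_two)

theorem integral_samplingIncrement_mul (he : ∀ n, Measurable (e n))
    (hlaw : ∀ n, HasLaw (e n) (expMeasure 1) μ) (hindep : iIndepFun e μ)
    (hf : Measurable f) (hf0 : ∀ x, 0 ≤ f x) (hf1 : ∀ x, f x ≤ 1) {i j : ℕ} (hij : i < j) :
    ∫ ω, samplingIncrement f (∑ k ∈ Finset.range i, e k ω) (e i ω) *
      samplingIncrement f (∑ k ∈ Finset.range j, e k ω) (e j ω) ∂μ = 0 := by
  have habs : ∀ x, |f x| ≤ 1 := fun x => abs_le.2 ⟨by linarith [hf0 x], hf1 x⟩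
  have hi : ∀ i, MemLp (fun ω => samplingIncrement f (∑ k ∈ Finset.range i, e k ω) (e i ω)) 2 μ :=
    fun i => memLp_samplingIncrement he hlaw hf habs (Finset.measurable_sum _ fun k _ => he k) i
  have h := integral_samplingIncrement he hlaw hindep hf hf0 hf1 j
    (φ := fun v => (samplingIncrement f (∑ k : Finset.range j, if (k : ℕ) < i then v k else 0)
      (v ⟨i, Finset.mem_range.2 hij⟩), ∑ k, v k)) ?_
  · have hs : ∀ ω, ∑ k : Finset.range j, e k ω = ∑ k ∈ Finset.range j, e k ω := fun ω =>
      Finset.sum_coe_sort (Finset.range j) fun k => e k ω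
    have hs' : ∀ ω, (∑ k : Finset.range j, if (k : ℕ) < i then e k ω else 0) =
        ∑ k ∈ Finset.range i, e k ω := fun ω =>
      (sum_range_eq_sum_subtype (fun k => e k ω) i j hij.le).symm
    simp only [hs, hs'] at h
    exact h ((hi i).integrable_mul (hi j))
  · have h1 : Measurable fun v : Finset.range j → ℝ =>
        ∑ k : Finset.range j, if (k : ℕ) < i then v k else 0 := by
      refine Finset.measurable_sum _ fun k _ => ?_
      split_ifs
      · exact measurable_pi_apply k
      · exact measurable_const
    exact Measurable.prodMk ((measurable_samplingIncrement hf habs).comp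
      (h1.prodMk (measurable_pi_apply (⟨i, Finset.mem_range.2 hij⟩ : Finset.range j))))
      (Finset.measurable_sum _ fun k _ => measurable_pi_apply k)

/-- The integrals between consecutive points telescope, so the difference is the sum of `B`
orthogonal increments, each dominated by one plus its spacing. The bound depends neither on `f` nor
on `a`. -/
theorem integral_abs_sampling_le (he : ∀ n, Measurable (e n))
    (hlaw : ∀ n, HasLaw (e n) (expMeasure 1) μ) (hindep : iIndepFun e μ)
    (hf : Measurable f) (hf0 : ∀ x, 0 ≤ f x) (hf1 : ∀ x, f x ≤ 1) (a B : ℕ) :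
    ∫ ω, |∑ k ∈ Finset.Ico a (a + B), f (∑ l ∈ Finset.range (k + 1), e l ω) -
      ((∫ s in (0 : ℝ)..(∑ l ∈ Finset.range (a + B), e l ω), f s) -
        ∫ s in (0 : ℝ)..(∑ l ∈ Finset.range a, e l ω), f s)| ∂μ ≤
      √(B * samplingVariance) := by
  have habs : ∀ x, |f x| ≤ 1 := fun x => abs_le.2 ⟨by linarith [hf0 x], hf1 x⟩
  have hm : ∀ i, Measurable fun ω => ∑ k ∈ Finset.range i, e k ω := fun i =>
    Finset.measurable_sum _ fun k _ => he k
  have hi : ∀ i, MemLp (fun ω => samplingIncrement f (∑ k ∈ Finset.range i, e k ω) (e i ω)) 2 μ :=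
    fun i => memLp_samplingIncrement he hlaw hf habs (hm i) i
  have h := integral_abs_sum_le_of_orthogonal (μ := μ) (Finset.Ico a (a + B))
    (fun i ω => samplingIncrement f (∑ k ∈ Finset.range i, e k ω) (e i ω)) (fun i _ => hi i)
    (fun i _ j _ hij => ?_) (V := samplingVariance) fun i _ => ?_
  · rw [Nat.card_Ico, add_tsub_cancel_left] at h
    refine (integral_congr_ae (ae_of_all _ fun ω => ?_)).trans_le h
    have h1 : ∀ k, samplingIncrement f (∑ l ∈ Finset.range k, e l ω) (e k ω) =
        f (∑ l ∈ Finset.range (k + 1), e l ω) -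
          ((∫ s in (0 : ℝ)..(∑ l ∈ Finset.range (k + 1), e l ω), f s) -
            ∫ s in (0 : ℝ)..(∑ l ∈ Finset.range k, e l ω), f s) := fun k => by
      rw [Finset.sum_range_succ, samplingIncrement]; ring
    simp only [h1]
    rw [Finset.sum_sub_distrib, Finset.sum_Ico_sub (fun k =>
      ∫ s in (0 : ℝ)..(∑ l ∈ Finset.range k, e l ω), f s) (Nat.le_add_right a B)]
  · rcases lt_or_gt_of_ne hij with h | h
    · exact integral_samplingIncrement_mul he hlaw hindep hf hf0 hf1 h
    · simp_rw [mul_comm (samplingIncrement f (∑ k ∈ Finset.range i, e k _) _)]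
      exact integral_samplingIncrement_mul he hlaw hindep hf hf0 hf1 h
  · have h1 : samplingVariance = ∫ ω, (1 + |e i ω|) * (1 + |e i ω|) ∂μ := by
      rw [samplingVariance, ← (hlaw i).map_eq, integral_map (he i).aemeasurable]
      exact (by fun_prop : Continuous fun u : ℝ => (1 + |u|) * (1 + |u|)).aestronglyMeasurable
    rw [h1]
    have h2 := memLp_one_add_abs he hlaw i
    refine integral_mono ((hi i).integrable_mul (hi i)) (h2.integrable_mul h2) fun ω => ?_
    have := abs_samplingIncrement_le hf habs (∑ k ∈ Finset.range i, e k ω) (e i ω)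
    simp only
    rw [← abs_mul_abs_self]
    gcongr

/-- For `f = 1` the sampled sum is the number of points and the integral is the elapsed time. -/
theorem integral_abs_sum_sub_le (he : ∀ n, Measurable (e n))
    (hlaw : ∀ n, HasLaw (e n) (expMeasure 1) μ) (hindep : iIndepFun e μ) (a B : ℕ) :
    ∫ ω, |∑ l ∈ Finset.range (a + B), e l ω - ∑ l ∈ Finset.range a, e l ω - B| ∂μ ≤
      √(B * samplingVariance) := by
  have h := integral_abs_sampling_le he hlaw hindep (f := fun _ => 1) measurable_const
    (fun _ => zero_le_one) (fun _ => le_rfl) a B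
  refine (integral_congr_ae (ae_of_all _ fun ω => ?_)).trans_le h
  simp only [Finset.sum_const, Nat.card_Ico, add_tsub_cancel_left, nsmul_eq_mul, mul_one,
    intervalIntegral.integral_const, sub_zero, smul_eq_mul]
  rw [← abs_neg]
  congr 1
  ring

/-- The mean number of the first `n` Poisson points that lie in `[0, t]` is at most `t`. -/
theorem sum_measureReal_le (he : ∀ n, Measurable (e n))
    (hlaw : ∀ n, HasLaw (e n) (expMeasure 1) μ) (hindep : iIndepFun e μ) {t : ℝ} (ht : 0 ≤ t)
    (n : ℕ) :
    ∑ k ∈ Finset.range n, μ.real {ω | ∑ l ∈ Finset.range (k + 1), e l ω ∈ Set.Icc 0 t} ≤ t := by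
  set f : ℝ → ℝ := (Set.Icc 0 t).indicator fun _ => 1 with hfdef
  have hf : Measurable f := measurable_const.indicator measurableSet_Icc
  have hf0 : ∀ x, 0 ≤ f x := fun x => Set.indicator_nonneg (fun _ _ => zero_le_one) x
  have hf1 : ∀ x, f x ≤ 1 := fun x => Set.indicator_le_self' (fun _ _ => zero_le_one) x
  have habs : ∀ x, |f x| ≤ 1 := fun x => abs_le.2 ⟨by linarith [hf0 x], hf1 x⟩
  have hm : ∀ i, Measurable fun ω => ∑ k ∈ Finset.range i, e k ω := fun i =>
    Finset.measurable_sum _ fun k _ => he k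
  -- Negative `y` is included because the spacings are positive only almost surely.
  have hF : ∀ y, ∫ s in (0 : ℝ)..y, f s ≤ t := fun y => by
    rcases le_total y 0 with hy | hy
    · rw [intervalIntegral.integral_symm]
      have := intervalIntegral.integral_nonneg (f := f) (μ := volume) hy fun s _ => hf0 s
      linarith
    · rw [intervalIntegral.integral_of_le hy]
      calc ∫ s in Set.Ioc 0 y, f s ≤ ∫ s, f s := by
            refine setIntegral_le_integral ?_ (ae_of_all _ hf0)
            exact (integrable_indicator_iff measurableSet_Icc).2
              (integrableOn_const (by simp))
        _ = t := by
            rw [hfdef, integral_indicator measurableSet_Icc]; simp [ht]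
  have h1 : ∀ k, ∫ ω, f (∑ l ∈ Finset.range (k + 1), e l ω) ∂μ =
      μ.real {ω | ∑ l ∈ Finset.range (k + 1), e l ω ∈ Set.Icc 0 t} := fun k => by
    have hs : MeasurableSet {ω | ∑ l ∈ Finset.range (k + 1), e l ω ∈ Set.Icc 0 t} :=
      hm (k + 1) measurableSet_Icc
    rw [← integral_indicator_one hs]
    rfl
  have hint : ∀ k, Integrable (fun ω => f (∑ l ∈ Finset.range (k + 1), e l ω)) μ := fun k =>
    (integrable_const (1 : ℝ)).mono' (hf.comp (hm _)).aestronglyMeasurable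
      (ae_of_all _ fun ω => habs _)
  have h2 : ∀ k, ∫ ω, samplingIncrement f (∑ l ∈ Finset.range k, e l ω) (e k ω) ∂μ = 0 :=
    integral_samplingIncrement_sum he hlaw hindep hf hf0 hf1
  have h3 : ∀ k, Integrable (fun ω =>
      samplingIncrement f (∑ l ∈ Finset.range k, e l ω) (e k ω)) μ :=
    fun i => (memLp_samplingIncrement he hlaw hf habs (hm i) i).integrable one_le_two
  simp_rw [← h1]
  -- The count is a mean-zero sum plus the integral of the indicator up to the `n`-th point, and
  -- this integral never exceeds `t`.
  have h4 : ∀ ω, ∑ k ∈ Finset.range n, f (∑ l ∈ Finset.range (k + 1), e l ω) =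
      ∑ k ∈ Finset.range n, samplingIncrement f (∑ l ∈ Finset.range k, e l ω) (e k ω) +
        ∫ s in (0 : ℝ)..(∑ l ∈ Finset.range n, e l ω), f s := fun ω => by
    induction n with
    | zero => simp
    | succ n ih =>
      have hn : samplingIncrement f (∑ l ∈ Finset.range n, e l ω) (e n ω) =
          f (∑ l ∈ Finset.range (n + 1), e l ω) -
          (∫ s in (0 : ℝ)..(∑ l ∈ Finset.range (n + 1), e l ω), f s) +
            ∫ s in (0 : ℝ)..(∑ l ∈ Finset.range n, e l ω), f s := by
        rw [Finset.sum_range_succ, samplingIncrement]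
      rw [Finset.sum_range_succ, ih, Finset.sum_range_succ (fun k =>
        samplingIncrement f (∑ l ∈ Finset.range k, e l ω) (e k ω)), hn]
      ring
  rw [← integral_finsetSum _ fun k _ => hint k]
  have h5 : Integrable (fun ω => ∑ k ∈ Finset.range n,
      samplingIncrement f (∑ l ∈ Finset.range k, e l ω) (e k ω)) μ :=
    integrable_finsetSum _ fun k _ => h3 k
  calc ∫ ω, ∑ k ∈ Finset.range n, f (∑ l ∈ Finset.range (k + 1), e l ω) ∂μ
      ≤ ∫ ω, (∑ k ∈ Finset.range n,
          samplingIncrement f (∑ l ∈ Finset.range k, e l ω) (e k ω) + t) ∂μ := by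
        refine integral_mono (integrable_finsetSum _ fun k _ => hint k)
          (h5.add (integrable_const t)) fun ω => ?_
        simp only [h4]
        gcongr
        exact hF _
    _ = t := by
        rw [integral_add h5 (integrable_const t), integral_finsetSum _ fun k _ => h3 k]
        simp [h2]

end Sampling

/-! ### The Poisson equation of an irreducible stochastic matrix -/

section PoissonEquation

variable {M : ℕ} {p : Matrix (Fin M) (Fin M) ℝ}

theorem sum_pow_row_eq_one (hsum : ∀ i, ∑ j, p i j = 1) (k : ℕ) (i : Fin M) :
    ∑ j, (p ^ k) i j = 1 := by
  have h1 : p.mulVec 1 = 1 := by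
    ext i
    simpa [Matrix.mulVec, dotProduct] using hsum i
  have h2 : (p ^ k).mulVec 1 = 1 := by
    induction k with
    | zero => simp
    | succ k ih => rw [pow_succ, ← Matrix.mulVec_mulVec, h1, ih]
  simpa [Matrix.mulVec, dotProduct] using congrFun h2 i

/-- The maximum principle: harmonic functions of an irreducible chain are constant. -/
theorem eq_of_mulVec_eq_self (hsum : ∀ i, ∑ j, p i j = 1) (hirr : p.IsIrreducible)
    {g : Fin M → ℝ} (hg : p.mulVec g = g) (i j : Fin M) : g i = g j := by
  have hpow : ∀ k, (p ^ k).mulVec g = g := fun k => by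
    induction k with
    | zero => simp
    | succ k ih => rw [pow_succ, ← Matrix.mulVec_mulVec, hg, ih]
  have hnn : ∀ k i j, 0 ≤ (p ^ k) i j := fun k => by
    induction k with
    | zero => intro i j; rw [pow_zero, Matrix.one_apply]; split_ifs <;> simp
    | succ k ih =>
      intro i j
      rw [pow_succ, Matrix.mul_apply]
      exact Finset.sum_nonneg fun l _ => mul_nonneg (ih i l) (hirr.nonneg l j)
  have hpos := (Matrix.isIrreducible_iff_exists_pow_pos hirr.nonneg).1 hirr
  have : Nonempty (Fin M) := ⟨i⟩
  obtain ⟨m, hm⟩ := Finite.exists_max g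
  have key : ∀ l, g l = g m := fun l => by
    obtain ⟨k, -, hk⟩ := hpos m l
    -- At a maximum point `m`, the row `m` of `p ^ k` averages the nonnegative gaps `g m - g j` to
    -- zero. Irreducibility provides a `k` that gives weight to `l`.
    have h1 : ∑ j, (p ^ k) m j * (g m - g j) = 0 := by
      have h2 : ∑ j, (p ^ k) m j * g j = g m := by
        simpa [Matrix.mulVec, dotProduct] using congrFun (hpow k) m
      simp_rw [mul_sub]
      rw [Finset.sum_sub_distrib, ← Finset.sum_mul, sum_pow_row_eq_one hsum, h2]
      ring
    have h3 := (Finset.sum_eq_zero_iff_of_nonneg fun j _ =>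
      mul_nonneg (hnn k m j) (sub_nonneg.2 (hm j))).1 h1 l (Finset.mem_univ l)
    rcases mul_eq_zero.1 h3 with h | h
    · exact absurd h hk.ne'
    · linarith
  rw [key i, key j]

/-- The value `g i₀` is free, since `g` matters only up to constants, and can serve as the unknown
`c`. This gives a linear endomorphism of a finite-dimensional space, so injectivity is enough. -/
theorem exists_poissonEquation (hsum : ∀ i, ∑ j, p i j = 1) (hirr : p.IsIrreducible)
    {h : Fin M → ℝ} (hh : ∀ i, 0 < h i) (v : Fin M → ℝ) (i₀ : Fin M) :
    ∃ (c : ℝ) (g : Fin M → ℝ), ∀ i, v i = c * h i + (g i - ∑ j, p i j * g j) := by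
  let Ψ : (Fin M → ℝ) →ₗ[ℝ] (Fin M → ℝ) :=
    { toFun := fun g i => g i₀ * h i + (g i - ∑ j, p i j * g j)
      map_add' := fun x y => by
        ext i
        simp only [Pi.add_apply, mul_add, Finset.sum_add_distrib]
        ring
      map_smul' := fun c x => by
        ext i
        simp only [Pi.smul_apply, smul_eq_mul, RingHom.id_apply, mul_add, mul_sub,
          Finset.mul_sum]
        congr 1
        · ring
        · congr 1
          exact Finset.sum_congr rfl fun j _ => by ring }
  have hinj : Function.Injective Ψ := by
    rw [injective_iff_map_eq_zero]
    intro g hg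
    have hg' : ∀ i, g i₀ * h i + (g i - ∑ j, p i j * g j) = 0 := fun i => congrFun hg i
    have : Nonempty (Fin M) := ⟨i₀⟩
    obtain ⟨a, ha⟩ := Finite.exists_max g
    obtain ⟨b, hb⟩ := Finite.exists_min g
    have h1 : ∑ j, p a j * g j ≤ g a := by
      calc ∑ j, p a j * g j ≤ ∑ j, p a j * g a :=
            Finset.sum_le_sum fun j _ => mul_le_mul_of_nonneg_left (ha j) (hirr.nonneg a j)
        _ = g a := by rw [← Finset.sum_mul, hsum, one_mul]
    have h2 : g b ≤ ∑ j, p b j * g j := by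
      calc g b = ∑ j, p b j * g b := by rw [← Finset.sum_mul, hsum, one_mul]
        _ ≤ _ := Finset.sum_le_sum fun j _ =>
          mul_le_mul_of_nonneg_left (hb j) (hirr.nonneg b j)
    -- In the kernel, `g - p g` is nonnegative at a maximum and nonpositive at a minimum, and `h` is
    -- positive; so `g i₀ = 0`. Then `g` is harmonic, hence constant, hence zero.
    have h3 : g i₀ ≤ 0 := by
      by_contra hc
      have := mul_pos (not_le.1 hc) (hh a)
      linarith [hg' a]
    have h4 : 0 ≤ g i₀ := by
      by_contra hc
      have := mul_neg_of_neg_of_pos (not_le.1 hc) (hh b)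
      linarith [hg' b]
    have h5 : g i₀ = 0 := le_antisymm h3 h4
    have h6 : p.mulVec g = g := by
      ext i
      have := hg' i
      rw [h5, zero_mul, zero_add] at this
      simp only [Matrix.mulVec, dotProduct]
      linarith
    ext i
    rw [eq_of_mulVec_eq_self hsum hirr h6 i i₀, h5]
    rfl
  obtain ⟨g, hg⟩ := LinearMap.injective_iff_surjective.1 hinj v
  exact ⟨g i₀, g, fun i => (congrFun hg i).symm⟩

end PoissonEquation

/-! ### One transition of a semi-Markov process -/

/-- The conditional mean of `φ i j u` given the current state `i`, where `j` is the next state and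
`u` the sojourn time. -/
def transMean {M : ℕ} (p : Matrix (Fin M) (Fin M) ℝ) (F : Fin M → Fin M → Measure ℝ)
    (φ : Fin M → Fin M → ℝ → ℝ) (i : Fin M) : ℝ :=
  ∑ j, p i j * ∫ u, φ i j u ∂(F i j)

namespace IsStationarySemiMarkov

variable {Ω : Type*} [MeasurableSpace Ω] {μ : Measure Ω} [IsProbabilityMeasure μ] {M : ℕ}
  {p : Matrix (Fin M) (Fin M) ℝ} {F : Fin M → Fin M → Measure ℝ}
  {T : ℤ → Ω → ℝ} {J : ℝ → Ω → Fin M}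

theorem measurable_state (hJ : IsStationarySemiMarkov μ p F T J) (k : ℤ) :
    Measurable fun ω => J (T k ω) ω :=
  hJ.measurable_J.comp ((hJ.measurable_T k).prodMk measurable_id)

theorem jumpHistory_le (hJ : IsStationarySemiMarkov μ p F T J) (n : ℤ) :
    jumpHistory T J n ≤ ‹MeasurableSpace Ω› :=
  iSup_le fun k => sup_le (hJ.measurable_T k).comap_le (hJ.measurable_state k).comap_le

theorem measurable_T_jumpHistory {k n : ℤ} (hkn : k ≤ n) :
    Measurable[jumpHistory T J n] (T k) :=
  measurable_iff_comap_le.2 (le_sup_left.trans (le_iSup (fun k : Set.Iic n =>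
    MeasurableSpace.comap (T k) inferInstance ⊔
      MeasurableSpace.comap (fun ω => J (T k ω) ω) inferInstance) ⟨k, hkn⟩))

theorem measurable_state_jumpHistory {k n : ℤ} (hkn : k ≤ n) :
    Measurable[jumpHistory T J n] fun ω => J (T k ω) ω :=
  measurable_iff_comap_le.2 (le_sup_right.trans (le_iSup (fun k : Set.Iic n =>
    MeasurableSpace.comap (T k) inferInstance ⊔
      MeasurableSpace.comap (fun ω => J (T k ω) ω) inferInstance) ⟨k, hkn⟩))

theorem measure_transition (hJ : IsStationarySemiMarkov μ p F T J) {k : ℤ} (hk : 1 ≤ k)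
    {A : Set Ω} (hA : MeasurableSet[jumpHistory T J k] A) (i j : Fin M) {B : Set ℝ}
    (hB : MeasurableSet B) :
    μ.real (A ∩ {ω | J (T k ω) ω = i} ∩
      {ω | J (T (k + 1) ω) ω = j ∧ T (k + 1) ω - T k ω ∈ B}) =
      μ.real (A ∩ {ω | J (T k ω) ω = i}) * p i j * (F i j).real B := by
  have hm := hJ.jumpHistory_le k
  have hi : MeasurableSet[jumpHistory T J k] {ω | J (T k ω) ω = i} :=
    measurable_state_jumpHistory le_rfl (measurableSet_singleton i)
  have hE : MeasurableSet {ω | J (T (k + 1) ω) ω = j ∧ T (k + 1) ω - T k ω ∈ B} :=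
    (hJ.measurable_state (k + 1) (measurableSet_singleton j)).inter
      (((hJ.measurable_T (k + 1)).sub (hJ.measurable_T k)) hB)
  have h1 := setIntegral_condExp hm (μ := μ)
    (f := {ω | J (T (k + 1) ω) ω = j ∧ T (k + 1) ω - T k ω ∈ B}.indicator fun _ => (1 : ℝ))
    ((integrable_const 1).indicator hE) (hA.inter hi)
  rw [setIntegral_indicator hE] at h1
  simp only [integral_const, MeasurableSet.univ, measureReal_restrict_apply, Set.univ_inter,
    smul_eq_mul, mul_one] at h1
  rw [← h1]
  rw [setIntegral_congr_ae (g := fun _ => p i j * (F i j).real B) (hm _ (hA.inter hi))]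
  · rw [setIntegral_const, smul_eq_mul, mul_assoc]
  · filter_upwards [hJ.markov k hk j B hB] with ω hω hω'
    rw [hω, hω'.2]

/-- On a past event followed by a jump from `i` to `j`, the sojourn time has law `F i j` up to mass.
Identifying the measure extends `markov` from events to integrable functions. -/
theorem map_restrict_transition (hJ : IsStationarySemiMarkov μ p F T J) {k : ℤ} (hk : 1 ≤ k)
    {A : Set Ω} (hA : MeasurableSet[jumpHistory T J k] A) (i j : Fin M) :
    (μ.restrict (A ∩ {ω | J (T k ω) ω = i} ∩ {ω | J (T (k + 1) ω) ω = j})).map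
        (fun ω => T (k + 1) ω - T k ω) =
      ENNReal.ofReal (μ.real (A ∩ {ω | J (T k ω) ω = i}) * p i j) • F i j := by
  have := hJ.sojourn_prob i j
  have hS : Measurable fun ω => T (k + 1) ω - T k ω :=
    (hJ.measurable_T (k + 1)).sub (hJ.measurable_T k)
  ext B hB
  rw [Measure.map_apply hS hB, Measure.restrict_apply (hS hB), Measure.smul_apply, smul_eq_mul,
    ← ofReal_measureReal (μ := F i j), ← ENNReal.ofReal_mul
      (mul_nonneg measureReal_nonneg (hJ.irreducible.nonneg i j)),
    ← hJ.measure_transition hk hA i j hB, ofReal_measureReal]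
  congr 1
  ext ω
  simp only [Set.mem_inter_iff, Set.mem_preimage, Set.mem_ofPred_eq]
  tauto

theorem setIntegral_transition_part (hJ : IsStationarySemiMarkov μ p F T J) {k : ℤ}
    (hk : 1 ≤ k) {A : Set Ω} (hA : MeasurableSet[jumpHistory T J k] A) (i j : Fin M)
    {φ : ℝ → ℝ} (hφ : Measurable φ) (hint : Integrable φ (F i j)) :
    IntegrableOn (fun ω => φ (T (k + 1) ω - T k ω))
        (A ∩ {ω | J (T k ω) ω = i} ∩ {ω | J (T (k + 1) ω) ω = j}) μ ∧
      ∫ ω in A ∩ {ω | J (T k ω) ω = i} ∩ {ω | J (T (k + 1) ω) ω = j},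
        φ (T (k + 1) ω - T k ω) ∂μ =
      μ.real (A ∩ {ω | J (T k ω) ω = i}) * (p i j * ∫ u, φ u ∂(F i j)) := by
  have hS : Measurable fun ω => T (k + 1) ω - T k ω :=
    (hJ.measurable_T (k + 1)).sub (hJ.measurable_T k)
  have hmap := hJ.map_restrict_transition hk hA i j
  constructor
  · refine (integrable_map_measure (g := φ) hφ.aestronglyMeasurable hS.aemeasurable).1 ?_
    rw [hmap]
    exact hint.smul_measure ENNReal.ofReal_ne_top
  · rw [← integral_map (f := φ) hS.aemeasurable hφ.aestronglyMeasurable, hmap,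
      integral_smul_measure, ENNReal.toReal_ofReal
        (mul_nonneg measureReal_nonneg (hJ.irreducible.nonneg i j)), smul_eq_mul, mul_assoc]

/-- The value of `φ` at the transition number `k`. -/
def transValue (T : ℤ → Ω → ℝ) (J : ℝ → Ω → Fin M) (φ : Fin M → Fin M → ℝ → ℝ) (k : ℤ)
    (ω : Ω) : ℝ :=
  φ (J (T k ω) ω) (J (T (k + 1) ω) ω) (T (k + 1) ω - T k ω)

theorem transValue_eq_sum (φ : Fin M → Fin M → ℝ → ℝ) (k : ℤ) (ω : Ω) :
    transValue T J φ k ω = ∑ i, ∑ j,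
      ({ω | J (T k ω) ω = i} ∩ {ω | J (T (k + 1) ω) ω = j}).indicator
        (fun ω => φ i j (T (k + 1) ω - T k ω)) ω := by
  rw [Finset.sum_eq_single (J (T k ω) ω), Finset.sum_eq_single (J (T (k + 1) ω) ω)]
  · simp [transValue]
  · intro j _ hj; simp [hj.symm]
  · simp
  · intro i _ hi
    refine Finset.sum_eq_zero fun j _ => ?_
    simp [hi.symm]
  · simp

theorem measurableSet_transition (hJ : IsStationarySemiMarkov μ p F T J) (k : ℤ)
    (i j : Fin M) :
    MeasurableSet ({ω | J (T k ω) ω = i} ∩ {ω | J (T (k + 1) ω) ω = j}) :=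
  (hJ.measurable_state k (measurableSet_singleton i)).inter
    (hJ.measurable_state (k + 1) (measurableSet_singleton j))

theorem integrable_transValue (hJ : IsStationarySemiMarkov μ p F T J)
    {φ : Fin M → Fin M → ℝ → ℝ} (hφ : ∀ i j, Measurable (φ i j))
    (hint : ∀ i j, Integrable (φ i j) (F i j)) {k : ℤ} (hk : 1 ≤ k) :
    Integrable (transValue T J φ k) μ := by
  have : transValue T J φ k = fun ω => ∑ i, ∑ j,
      ({ω | J (T k ω) ω = i} ∩ {ω | J (T (k + 1) ω) ω = j}).indicator
        (fun ω => φ i j (T (k + 1) ω - T k ω)) ω := funext (transValue_eq_sum φ k)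
  rw [this]
  refine integrable_finsetSum _ fun i _ => integrable_finsetSum _ fun j _ =>
    (integrable_indicator_iff (hJ.measurableSet_transition k i j)).2 ?_
  have h := (hJ.setIntegral_transition_part hk MeasurableSet.univ i j (hφ i j) (hint i j)).1
  simpa using h

theorem setIntegral_transValue (hJ : IsStationarySemiMarkov μ p F T J)
    {φ : Fin M → Fin M → ℝ → ℝ} (hφ : ∀ i j, Measurable (φ i j))
    (hint : ∀ i j, Integrable (φ i j) (F i j)) {k : ℤ} (hk : 1 ≤ k)
    {A : Set Ω} (hA : MeasurableSet[jumpHistory T J k] A) :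
    ∫ ω in A, transMean p F φ (J (T k ω) ω) ∂μ = ∫ ω in A, transValue T J φ k ω ∂μ := by
  have hset : ∀ i j, A ∩ {ω | J (T k ω) ω = i} ∩ {ω | J (T (k + 1) ω) ω = j} =
      A ∩ ({ω | J (T k ω) ω = i} ∩ {ω | J (T (k + 1) ω) ω = j}) := fun i j =>
    Set.inter_assoc _ _ _
  have hpart := fun i j => hJ.setIntegral_transition_part hk hA i j (hφ i j) (hint i j)
  simp only [hset] at hpart
  have hind : ∀ i j, IntegrableOn (({ω | J (T k ω) ω = i} ∩
      {ω | J (T (k + 1) ω) ω = j}).indicator (fun ω => φ i j (T (k + 1) ω - T k ω))) A μ :=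
    fun i j => by
      rw [IntegrableOn, integrable_indicator_iff (hJ.measurableSet_transition k i j),
        IntegrableOn, Measure.restrict_restrict (hJ.measurableSet_transition k i j),
        Set.inter_comm]
      exact (hpart i j).1
  have hmi : ∀ i, MeasurableSet {ω | J (T k ω) ω = i} := fun i =>
    hJ.measurable_state k (measurableSet_singleton i)
  simp_rw [transValue_eq_sum φ k]
  rw [integral_finsetSum _ fun i _ => integrable_finsetSum _ fun j _ => hind i j]
  have hmean : ∀ ω, transMean p F φ (J (T k ω) ω) =
      ∑ i, {ω | J (T k ω) ω = i}.indicator (fun _ => transMean p F φ i) ω := fun ω => by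
    rw [Finset.sum_eq_single (J (T k ω) ω)]
    · simp
    · intro i _ hi; simp [hi.symm]
    · simp
  simp_rw [hmean]
  rw [integral_finsetSum _ fun i _ => (integrable_const _).indicator (hmi i)]
  refine Finset.sum_congr rfl fun i _ => ?_
  rw [integral_finsetSum _ fun j _ => hind i j, setIntegral_indicator (hmi i),
    setIntegral_const, smul_eq_mul, transMean, Finset.mul_sum]
  refine Finset.sum_congr rfl fun j _ => ?_
  rw [setIntegral_indicator (hJ.measurableSet_transition k i j), (hpart i j).2]

theorem condExp_transValue (hJ : IsStationarySemiMarkov μ p F T J)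
    {φ : Fin M → Fin M → ℝ → ℝ} (hφ : ∀ i j, Measurable (φ i j))
    (hint : ∀ i j, Integrable (φ i j) (F i j)) {k : ℤ} (hk : 1 ≤ k) :
    μ[transValue T J φ k | jumpHistory T J k] =ᵐ[μ]
      fun ω => transMean p F φ (J (T k ω) ω) := by
  have hmeas : Measurable[jumpHistory T J k] fun ω => transMean p F φ (J (T k ω) ω) :=
    (measurable_of_finite (transMean p F φ)).comp (measurable_state_jumpHistory le_rfl)
  refine (ae_eq_condExp_of_forall_setIntegral_eq (hJ.jumpHistory_le k)
    (hJ.integrable_transValue hφ hint hk) (fun A _ _ => ?_)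
    (fun A hA _ => hJ.setIntegral_transValue hφ hint hk hA)
    hmeas.stronglyMeasurable.aestronglyMeasurable).symm
  obtain ⟨C, hC⟩ := (Set.finite_range fun i => |transMean p F φ i|).bddAbove
  exact ((integrable_const C).mono' ((hmeas.mono (hJ.jumpHistory_le k) le_rfl).aestronglyMeasurable)
    (ae_of_all _ fun ω => hC ⟨_, rfl⟩)).integrableOn

/-- A weight known at jump `k` can be kept while the next transition is averaged. Its bound is
required only almost surely, because the jump times are ordered only almost surely. -/
theorem integral_mul_transValue (hJ : IsStationarySemiMarkov μ p F T J)
    {φ : Fin M → Fin M → ℝ → ℝ} (hφ : ∀ i j, Measurable (φ i j))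
    (hint : ∀ i j, Integrable (φ i j) (F i j)) {k : ℤ} (hk : 1 ≤ k) {b : Ω → ℝ}
    (hb : Measurable[jumpHistory T J k] b) {C : ℝ} (hC : ∀ᵐ ω ∂μ, |b ω| ≤ C) :
    Integrable (fun ω => b ω * transValue T J φ k ω) μ ∧
    ∫ ω, b ω * transValue T J φ k ω ∂μ =
      ∫ ω, b ω * transMean p F φ (J (T k ω) ω) ∂μ := by
  have hi := hJ.integrable_transValue hφ hint hk
  have hbi : Integrable (fun ω => b ω * transValue T J φ k ω) μ :=
    hi.bdd_mul (hb.mono (hJ.jumpHistory_le k) le_rfl).aestronglyMeasurable (c := C) hC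
  refine ⟨hbi, ?_⟩
  rw [← integral_condExp (hJ.jumpHistory_le k)]
  refine integral_congr_ae ?_
  filter_upwards [condExp_mul_of_stronglyMeasurable_left (f := b) hb.stronglyMeasurable hbi hi,
    hJ.condExp_transValue hφ hint hk] with ω h1 h2
  have h3 : (b * transValue T J φ k) = fun ω => b ω * transValue T J φ k ω := rfl
  rw [h3] at h1
  rw [h1, Pi.mul_apply, h2]

end IsStationarySemiMarkov

/-! ### Non-accumulation of the jumps and martingales along the embedded chain -/

namespace IsStationarySemiMarkov

variable {Ω : Type*} [MeasurableSpace Ω] {μ : Measure Ω} [IsProbabilityMeasure μ] {M : ℕ}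
  {p : Matrix (Fin M) (Fin M) ℝ} {F : Fin M → Fin M → Measure ℝ}
  {T : ℤ → Ω → ℝ} {J : ℝ → Ω → Fin M}

theorem integral_exp_neg_lt_one {ν : Measure ℝ} [IsProbabilityMeasure ν]
    (hν : ν (Set.Iic 0) = 0) :
    Integrable (fun u => Real.exp (-u)) ν ∧ ∫ u, Real.exp (-u) ∂ν < 1 := by
  have hpos : ∀ᵐ u ∂ν, 0 < u := by
    rw [ae_iff]
    convert hν using 2
    ext; simp
  have hlt : ∀ᵐ u ∂ν, 0 < 1 - Real.exp (-u) := by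
    filter_upwards [hpos] with u hu
    rw [sub_pos, Real.exp_lt_one_iff]
    linarith
  have hint : Integrable (fun u => Real.exp (-u)) ν := by
    refine (integrable_const (1 : ℝ)).mono' (by fun_prop) ?_
    filter_upwards [hlt] with u hu
    rw [Real.norm_of_nonneg (Real.exp_pos _).le]
    linarith
  refine ⟨hint, ?_⟩
  have h : 0 < ∫ u, (1 - Real.exp (-u)) ∂ν := by
    rw [integral_pos_iff_support_of_nonneg_ae (hlt.mono fun u hu => hu.le)
      ((integrable_const 1).sub hint)]
    have h1 : ν (Function.support fun u => 1 - Real.exp (-u)) = 1 :=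
      (prob_compl_eq_zero_iff (measurableSet_support (by fun_prop))).1 (hlt.mono fun u hu => hu.ne')
    rw [h1]
    exact one_pos
  rw [integral_sub (integrable_const 1) hint] at h
  simpa using h

theorem abs_transMean_le (hJ : IsStationarySemiMarkov μ p F T J)
    {φ : Fin M → Fin M → ℝ → ℝ} {C : ℝ} (hC : ∀ i j, |∫ u, φ i j u ∂(F i j)| ≤ C) (i : Fin M) :
    |transMean p F φ i| ≤ C := by
  calc |transMean p F φ i| ≤ ∑ j, |p i j * ∫ u, φ i j u ∂(F i j)| :=
        Finset.abs_sum_le_sum_abs _ _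
    _ ≤ ∑ j, p i j * C := by
        refine Finset.sum_le_sum fun j _ => ?_
        rw [abs_mul, abs_of_nonneg (hJ.irreducible.nonneg i j)]
        exact mul_le_mul_of_nonneg_left (hC i j) (hJ.irreducible.nonneg i j)
    _ = C := by rw [← Finset.sum_mul, hJ.row_sum, one_mul]

/-- The jumps do not accumulate: the probability of `n` jumps before `t` decays
geometrically in `n`. -/
theorem exists_measure_T_le (hJ : IsStationarySemiMarkov μ p F T J) (i₀ : Fin M) :
    ∃ r : ℝ, 0 ≤ r ∧ r < 1 ∧ ∀ (n : ℕ) (t : ℝ),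
      μ.real {ω | T ((n : ℤ) + 1) ω ≤ t} ≤ Real.exp t * r ^ n := by
  have := hJ.sojourn_prob
  have : Nonempty (Fin M × Fin M) := ⟨(i₀, i₀)⟩
  have hF := fun i j => integral_exp_neg_lt_one (hJ.sojourn_pos i j)
  -- The ratio `r` is the largest Laplace transform at `1` among the finitely many sojourn laws. It
  -- is below one since these laws charge only positive times.
  obtain ⟨z, hz⟩ := Finite.exists_max fun z : Fin M × Fin M =>
    ∫ u, Real.exp (-u) ∂(F z.1 z.2)
  set r := ∫ u, Real.exp (-u) ∂(F z.1 z.2) with hr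
  have hr0 : 0 ≤ r := integral_nonneg fun u => (Real.exp_pos _).le
  refine ⟨r, hr0, (hF _ _).2, fun n t => ?_⟩
  let φ : Fin M → Fin M → ℝ → ℝ := fun _ _ u => Real.exp (-u)
  have hφ : ∀ i j, Measurable (φ i j) := fun i j => by fun_prop
  have hmean : ∀ i, transMean p F φ i ≤ r := fun i =>
    (le_abs_self _).trans (hJ.abs_transMean_le (fun i j => by
      rw [abs_of_nonneg (integral_nonneg fun u => (Real.exp_pos _).le)]
      exact hz (i, j)) i)
  -- Each transition multiplies the mean of the discount factor `W` by at most `r`; Markov's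
  -- inequality then concludes. Time runs from `T 1`, where the transition rule starts to apply.
  let W : ℕ → Ω → ℝ := fun n ω => Real.exp (-(T ((n : ℤ) + 1) ω - T 1 ω))
  have hW0 : ∀ n ω, 0 ≤ W n ω := fun n ω => (Real.exp_pos _).le
  have hWm : ∀ n : ℕ, Measurable[jumpHistory T J ((n : ℤ) + 1)] (W n) := fun n =>
    Real.measurable_exp.comp (((measurable_T_jumpHistory le_rfl).sub
      (measurable_T_jumpHistory (by omega))).neg)
  have hW1 : ∀ n, ∀ᵐ ω ∂μ, |W n ω| ≤ 1 := fun n => by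
    filter_upwards [hJ.strictMono] with ω hω
    rw [abs_of_nonneg (hW0 n ω), Real.exp_le_one_iff]
    have : T 1 ω ≤ T ((n : ℤ) + 1) ω := hω.monotone (by omega)
    linarith
  have hWi : ∀ n, Integrable (W n) μ := fun n =>
    (integrable_const (1 : ℝ)).mono' ((hWm n).mono (hJ.jumpHistory_le _) le_rfl).aestronglyMeasurable
      (hW1 n)
  have hWr : ∀ n, ∫ ω, W n ω ∂μ ≤ r ^ n := fun n => by
    induction n with
    | zero => simp [W]
    | succ n ih =>
      have h := hJ.integral_mul_transValue hφ (fun i j => (hF i j).1)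
        (k := (n : ℤ) + 1) (by omega) (hWm n) (hW1 n)
      have h1 : ∀ ω, W (n + 1) ω = W n ω * transValue T J φ ((n : ℤ) + 1) ω := fun ω => by
        simp only [W, transValue, φ, ← Real.exp_add]
        push_cast
        congr 1
        ring
      simp_rw [h1]
      rw [h.2]
      calc ∫ ω, W n ω * transMean p F φ (J (T ((n : ℤ) + 1) ω) ω) ∂μ
          ≤ ∫ ω, W n ω * r ∂μ := by
            refine integral_mono_of_nonneg (ae_of_all _ fun ω => ?_) ((hWi n).mul_const r)
              (ae_of_all _ fun ω => mul_le_mul_of_nonneg_left (hmean _) (hW0 n ω))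
            refine mul_nonneg (hW0 n ω) (Finset.sum_nonneg fun j _ =>
              mul_nonneg (hJ.irreducible.nonneg _ j) (integral_nonneg fun u => (Real.exp_pos _).le))
        _ = (∫ ω, W n ω ∂μ) * r := integral_mul_const _ _
        _ ≤ r ^ n * r := by gcongr
        _ = r ^ (n + 1) := (pow_succ _ _).symm
  have h2 := mul_meas_ge_le_integral_of_nonneg (ae_of_all _ (hW0 n)) (hWi n) (Real.exp (-t))
  have h3 : μ.real {ω | T ((n : ℤ) + 1) ω ≤ t} ≤ μ.real {ω | Real.exp (-t) ≤ W n ω} := by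
    refine ENNReal.toReal_mono (measure_ne_top _ _) (measure_mono_ae ?_)
    filter_upwards [hJ.origin] with ω hω hω'
    have hω' : T ((n : ℤ) + 1) ω ≤ t := hω'
    change Real.exp (-t) ≤ W n ω
    refine Real.exp_le_exp.2 ?_
    linarith [hω.2]
  have h4 : Real.exp (-t) * μ.real {ω | T ((n : ℤ) + 1) ω ≤ t} ≤ r ^ n :=
    (mul_le_mul_of_nonneg_left h3 (Real.exp_pos _).le).trans (h2.trans (hWr n))
  calc μ.real {ω | T ((n : ℤ) + 1) ω ≤ t}
      = Real.exp t * (Real.exp (-t) * μ.real {ω | T ((n : ℤ) + 1) ω ≤ t}) := by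
        rw [← mul_assoc, ← Real.exp_add]; simp
    _ ≤ _ := by gcongr

/-- The indicator that jump `k + 1` happens before time `t`. -/
def jumpBefore (T : ℤ → Ω → ℝ) (t : ℝ) (k : ℕ) (ω : Ω) : ℝ :=
  {ω | T ((k : ℤ) + 1) ω ≤ t}.indicator (fun _ => 1) ω

theorem measurable_jumpBefore (t : ℝ) (k : ℕ) :
    Measurable[jumpHistory T J ((k : ℤ) + 1)] (jumpBefore T t k) :=
  Measurable.indicator measurable_const
    (measurableSet_le (measurable_T_jumpHistory le_rfl) measurable_const)

theorem jumpBefore_nonneg (t : ℝ) (k : ℕ) (ω : Ω) : 0 ≤ jumpBefore T t k ω :=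
  Set.indicator_nonneg (fun _ _ => zero_le_one) ω

theorem jumpBefore_le_one (t : ℝ) (k : ℕ) (ω : Ω) : jumpBefore T t k ω ≤ 1 :=
  Set.indicator_le_self' (fun _ _ => zero_le_one) ω

theorem abs_jumpBefore_le_one (t : ℝ) (k : ℕ) (ω : Ω) : |jumpBefore T t k ω| ≤ 1 := by
  rw [abs_of_nonneg (jumpBefore_nonneg t k ω)]
  exact jumpBefore_le_one t k ω

/-- Whether jump `k + 1` occurs before `t` is known at that jump. The cut-off therefore keeps the
terms orthogonal martingale differences, each bounded by `2 * C`. -/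
theorem integral_abs_martingale_le (hJ : IsStationarySemiMarkov μ p F T J)
    {φ : Fin M → Fin M → ℝ → ℝ} (hφ : ∀ i j, Measurable (φ i j)) {C : ℝ}
    (hC : ∀ i j u, |φ i j u| ≤ C) (t : ℝ) (n : ℕ) :
    ∫ ω, |∑ k ∈ Finset.range n, jumpBefore T t k ω * (transValue T J φ ((k : ℤ) + 1) ω -
      transMean p F φ (J (T ((k : ℤ) + 1) ω) ω))| ∂μ ≤ √(n * ((2 * C) * (2 * C))) := by
  have := hJ.sojourn_prob
  have hint : ∀ i j, Integrable (φ i j) (F i j) := fun i j =>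
    (integrable_const C).mono' (hφ i j).aestronglyMeasurable (ae_of_all _ fun u => hC i j u)
  have hmean : ∀ i, |transMean p F φ i| ≤ C := hJ.abs_transMean_le fun i j => by
    have h := norm_integral_le_of_norm_le_const (μ := F i j) (f := φ i j) (C := C)
      (ae_of_all _ fun u => hC i j u)
    simpa using h
  have hY : ∀ k ω, |jumpBefore T t k ω * (transValue T J φ ((k : ℤ) + 1) ω -
      transMean p F φ (J (T ((k : ℤ) + 1) ω) ω))| ≤ 2 * C := fun k ω => by
    rw [abs_mul]
    have h1 : |transValue T J φ ((k : ℤ) + 1) ω -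
      transMean p F φ (J (T ((k : ℤ) + 1) ω) ω)| ≤ 2 * C := by
      refine (abs_sub _ _).trans ?_
      have := hC (J (T ((k : ℤ) + 1) ω) ω) (J (T ((k : ℤ) + 1 + 1) ω) ω)
        (T ((k : ℤ) + 1 + 1) ω - T ((k : ℤ) + 1) ω)
      have := hmean (J (T ((k : ℤ) + 1) ω) ω)
      unfold transValue
      linarith
    calc _ ≤ 1 * (2 * C) :=
          mul_le_mul (abs_jumpBefore_le_one t k ω) h1 (abs_nonneg _) zero_le_one
      _ = 2 * C := one_mul _
  have hmm : ∀ {k l : ℕ}, k < l → Measurable[jumpHistory T J ((l : ℤ) + 1)] fun ω =>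
      jumpBefore T t k ω * (transValue T J φ ((k : ℤ) + 1) ω -
      transMean p F φ (J (T ((k : ℤ) + 1) ω) ω)) := fun {k l} hkl => by
    have h0 : Measurable[jumpHistory T J ((l : ℤ) + 1)] (jumpBefore T t k) :=
      Measurable.indicator measurable_const
        (measurableSet_le (measurable_T_jumpHistory (by omega)) measurable_const)
    have h1 : ∀ i j, MeasurableSet[jumpHistory T J ((l : ℤ) + 1)]
        ({ω | J (T ((k : ℤ) + 1) ω) ω = i} ∩ {ω | J (T ((k : ℤ) + 1 + 1) ω) ω = j}) :=
      fun i j => MeasurableSet.inter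
        (measurable_state_jumpHistory (by omega) (measurableSet_singleton i))
        (measurable_state_jumpHistory (by omega) (measurableSet_singleton j))
    have h2 : Measurable[jumpHistory T J ((l : ℤ) + 1)] (transValue T J φ ((k : ℤ) + 1)) := by
      rw [show transValue T J φ ((k : ℤ) + 1) = _ from funext (transValue_eq_sum φ ((k : ℤ) + 1))]
      exact Finset.measurable_sum _ fun i _ => Finset.measurable_sum _ fun j _ =>
        ((hφ i j).comp ((measurable_T_jumpHistory (by omega)).sub
          (measurable_T_jumpHistory (by omega)))).indicator (h1 i j)
    exact h0.mul (h2.sub ((measurable_of_finite (transMean p F φ)).comp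
      (measurable_state_jumpHistory (by omega))))
  have hm : ∀ k : ℕ, Measurable fun ω =>
      jumpBefore T t k ω * (transValue T J φ ((k : ℤ) + 1) ω -
      transMean p F φ (J (T ((k : ℤ) + 1) ω) ω)) := fun k =>
    (hmm (Nat.lt_succ_self k)).mono (hJ.jumpHistory_le _) le_rfl
  have hL : ∀ k : ℕ, MemLp (fun ω =>
      jumpBefore T t k ω * (transValue T J φ ((k : ℤ) + 1) ω -
      transMean p F φ (J (T ((k : ℤ) + 1) ω) ω))) 2 μ := fun k =>
    MemLp.of_bound (hm k).aestronglyMeasurable (2 * C) (ae_of_all _ (hY k))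
  have horth : ∀ {k l : ℕ}, k < l → ∫ ω, (jumpBefore T t k ω *
      (transValue T J φ ((k : ℤ) + 1) ω - transMean p F φ (J (T ((k : ℤ) + 1) ω) ω))) *
      (jumpBefore T t l ω * (transValue T J φ ((l : ℤ) + 1) ω -
        transMean p F φ (J (T ((l : ℤ) + 1) ω) ω))) ∂μ = 0 := fun {k l} hkl => by
    set b : Ω → ℝ := fun ω => (jumpBefore T t k ω *
      (transValue T J φ ((k : ℤ) + 1) ω - transMean p F φ (J (T ((k : ℤ) + 1) ω) ω))) *
      jumpBefore T t l ω with hb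
    have hbm : Measurable[jumpHistory T J ((l : ℤ) + 1)] b :=
      (hmm hkl).mul (measurable_jumpBefore t l)
    have hbC : ∀ ω, |b ω| ≤ 2 * C := fun ω => by
      rw [hb]
      simp only
      rw [abs_mul]
      have h1 := hY k ω
      calc _ ≤ 2 * C * 1 := mul_le_mul h1 (abs_jumpBefore_le_one t l ω) (abs_nonneg _)
            ((abs_nonneg _).trans h1)
        _ = 2 * C := mul_one _
    have h := hJ.integral_mul_transValue hφ hint (k := (l : ℤ) + 1) (by omega) hbm
      (ae_of_all _ hbC)
    have h4 : Integrable (fun ω => b ω * transMean p F φ (J (T ((l : ℤ) + 1) ω) ω)) μ := by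
      refine Integrable.bdd_mul (c := 2 * C) ?_
        (hbm.mono (hJ.jumpHistory_le _) le_rfl).aestronglyMeasurable (ae_of_all _ hbC)
      exact (integrable_const C).mono' ((measurable_of_finite (transMean p F φ)).comp
        (hJ.measurable_state _)).aestronglyMeasurable (ae_of_all _ fun ω => hmean _)
    have h5 := integral_sub h.1 h4
    rw [h.2, sub_self] at h5
    rw [← h5]
    refine integral_congr_ae (ae_of_all _ fun ω => ?_)
    simp only [hb]
    ring
  have h := integral_abs_sum_le_of_orthogonal (μ := μ) (Finset.range n) _ (fun k _ => hL k)
    (fun k _ l _ hkl => ?_) (V := (2 * C) * (2 * C)) fun k _ => ?_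
  · simpa using h
  · rcases lt_or_gt_of_ne hkl with h | h
    · exact horth h
    · rw [← horth h]
      exact integral_congr_ae (ae_of_all _ fun ω => mul_comm _ _)
  · refine (integral_mono (g := fun _ => 2 * C * (2 * C)) ((hL k).integrable_mul (hL k))
      (integrable_const _) fun ω => ?_).trans ?_
    · have h1 := hY k ω
      rw [Pi.mul_apply, ← abs_mul_abs_self]
      exact mul_le_mul h1 h1 (abs_nonneg _) ((abs_nonneg _).trans h1)
    · simp

end IsStationarySemiMarkov

/-! ### Law of large numbers for time integrals along the path -/

theorem exists_sum_telescope (b g : ℕ → ℝ) (hb : ∀ k, b k = 0 ∨ b k = 1)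
    (hanti : ∀ k, b k = 0 → b (k + 1) = 0) (n : ℕ) :
    ∃ m, ∑ k ∈ Finset.range n, b k * (g k - g (k + 1)) = g 0 - g m ∧ (m = n ∨ b n = 0) := by
  -- A nonincreasing sequence of zeros and ones stops the telescoping sum at one index `m`. The
  -- alternative `m = n ∨ b n = 0` is carried along for the induction.
  induction n with
  | zero => exact ⟨0, by simp, Or.inl rfl⟩
  | succ n ih =>
    obtain ⟨m, hm, h⟩ := ih
    rw [Finset.sum_range_succ, hm]
    rcases hb n with h0 | h1
    · exact ⟨m, by rw [h0]; ring, Or.inr (hanti n h0)⟩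
    · rcases h with rfl | h
      · exact ⟨m + 1, by rw [h1]; ring, Or.inl rfl⟩
      · rw [h1] at h
        exact absurd h one_ne_zero

/-- The part of a sojourn time beyond the level `L`. -/
def excess (L u : ℝ) : ℝ := |u| - min |u| L

theorem excess_nonneg (L u : ℝ) : 0 ≤ excess L u := sub_nonneg.2 (min_le_left _ _)

theorem measurable_excess (L : ℝ) : Measurable (excess L) := by unfold excess; fun_prop

theorem integrable_excess {L : ℝ} (hL : 0 ≤ L) {ν : Measure ℝ}
    (hν : Integrable (fun u : ℝ => u) ν) : Integrable (excess L) ν := by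
  refine hν.abs.mono' (measurable_excess L).aestronglyMeasurable (ae_of_all _ fun u => ?_)
  rw [Real.norm_of_nonneg (excess_nonneg L u), excess]
  linarith [le_min (abs_nonneg u) hL]

theorem tendsto_integral_excess {ν : Measure ℝ} (hν : Integrable (fun u : ℝ => u) ν) :
    Tendsto (fun L : ℕ => ∫ u, excess L u ∂ν) atTop (𝓝 0) := by
  have h := tendsto_integral_of_dominated_convergence (μ := ν) (F := fun (L : ℕ) u => excess L u)
    (f := fun _ => 0) (fun u => |u|) (fun L => (measurable_excess L).aestronglyMeasurable)
    hν.abs (fun L => ae_of_all _ fun u => ?_) (ae_of_all _ fun u => ?_)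
  · simpa using h
  · rw [Real.norm_of_nonneg (excess_nonneg _ u), excess]
    linarith [le_min (abs_nonneg u) (Nat.cast_nonneg L)]
  · obtain ⟨N, hN⟩ := exists_nat_ge |u|
    refine tendsto_const_nhds.congr' ?_
    filter_upwards [eventually_ge_atTop N] with L hL
    rw [excess, min_eq_left (hN.trans (by exact_mod_cast hL)), sub_self]

namespace IsStationarySemiMarkov

variable {Ω : Type*} [MeasurableSpace Ω] {μ : Measure Ω} [IsProbabilityMeasure μ] {M : ℕ}
  {p : Matrix (Fin M) (Fin M) ℝ} {F : Fin M → Fin M → Measure ℝ}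
  {T : ℤ → Ω → ℝ} {J : ℝ → Ω → Fin M}

theorem intervalIntegrable_path (hJ : IsStationarySemiMarkov μ p F T J) (v : Fin M → ℝ)
    (ω : Ω) (a b : ℝ) : IntervalIntegrable (fun s => v (J s ω)) volume a b := by
  obtain ⟨C, hC⟩ := (Set.finite_range fun i => |v i|).bddAbove
  exact (intervalIntegrable_const (c := C)).mono_fun'
    ((measurable_of_finite v).comp
      (hJ.measurable_J.comp measurable_prodMk_right)).aestronglyMeasurable
    (ae_of_all _ fun s => hC ⟨_, rfl⟩)

theorem path_eq {ω : Ω} (hmono : StrictMono fun n => T n ω)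
    (hpw : ∀ t : ℝ, ∃ n : ℤ, T n ω ≤ t ∧ t < T (n + 1) ω ∧ J t ω = J (T n ω) ω)
    {n : ℤ} {t : ℝ} (h1 : T n ω ≤ t) (h2 : t < T (n + 1) ω) : J t ω = J (T n ω) ω := by
  obtain ⟨m, hm1, hm2, hm3⟩ := hpw t
  have h3 : n < m + 1 := hmono.lt_iff_lt.1 (h1.trans_lt hm2)
  have h4 : m < n + 1 := hmono.lt_iff_lt.1 (hm1.trans_lt h2)
  have : m = n := by omega
  rw [hm3, this]

theorem integral_sojourn {ω : Ω} (hmono : StrictMono fun n => T n ω)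
    (hpw : ∀ t : ℝ, ∃ n : ℤ, T n ω ≤ t ∧ t < T (n + 1) ω ∧ J t ω = J (T n ω) ω)
    (v : Fin M → ℝ) (n : ℤ) :
    ∫ s in (T n ω)..(T (n + 1) ω), v (J s ω) = v (J (T n ω) ω) * (T (n + 1) ω - T n ω) := by
  have hle : T n ω ≤ T (n + 1) ω := hmono.monotone (by omega)
  rw [intervalIntegral.integral_of_le hle, integral_Ioc_eq_integral_Ioo,
    setIntegral_congr_fun (g := fun _ => v (J (T n ω) ω)) measurableSet_Ioo]
  · rw [setIntegral_const, smul_eq_mul, measureReal_def, Real.volume_Ioo,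
      ENNReal.toReal_ofReal (by linarith), mul_comm]
  · intro s hs
    simp only
    rw [path_eq hmono hpw hs.1.le hs.2]

/-- The interval `[0, t]` is the part before the first jump, plus all sojourns begun by time `t`,
minus the overshoot of the last one beyond `t`. The overshoot is at most `L` plus the excess of that
sojourn, and one excess is at most the sum of all; this avoids estimating the sojourn straddling
`t`, which is size-biased. -/
theorem abs_integral_path_le (hJ : IsStationarySemiMarkov μ p F T J) {ω : Ω}
    (hmono : StrictMono fun n => T n ω) (h0 : T 0 ω ≤ 0 ∧ 0 < T 1 ω)
    (hpw : ∀ t : ℝ, ∃ n : ℤ, T n ω ≤ t ∧ t < T (n + 1) ω ∧ J t ω = J (T n ω) ω)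
    {v : Fin M → ℝ} {A : ℝ} (hA : ∀ i, |v i| ≤ A) {n : ℕ} {t L : ℝ} (ht : 0 ≤ t) (hL : 0 ≤ L)
    (hn : t < T ((n : ℤ) + 1) ω) :
    |∫ s in (0 : ℝ)..t, v (J s ω)| ≤ A * min (T 1 ω) t +
      |∑ k ∈ Finset.range n, jumpBefore T t k ω * (v (J (T ((k : ℤ) + 1) ω) ω) *
        |T ((k : ℤ) + 1 + 1) ω - T ((k : ℤ) + 1) ω|)| +
      A * (L + ∑ k ∈ Finset.range n, jumpBefore T t k ω *
        excess L (T ((k : ℤ) + 1 + 1) ω - T ((k : ℤ) + 1) ω)) := by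
  have hA0 : 0 ≤ A := (abs_nonneg _).trans (hA (J 0 ω))
  have hbd : ∀ a b : ℝ, |∫ s in a..b, v (J s ω)| ≤ A * |b - a| := fun a b =>
    intervalIntegral.norm_integral_le_of_norm_le_const (f := fun s => v (J s ω)) (C := A)
      fun s _ => hA (J s ω)
  have hi := hJ.intervalIntegrable_path v ω
  have hex : 0 ≤ ∑ k ∈ Finset.range n, jumpBefore T t k ω *
        excess L (T ((k : ℤ) + 1 + 1) ω - T ((k : ℤ) + 1) ω) :=
    Finset.sum_nonneg fun k _ => mul_nonneg (jumpBefore_nonneg t k ω) (excess_nonneg _ _)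
  rcases lt_or_ge t (T 1 ω) with h1 | h1
  · have := hbd 0 t
    rw [sub_zero, abs_of_nonneg ht] at this
    rw [min_eq_right h1.le]
    have h2 := abs_nonneg (∑ k ∈ Finset.range n, jumpBefore T t k ω *
      (v (J (T ((k : ℤ) + 1) ω) ω) * |T ((k : ℤ) + 1 + 1) ω - T ((k : ℤ) + 1) ω|))
    have h3 := mul_nonneg hA0 (add_nonneg hL hex)
    linarith
  · obtain ⟨m, hm1, hm2, -⟩ := hpw t
    have hm3 : 1 < m + 1 := hmono.lt_iff_lt.1 (h1.trans_lt hm2)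
    -- The last jump up to `t` has number `N + 1`, so the cut-off keeps exactly the terms `k ≤ N`,
    -- the sojourn in progress included.
    obtain ⟨N, rfl⟩ : ∃ N : ℕ, m = (N : ℤ) + 1 := ⟨(m - 1).toNat, by omega⟩
    have hNn : N < n := by
      have : (N : ℤ) + 1 < (n : ℤ) + 1 := hmono.lt_iff_lt.1 (hm1.trans_lt hn)
      omega
    have hb1 : ∀ k, k < N + 1 → jumpBefore T t k ω = 1 := fun k hk => by
      refine Set.indicator_of_mem ?_ _
      exact (hmono.monotone (show (k : ℤ) + 1 ≤ (N : ℤ) + 1 by omega)).trans hm1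
    have hb0 : ∀ k, N + 1 ≤ k → jumpBefore T t k ω = 0 := fun k hk => by
      refine Set.indicator_of_notMem ?_ _
      exact not_le.2 (hm2.trans_le (hmono.monotone (show (N : ℤ) + 1 + 1 ≤ (k : ℤ) + 1 by omega)))
    have hpos : ∀ k : ℤ, 0 < T (k + 1) ω - T k ω := fun k =>
      sub_pos.2 (hmono (by omega))
    have hsum : ∑ k ∈ Finset.range n, jumpBefore T t k ω * (v (J (T ((k : ℤ) + 1) ω) ω) *
        |T ((k : ℤ) + 1 + 1) ω - T ((k : ℤ) + 1) ω|) =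
        ∫ s in (T 1 ω)..(T ((N : ℤ) + 1 + 1) ω), v (J s ω) := by
      have h2 := intervalIntegral.sum_integral_adjacent_intervals (μ := volume)
        (f := fun s => v (J s ω))
        (a := fun k : ℕ => T ((k : ℤ) + 1) ω) (n := N + 1) fun k _ => hi _ _
      simp only [Nat.cast_zero, zero_add, Nat.cast_add, Nat.cast_one] at h2
      rw [← h2, ← Finset.sum_subset (Finset.range_subset_range.2 (show N + 1 ≤ n by omega))]
      · refine Finset.sum_congr rfl fun k hk => ?_
        rw [hb1 k (Finset.mem_range.1 hk), one_mul, integral_sojourn hmono hpw,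
          abs_of_pos (hpos _)]
      · intro k _ hk
        rw [hb0 k (by simpa using hk), zero_mul]
    have hover : T ((N : ℤ) + 1 + 1) ω - t ≤ L + ∑ k ∈ Finset.range n, jumpBefore T t k ω *
        excess L (T ((k : ℤ) + 1 + 1) ω - T ((k : ℤ) + 1) ω) := by
      have h2 : jumpBefore T t N ω * excess L (T ((N : ℤ) + 1 + 1) ω - T ((N : ℤ) + 1) ω) ≤
          ∑ k ∈ Finset.range n, jumpBefore T t k ω *
          excess L (T ((k : ℤ) + 1 + 1) ω - T ((k : ℤ) + 1) ω) :=
        Finset.single_le_sum (f := fun k : ℕ => jumpBefore T t k ω *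
          excess L (T ((k : ℤ) + 1 + 1) ω - T ((k : ℤ) + 1) ω))
          (fun k _ => mul_nonneg (jumpBefore_nonneg t k ω) (excess_nonneg _ _))
          (Finset.mem_range.2 hNn)
      rw [hb1 N (Nat.lt_succ_self N), one_mul, excess, abs_of_pos (hpos _)] at h2
      have h3 := min_le_right (T ((N : ℤ) + 1 + 1) ω - T ((N : ℤ) + 1) ω) L
      linarith
    have hsplit : ∫ s in (0 : ℝ)..t, v (J s ω) = (∫ s in (0 : ℝ)..(T 1 ω), v (J s ω)) +
        (∫ s in (T 1 ω)..(T ((N : ℤ) + 1 + 1) ω), v (J s ω)) -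
        ∫ s in t..(T ((N : ℤ) + 1 + 1) ω), v (J s ω) := by
      rw [eq_sub_iff_add_eq, intervalIntegral.integral_add_adjacent_intervals (hi _ _) (hi _ _),
        intervalIntegral.integral_add_adjacent_intervals (hi _ _) (hi _ _)]
    rw [hsum, hsplit, min_eq_left h1]
    have h4 := hbd 0 (T 1 ω)
    rw [sub_zero, abs_of_pos h0.2] at h4
    have h5 := hbd t (T ((N : ℤ) + 1 + 1) ω)
    rw [abs_of_pos (sub_pos.2 hm2)] at h5
    have h6 := mul_le_mul_of_nonneg_left hover hA0
    refine (abs_sub _ _).trans ?_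
    have h7 := abs_add_le (∫ s in (0 : ℝ)..(T 1 ω), v (J s ω))
      (∫ s in (T 1 ω)..(T ((N : ℤ) + 1 + 1) ω), v (J s ω))
    linarith

end IsStationarySemiMarkov

theorem tendsto_sqrt_mul_div (D : ℝ) :
    Tendsto (fun N : ℕ => √(N * D) / N) atTop (𝓝 0) := by
  have h : Tendsto (fun N : ℕ => √(D / N)) atTop (𝓝 0) := by
    have := (tendsto_const_div_atTop_nhds_zero_nat D).sqrt
    simpa using this
  refine h.congr' ?_
  filter_upwards [eventually_gt_atTop 0] with N hN
  have hN' : (0 : ℝ) < N := by exact_mod_cast hN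
  rw [eq_div_iff hN'.ne']
  nth_rw 2 [← Real.sqrt_sq hN'.le]
  rw [← Real.sqrt_mul' _ (sq_nonneg _)]
  congr 1
  field_simp

/-- Applied to the first jump time, which may have infinite mean: the interval that contains the
origin is size-biased, and only first moments of the sojourns are assumed. -/
theorem tendsto_integral_min_div {Ω : Type*} [MeasurableSpace Ω] {μ : Measure Ω}
    [IsProbabilityMeasure μ] {X : Ω → ℝ} (hX : Measurable X) (hpos : ∀ᵐ ω ∂μ, 0 < X ω) :
    Tendsto (fun N : ℕ => (∫ ω, min (X ω) N ∂μ) / N) atTop (𝓝 0) := by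
  have h := tendsto_integral_of_dominated_convergence (μ := μ)
    (F := fun (N : ℕ) ω => min (X ω) N / N) (f := fun _ => 0) (fun _ => (1 : ℝ))
    (fun N => (by fun_prop : Measurable fun ω => min (X ω) N / N).aestronglyMeasurable)
    (integrable_const _) (fun N => ?_) (ae_of_all _ fun ω => ?_)
  · simpa [integral_div] using h
  · filter_upwards [hpos] with ω hω
    rw [Real.norm_of_nonneg (by positivity)]
    exact div_le_one_of_le₀ (min_le_right _ _) (Nat.cast_nonneg _)
  · refine (tendsto_const_div_atTop_nhds_zero_nat (X ω)).congr' ?_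
    obtain ⟨N, hN⟩ := exists_nat_ge (X ω)
    filter_upwards [eventually_ge_atTop N] with n hn
    rw [min_eq_left (hN.trans (by exact_mod_cast hn))]

namespace IsStationarySemiMarkov

variable {Ω : Type*} [MeasurableSpace Ω] {μ : Measure Ω} [IsProbabilityMeasure μ] {M : ℕ}
  {p : Matrix (Fin M) (Fin M) ℝ} {F : Fin M → Fin M → Measure ℝ}
  {T : ℤ → Ω → ℝ} {J : ℝ → Ω → Fin M}

/-- Truncate the sojourn at `L` and add `g` of the next state. By the Poisson equation the
conditional mean of this sum is `g` of the present state up to the mean of the excess. The reward is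
thus a martingale difference, a difference of consecutive values of `g`, and two errors due to the
excess. -/
theorem abs_sum_sojourn_le (hJ : IsStationarySemiMarkov μ p F T J) {v g : Fin M → ℝ}
    (hvg : ∀ i, v i * transMean p F (fun _ _ u => |u|) i = g i - ∑ j, p i j * g j)
    {A G L ε : ℝ} (hA : ∀ i, |v i| ≤ A) (hG : ∀ i, |g i| ≤ G) (hL : 0 ≤ L)
    (hε : ∀ i j, ∫ u, excess L u ∂(F i j) ≤ ε) (t : ℝ) (n : ℕ) {ω : Ω}
    (hmono : StrictMono fun n => T n ω) :
    |∑ k ∈ Finset.range n, jumpBefore T t k ω * (v (J (T ((k : ℤ) + 1) ω) ω) *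
        |T ((k : ℤ) + 1 + 1) ω - T ((k : ℤ) + 1) ω|)| ≤
      |∑ k ∈ Finset.range n, jumpBefore T t k ω *
        (transValue T J (fun i j u => v i * min |u| L + g j) ((k : ℤ) + 1) ω -
        transMean p F (fun i j u => v i * min |u| L + g j) (J (T ((k : ℤ) + 1) ω) ω))| +
      A * ∑ k ∈ Finset.range n, excess L (T ((k : ℤ) + 1 + 1) ω - T ((k : ℤ) + 1) ω) +
      n * (A * ε) + 2 * G := by
  have hprob := hJ.sojourn_prob
  have hmean : ∀ i, v i * transMean p F (fun _ _ u => excess L u) i +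
      transMean p F (fun i j u => v i * min |u| L + g j) i = g i := fun i => by
    have h1 : ∀ j, ∫ u, (v i * min |u| L + g j) ∂(F i j) =
        v i * (∫ u, |u| ∂(F i j) - ∫ u, excess L u ∂(F i j)) + g j := fun j => by
      have h2 := (hJ.sojourn_mean i j).abs
      have h3 := integrable_excess hL (hJ.sojourn_mean i j)
      rw [← integral_sub h2 h3, ← integral_const_mul, integral_add]
      · simp [excess]
      · simpa [excess] using (h2.sub h3).const_mul (v i)
      · exact integrable_const _
    have h4 := hvg i
    simp only [transMean, h1] at h4 ⊢
    have h5 : ∑ j, p i j * (v i * (∫ u, |u| ∂(F i j) - ∫ u, excess L u ∂(F i j)) + g j) =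
        v i * ∑ j, p i j * ∫ u, |u| ∂(F i j) - v i * ∑ j, p i j * ∫ u, excess L u ∂(F i j) +
          ∑ j, p i j * g j := by
      rw [Finset.mul_sum, Finset.mul_sum, ← Finset.sum_sub_distrib, ← Finset.sum_add_distrib]
      exact Finset.sum_congr rfl fun j _ => by ring
    rw [h5, h4]
    ring
  have hmε : ∀ i, |transMean p F (fun _ _ u => excess L u) i| ≤ ε :=
    hJ.abs_transMean_le fun i j => by
      rw [abs_of_nonneg (integral_nonneg fun u => excess_nonneg L u)]
      exact hε i j
  have hid : ∀ k : ℕ, jumpBefore T t k ω * (v (J (T ((k : ℤ) + 1) ω) ω) *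
        |T ((k : ℤ) + 1 + 1) ω - T ((k : ℤ) + 1) ω|) =
      jumpBefore T t k ω *
        (transValue T J (fun i j u => v i * min |u| L + g j) ((k : ℤ) + 1) ω -
        transMean p F (fun i j u => v i * min |u| L + g j) (J (T ((k : ℤ) + 1) ω) ω)) +
      jumpBefore T t k ω * (v (J (T ((k : ℤ) + 1) ω) ω) *
        excess L (T ((k : ℤ) + 1 + 1) ω - T ((k : ℤ) + 1) ω)) -
      jumpBefore T t k ω * (v (J (T ((k : ℤ) + 1) ω) ω) *
        transMean p F (fun _ _ u => excess L u) (J (T ((k : ℤ) + 1) ω) ω)) +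
      jumpBefore T t k ω * (g (J (T ((k : ℤ) + 1) ω) ω) -
        g (J (T (((k + 1 : ℕ) : ℤ) + 1) ω) ω)) := fun k => by
    have := hmean (J (T ((k : ℤ) + 1) ω) ω)
    simp only [transValue, excess, Nat.cast_add, Nat.cast_one] at this ⊢
    linear_combination jumpBefore T t k ω * this
  simp_rw [hid]
  rw [Finset.sum_add_distrib, Finset.sum_sub_distrib, Finset.sum_add_distrib]
  have hb := abs_jumpBefore_le_one (T := T) t (ω := ω)
  have e1 : |∑ k ∈ Finset.range n, jumpBefore T t k ω * (v (J (T ((k : ℤ) + 1) ω) ω) *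
        excess L (T ((k : ℤ) + 1 + 1) ω - T ((k : ℤ) + 1) ω))| ≤
      A * ∑ k ∈ Finset.range n, excess L (T ((k : ℤ) + 1 + 1) ω - T ((k : ℤ) + 1) ω) := by
    rw [Finset.mul_sum]
    refine (Finset.abs_sum_le_sum_abs _ _).trans (Finset.sum_le_sum fun k _ => ?_)
    rw [abs_mul, abs_mul, abs_of_nonneg (excess_nonneg _ _)]
    have h1 := mul_le_mul_of_nonneg_right (hA (J (T ((k : ℤ) + 1) ω) ω))
      (excess_nonneg L (T ((k : ℤ) + 1 + 1) ω - T ((k : ℤ) + 1) ω))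
    calc _ ≤ 1 * (|v (J (T ((k : ℤ) + 1) ω) ω)| *
          excess L (T ((k : ℤ) + 1 + 1) ω - T ((k : ℤ) + 1) ω)) :=
          mul_le_mul_of_nonneg_right (hb k) (mul_nonneg (abs_nonneg _) (excess_nonneg _ _))
      _ ≤ _ := by rw [one_mul]; exact h1
  have e2 : |∑ k ∈ Finset.range n, jumpBefore T t k ω * (v (J (T ((k : ℤ) + 1) ω) ω) *
        transMean p F (fun _ _ u => excess L u) (J (T ((k : ℤ) + 1) ω) ω))| ≤ n * (A * ε) := by
    refine (Finset.abs_sum_le_sum_abs _ _).trans ?_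
    refine (Finset.sum_le_card_nsmul _ _ (A * ε) fun k _ => ?_).trans_eq (by simp)
    rw [abs_mul, abs_mul]
    have h1 := mul_le_mul (hA (J (T ((k : ℤ) + 1) ω) ω)) (hmε (J (T ((k : ℤ) + 1) ω) ω))
      (abs_nonneg _) ((abs_nonneg _).trans (hA (J (T ((k : ℤ) + 1) ω) ω)))
    calc _ ≤ 1 * (|v (J (T ((k : ℤ) + 1) ω) ω)| *
          |transMean p F (fun _ _ u => excess L u) (J (T ((k : ℤ) + 1) ω) ω)|) :=
          mul_le_mul_of_nonneg_right (hb k) (mul_nonneg (abs_nonneg _) (abs_nonneg _))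
      _ ≤ _ := by rw [one_mul]; exact h1
  have e3 : |∑ k ∈ Finset.range n, jumpBefore T t k ω * (g (J (T ((k : ℤ) + 1) ω) ω) -
        g (J (T (((k + 1 : ℕ) : ℤ) + 1) ω) ω))| ≤ 2 * G := by
    obtain ⟨m, hm, -⟩ := exists_sum_telescope (fun k => jumpBefore T t k ω)
      (fun k => g (J (T ((k : ℤ) + 1) ω) ω))
      (fun k => by
        by_cases h : T ((k : ℤ) + 1) ω ≤ t
        · exact Or.inr (Set.indicator_of_mem (s := {ω | T ((k : ℤ) + 1) ω ≤ t}) h _)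
        · exact Or.inl (Set.indicator_of_notMem (s := {ω | T ((k : ℤ) + 1) ω ≤ t}) h _))
      (fun k hk => by
        refine Set.indicator_of_notMem (s := {ω | T (((k + 1 : ℕ) : ℤ) + 1) ω ≤ t})
          (fun h : T (((k + 1 : ℕ) : ℤ) + 1) ω ≤ t => ?_) _
        have h1 : T ((k : ℤ) + 1) ω ≤ t :=
          (hmono.monotone (show (k : ℤ) + 1 ≤ ((k + 1 : ℕ) : ℤ) + 1 by omega)).trans h
        have h2 : jumpBefore T t k ω = 1 :=
          Set.indicator_of_mem (s := {ω | T ((k : ℤ) + 1) ω ≤ t}) h1 _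
        simp [h2] at hk) n
    rw [hm]
    refine (abs_sub _ _).trans ?_
    have := hG (J (T (((0 : ℕ) : ℤ) + 1) ω) ω)
    have := hG (J (T ((m : ℤ) + 1) ω) ω)
    linarith
  refine (abs_add_le _ _).trans ?_
  refine (add_le_add (abs_sub _ _) e3).trans ?_
  gcongr
  exact (abs_add_le _ _).trans (by gcongr)

theorem integral_abs_integral_path_le (hJ : IsStationarySemiMarkov μ p F T J)
    {v g : Fin M → ℝ}
    (hvg : ∀ i, v i * transMean p F (fun _ _ u => |u|) i = g i - ∑ j, p i j * g j)
    {A G L ε : ℝ} (hA : ∀ i, |v i| ≤ A) (hG : ∀ i, |g i| ≤ G) (hA0 : 0 ≤ A) (hL : 0 ≤ L)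
    (hε : ∀ i j, ∫ u, excess L u ∂(F i j) ≤ ε) {t : ℝ} (ht : 0 ≤ t) (n : ℕ) :
    ∫ ω, |∫ s in (0 : ℝ)..t, v (J s ω)| ∂μ ≤ A * ∫ ω, min (T 1 ω) t ∂μ +
      √(n * ((2 * (A * L + G)) * (2 * (A * L + G)))) + 3 * (n * (A * ε)) + (2 * G + A * L) +
      A * t * μ.real {ω | T ((n : ℤ) + 1) ω ≤ t} := by
  have hprob := hJ.sojourn_prob
  set φ : Fin M → Fin M → ℝ → ℝ := fun i j u => v i * min |u| L + g j with hφdef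
  have hφ : ∀ i j, Measurable (φ i j) := fun i j => by fun_prop
  have hφC : ∀ i j u, |φ i j u| ≤ A * L + G := fun i j u => by
    refine (abs_add_le _ _).trans (add_le_add ?_ (hG j))
    rw [abs_mul]
    refine mul_le_mul (hA i) ?_ (abs_nonneg _) hA0
    rw [abs_of_nonneg (le_min (abs_nonneg u) hL)]
    exact min_le_right _ _
  have hmart := hJ.integral_abs_martingale_le hφ hφC t n
  have hexm : ∀ k : ℕ, Integrable (fun ω =>
      excess L (T ((k : ℤ) + 1 + 1) ω - T ((k : ℤ) + 1) ω)) μ := fun k =>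
    hJ.integrable_transValue (φ := fun _ _ u => excess L u) (fun _ _ => measurable_excess L)
      (fun i j => integrable_excess hL (hJ.sojourn_mean i j)) (k := (k : ℤ) + 1) (by omega)
  have hexi : ∀ k : ℕ, ∫ ω, excess L (T ((k : ℤ) + 1 + 1) ω - T ((k : ℤ) + 1) ω) ∂μ ≤ ε :=
    fun k => by
      have h := hJ.setIntegral_transValue (φ := fun _ _ u => excess L u)
        (fun _ _ => measurable_excess L)
        (fun i j => integrable_excess hL (hJ.sojourn_mean i j)) (k := (k : ℤ) + 1) (by omega)
        MeasurableSet.univ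
      rw [setIntegral_univ, setIntegral_univ] at h
      refine h.symm.trans_le ?_
      have h1 := norm_integral_le_of_norm_le_const (μ := μ) (C := ε)
        (f := fun ω => transMean p F (fun _ _ u => excess L u) (J (T ((k : ℤ) + 1) ω) ω))
        (ae_of_all _ fun ω => hJ.abs_transMean_le (fun i j => by
          rw [abs_of_nonneg (integral_nonneg fun u => excess_nonneg L u)]
          exact hε i j) _)
      rw [probReal_univ, mul_one] at h1
      exact (le_abs_self _).trans h1
  have hmin : Integrable (fun ω => min (T 1 ω) t) μ := by
    refine (integrable_const t).mono' ((hJ.measurable_T 1).min measurable_const).aestronglyMeasurable ?_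
    filter_upwards [hJ.origin] with ω hω
    rw [Real.norm_of_nonneg (le_min hω.2.le ht)]
    exact min_le_right _ _
  have hmarti : Integrable (fun ω => |∑ k ∈ Finset.range n, jumpBefore T t k ω *
      (transValue T J φ ((k : ℤ) + 1) ω -
        transMean p F φ (J (T ((k : ℤ) + 1) ω) ω))|) μ := by
    refine (integrable_finsetSum _ fun k _ => ?_).abs
    have h1 := hJ.integrable_transValue hφ (fun i j => (integrable_const (A * L + G)).mono'
      (hφ i j).aestronglyMeasurable (ae_of_all _ fun u => hφC i j u)) (k := (k : ℤ) + 1) (by omega)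
    obtain ⟨C, hC⟩ := (Set.finite_range fun i => |transMean p F φ i|).bddAbove
    have h2 : Integrable (fun ω => transMean p F φ (J (T ((k : ℤ) + 1) ω) ω)) μ :=
      (integrable_const C).mono' ((measurable_of_finite (transMean p F φ)).comp
        (hJ.measurable_state _)).aestronglyMeasurable (ae_of_all _ fun ω => hC ⟨_, rfl⟩)
    exact (h1.sub h2).bdd_mul (c := 1) ((measurable_jumpBefore t k).mono
      (hJ.jumpHistory_le _) le_rfl).aestronglyMeasurable
      (ae_of_all _ fun ω => abs_jumpBefore_le_one t k ω)
  have hlast : MeasurableSet {ω | T ((n : ℤ) + 1) ω ≤ t} :=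
    measurableSet_le (hJ.measurable_T _) measurable_const
  have hlasti : Integrable ({ω | T ((n : ℤ) + 1) ω ≤ t}.indicator fun _ => (1 : ℝ)) μ :=
    (integrable_const 1).indicator hlast
  have hexs : Integrable (fun ω => ∑ k ∈ Finset.range n,
      excess L (T ((k : ℤ) + 1 + 1) ω - T ((k : ℤ) + 1) ω)) μ :=
    integrable_finsetSum _ fun k _ => hexm k
  -- With more than `n` jumps by time `t` the trivial bound `A * t` is used. Otherwise the excesses
  -- count twice, in the reward and in the overshoot; together with their conditional means they
  -- give the final factor `3`.
  have hpt : ∀ᵐ ω ∂μ, |∫ s in (0 : ℝ)..t, v (J s ω)| ≤ A * min (T 1 ω) t +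
      |∑ k ∈ Finset.range n, jumpBefore T t k ω * (transValue T J φ ((k : ℤ) + 1) ω -
        transMean p F φ (J (T ((k : ℤ) + 1) ω) ω))| +
      2 * A * ∑ k ∈ Finset.range n, excess L (T ((k : ℤ) + 1 + 1) ω - T ((k : ℤ) + 1) ω) +
      (n * (A * ε) + 2 * G + A * L) +
      A * t * {ω | T ((n : ℤ) + 1) ω ≤ t}.indicator (fun _ => (1 : ℝ)) ω := by
    filter_upwards [hJ.strictMono, hJ.origin, hJ.piecewise] with ω hmono h0 hpw
    have h1 := hJ.abs_sum_sojourn_le hvg hA hG hL hε t n hmono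
    have hex0 : 0 ≤ ∑ k ∈ Finset.range n,
        excess L (T ((k : ℤ) + 1 + 1) ω - T ((k : ℤ) + 1) ω) :=
      Finset.sum_nonneg fun k _ => excess_nonneg _ _
    by_cases hn : T ((n : ℤ) + 1) ω ≤ t
    · rw [Set.indicator_of_mem (s := {ω | T ((n : ℤ) + 1) ω ≤ t}) hn, mul_one]
      have h2 : |∫ s in (0 : ℝ)..t, v (J s ω)| ≤ A * t := by
        have := intervalIntegral.norm_integral_le_of_norm_le_const (f := fun s => v (J s ω))
          (C := A) (a := 0) (b := t) fun s _ => hA (J s ω)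
        rwa [sub_zero, abs_of_nonneg ht] at this
      have h3 : 0 ≤ A * min (T 1 ω) t := mul_nonneg hA0 (le_min h0.2.le ht)
      have h4 : 0 ≤ ε := by
        have i := J 0 ω
        exact (integral_nonneg fun u => excess_nonneg L u).trans (hε i i)
      have h5 : 0 ≤ G := (abs_nonneg _).trans (hG (J 0 ω))
      refine h2.trans (le_add_of_nonneg_left ?_)
      positivity
    · rw [Set.indicator_of_notMem (s := {ω | T ((n : ℤ) + 1) ω ≤ t}) hn, mul_zero, add_zero]
      have h2 := hJ.abs_integral_path_le hmono h0 hpw hA ht hL (not_le.1 hn)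
      have h3 : ∑ k ∈ Finset.range n, jumpBefore T t k ω *
          excess L (T ((k : ℤ) + 1 + 1) ω - T ((k : ℤ) + 1) ω) ≤
          ∑ k ∈ Finset.range n, excess L (T ((k : ℤ) + 1 + 1) ω - T ((k : ℤ) + 1) ω) :=
        Finset.sum_le_sum fun k _ =>
          mul_le_of_le_one_left (excess_nonneg _ _) (jumpBefore_le_one t k ω)
      have h4 := mul_le_mul_of_nonneg_left h3 hA0
      linarith
  have hfin := integral_mono_of_nonneg (ae_of_all μ fun ω => abs_nonneg _)
    (((((hmin.const_mul A).add hmarti).add (hexs.const_mul (2 * A))).add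
      (integrable_const (n * (A * ε) + 2 * G + A * L))).add (hlasti.const_mul (A * t))) hpt
  refine hfin.trans ?_
  rw [integral_add' ((((hmin.const_mul A).add hmarti).add (hexs.const_mul (2 * A))).add
      (integrable_const (n * (A * ε) + 2 * G + A * L))) (hlasti.const_mul (A * t)),
    integral_add' (((hmin.const_mul A).add hmarti).add (hexs.const_mul (2 * A)))
      (integrable_const (n * (A * ε) + 2 * G + A * L)),
    integral_add' ((hmin.const_mul A).add hmarti) (hexs.const_mul (2 * A)),
    integral_add' (hmin.const_mul A) hmarti, integral_const_mul, integral_const_mul,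
    integral_const_mul, integral_finsetSum _ fun k _ => hexm k,
    integral_indicator hlast, integral_const, setIntegral_const, probReal_univ]
  have h6 : ∑ k ∈ Finset.range n,
      ∫ ω, excess L (T ((k : ℤ) + 1 + 1) ω - T ((k : ℤ) + 1) ω) ∂μ ≤ n * ε :=
    (Finset.sum_le_card_nsmul _ _ ε fun k _ => hexi k).trans_eq (by simp)
  have h7 := mul_le_mul_of_nonneg_left h6 hA0
  simp only [smul_eq_mul, one_mul, mul_one]
  nlinarith

theorem tendsto_integral_path (hJ : IsStationarySemiMarkov μ p F T J) {v g : Fin M → ℝ}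
    (hvg : ∀ i, v i * transMean p F (fun _ _ u => |u|) i = g i - ∑ j, p i j * g j)
    (i₀ : Fin M) :
    Tendsto (fun N : ℕ => (∫ ω, |∫ s in (0 : ℝ)..N, v (J s ω)| ∂μ) / N) atTop (𝓝 0) := by
  have hprob := hJ.sojourn_prob
  obtain ⟨A, hA'⟩ := (Set.finite_range fun i => |v i|).bddAbove
  obtain ⟨G, hG'⟩ := (Set.finite_range fun i => |g i|).bddAbove
  have hA : ∀ i, |v i| ≤ A := fun i => hA' ⟨i, rfl⟩
  have hG : ∀ i, |g i| ≤ G := fun i => hG' ⟨i, rfl⟩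
  have hA0 : 0 ≤ A := (abs_nonneg _).trans (hA i₀)
  obtain ⟨r, hr0, hr1, hr⟩ := hJ.exists_measure_T_le i₀
  -- Allowing `K * N` jumps by time `N` makes the exceptional probability at most `(exp 1 * r ^ K) ^
  -- N ≤ 2 ^ (-N)`.
  obtain ⟨K, hK⟩ : ∃ K : ℕ, Real.exp 1 * r ^ K ≤ 1 / 2 := by
    have h := (tendsto_pow_atTop_nhds_zero_of_lt_one hr0 hr1).const_mul (Real.exp 1)
    rw [mul_zero] at h
    exact (h.eventually_le_const (by norm_num : (0 : ℝ) < 1 / 2)).exists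
  rw [Metric.tendsto_atTop']
  intro δ hδ
  -- The order matters: `K` first, then the excess tolerance `ε` in terms of `K`, and only then the
  -- truncation level `L`.
  obtain ⟨ε, hε0, hεδ⟩ : ∃ ε > 0, 3 * (K * (A * ε)) ≤ δ / 2 := by
    refine ⟨δ / (2 * (3 * (K * A) + 1)), by positivity, ?_⟩
    rw [show 3 * (K * (A * (δ / (2 * (3 * (K * A) + 1))))) =
      (3 * (K * A)) / (3 * (K * A) + 1) * (δ / 2) by field_simp]
    exact mul_le_of_le_one_left (by positivity) ((div_le_one (by positivity)).2 (by linarith))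
  obtain ⟨L, hL⟩ : ∃ L : ℕ, ∀ i j, ∫ u, excess L u ∂(F i j) ≤ ε := by
    have h : ∀ᶠ L : ℕ in atTop, ∀ i j, ∫ u, excess L u ∂(F i j) ≤ ε :=
      eventually_all.2 fun i => eventually_all.2 fun j =>
        (tendsto_integral_excess (hJ.sojourn_mean i j)).eventually_le_const hε0
    exact h.exists
  set D := K * ((2 * (A * L + G)) * (2 * (A * L + G)))
  have hlim : Tendsto (fun N : ℕ => A * ((∫ ω, min (T 1 ω) N ∂μ) / N) + √(N * D) / N +
      3 * (K * (A * ε)) + (2 * G + A * L) / N + A * (1 / 2) ^ N) atTop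
      (𝓝 (A * 0 + 0 + 3 * (K * (A * ε)) + 0 + A * 0)) :=
    ((((((tendsto_integral_min_div (hJ.measurable_T 1) (hJ.origin.mono fun _ h => h.2)).const_mul
      A).add (tendsto_sqrt_mul_div D)).add_const _).add
      (tendsto_const_div_atTop_nhds_zero_nat _)).add
      ((tendsto_pow_atTop_nhds_zero_of_lt_one (by norm_num) (by norm_num)).const_mul A))
  have hev := hlim.eventually_lt_const (show _ < δ by linarith)
  obtain ⟨N₀, hN₀⟩ := (hev.and (eventually_gt_atTop 0)).exists_forall_of_atTop
  refine ⟨N₀, fun N hN => ?_⟩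
  obtain ⟨h1, h2⟩ := hN₀ N hN.le
  have hN0 : (0 : ℝ) < N := by exact_mod_cast h2
  rw [Real.dist_eq, sub_zero, abs_of_nonneg
    (div_nonneg (integral_nonneg fun ω => abs_nonneg _) hN0.le)]
  refine lt_of_le_of_lt ?_ h1
  have hb := hJ.integral_abs_integral_path_le hvg hA hG hA0 (Nat.cast_nonneg L) hL hN0.le (K * N)
  have hlast : μ.real {ω | T (((K * N : ℕ) : ℤ) + 1) ω ≤ N} ≤ (1 / 2) ^ N := by
    refine (hr _ _).trans ?_
    rw [pow_mul, ← mul_one (N : ℝ), Real.exp_nat_mul, ← mul_pow]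
    exact pow_le_pow_left₀ (by positivity) hK N
  rw [div_le_iff₀ hN0]
  refine hb.trans ?_
  have e1 : √(((K * N : ℕ) : ℝ) * ((2 * (A * L + G)) * (2 * (A * L + G)))) = √(N * D) := by
    congr 1
    push_cast
    simp only [D]
    ring
  rw [e1]
  have e2 := mul_le_mul_of_nonneg_left hlast (mul_nonneg hA0 hN0.le)
  push_cast at e2 ⊢
  have e3 : (A * ((∫ ω, min (T 1 ω) N ∂μ) / N) + √(N * D) / N + 3 * (K * (A * ε)) +
      (2 * G + A * L) / N + A * (1 / 2) ^ N) * N =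
      A * (∫ ω, min (T 1 ω) N ∂μ) + √(N * D) + 3 * (K * N * (A * ε)) + (2 * G + A * L) +
        A * N * (1 / 2) ^ N := by
    field_simp
  rw [e3]
  linarith

/-- The weak law of large numbers for the time spent in a state. -/
theorem exists_tendsto_occupation (hJ : IsStationarySemiMarkov μ p F T J) (r : Fin M) :
    ∃ c : ℝ, Tendsto (fun N : ℕ =>
      (∫ ω, |∫ s in (0 : ℝ)..N, ((if J s ω = r then 1 else 0) - c)| ∂μ) / N) atTop (𝓝 0) := by
  have hprob := hJ.sojourn_prob
  have hh : ∀ i, 0 < transMean p F (fun _ _ u => |u|) i := fun i => by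
    have hpos : ∀ j, 0 < ∫ u, |u| ∂(F i j) := fun j => by
      rw [integral_pos_iff_support_of_nonneg (fun u => abs_nonneg u) (hJ.sojourn_mean i j).abs]
      have h1 : ({0}ᶜ : Set ℝ) = Function.support fun u : ℝ => |u| := by ext; simp
      rw [← h1, prob_compl_eq_one_sub (measurableSet_singleton 0),
        measure_mono_null (by simp) (hJ.sojourn_pos i j), tsub_zero]
      exact one_pos
    have hnn : ∀ j ∈ Finset.univ, 0 ≤ p i j * ∫ u, |u| ∂(F i j) := fun j _ =>
      mul_nonneg (hJ.irreducible.nonneg i j) (hpos j).le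
    refine lt_of_le_of_ne (Finset.sum_nonneg hnn) fun h0 => ?_
    have h1 := (Finset.sum_eq_zero_iff_of_nonneg hnn).1 h0.symm
    have h2 : ∑ j, p i j = 0 := Finset.sum_eq_zero fun j hj =>
      (mul_eq_zero.1 (h1 j hj)).resolve_right (hpos j).ne'
    rw [hJ.row_sum] at h2
    exact one_ne_zero h2
  -- Here `h` is the mean sojourn time, so that `c` is a frequency per unit of time and the centred
  -- reward is the indicator of `r` minus `c`.
  obtain ⟨c, g, hcg⟩ := exists_poissonEquation hJ.row_sum hJ.irreducible hh
    (fun i => (if i = r then 1 else 0) * transMean p F (fun _ _ u => |u|) i) r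
  exact ⟨c, hJ.tendsto_integral_path (v := fun i => (if i = r then 1 else 0) - c) (g := g)
    (fun i => by linear_combination hcg i) r⟩

end IsStationarySemiMarkov

/-! ### A countable description of the modulating process -/

section PathCode

variable {M : ℕ}

/-- The pairs of a time `t` and a rational skeleton `x` whose right limit at `t` is `r`. -/
def rightLimitSet (r : Fin M) : Set (ℝ × (ℚ → Fin M)) :=
  {z | ∀ᶠ m : ℕ in atTop, z.2 ((⌊(m : ℝ) * z.1⌋ + 1 : ℚ) / m) = r}

theorem measurableSet_rightLimitSet (r : Fin M) : MeasurableSet (rightLimitSet r) := by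
  have h : ∀ m : ℕ, MeasurableSet
      {z : ℝ × (ℚ → Fin M) | z.2 ((⌊(m : ℝ) * z.1⌋ + 1 : ℚ) / m) = r} := fun m => by
    have h1 : Measurable fun z : ℤ × (ℚ → Fin M) => z.2 ((z.1 + 1 : ℚ) / m) :=
      measurable_from_prod_countable_right fun a => measurable_pi_apply ((a + 1 : ℚ) / m)
    have h2 : Measurable fun z : ℝ × (ℚ → Fin M) => (⌊(m : ℝ) * z.1⌋, z.2) :=
      (Int.measurable_floor.comp (measurable_fst.const_mul _)).prodMk measurable_snd
    exact (h1.comp h2) (measurableSet_singleton r)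
  have h3 : rightLimitSet r = ⋃ N : ℕ, ⋂ m : ℕ, ⋂ _ : N ≤ m,
      {z : ℝ × (ℚ → Fin M) | z.2 ((⌊(m : ℝ) * z.1⌋ + 1 : ℚ) / m) = r} := by
    ext z
    simp [rightLimitSet, eventually_atTop]
  rw [h3]
  exact MeasurableSet.iUnion fun N => MeasurableSet.iInter fun m => MeasurableSet.iInter fun _ => h m

/-- The indicator that the path with rational skeleton `x` is in the state `r` at time `t`. -/
def occupied (r : Fin M) (x : ℚ → Fin M) (t : ℝ) : ℝ :=
  (rightLimitSet r).indicator (fun _ => 1) (t, x)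

theorem measurable_occupied (r : Fin M) :
    Measurable fun z : ℝ × (ℚ → Fin M) => occupied r z.2 z.1 :=
  measurable_const.indicator (measurableSet_rightLimitSet r)

theorem measurable_occupied_left (r : Fin M) (x : ℚ → Fin M) : Measurable (occupied r x) :=
  (measurable_occupied r).comp (measurable_id.prodMk measurable_const)

theorem occupied_nonneg (r : Fin M) (x : ℚ → Fin M) (t : ℝ) : 0 ≤ occupied r x t :=
  Set.indicator_nonneg (fun _ _ => zero_le_one) _

theorem occupied_le_one (r : Fin M) (x : ℚ → Fin M) (t : ℝ) : occupied r x t ≤ 1 :=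
  Set.indicator_le_self' (fun _ _ => zero_le_one) _

theorem abs_occupied_le_one (r : Fin M) (x : ℚ → Fin M) (t : ℝ) : |occupied r x t| ≤ 1 := by
  rw [abs_of_nonneg (occupied_nonneg r x t)]
  exact occupied_le_one r x t

/-- The restriction to rational times of the path shifted by `h`. -/
def skeleton {Ω : Type*} (J : ℝ → Ω → Fin M) (h : ℝ) (ω : Ω) (q : ℚ) : Fin M := J (q + h) ω

end PathCode

theorem tendsto_floor_mul_add_one_div (t : ℝ) :
    Tendsto (fun m : ℕ => ((⌊(m : ℝ) * t⌋ : ℝ) + 1) / m) atTop (𝓝 t) := by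
  have h : Tendsto (fun m : ℕ => t + 1 / (m : ℝ)) atTop (𝓝 (t + 0)) :=
    tendsto_const_nhds.add (tendsto_const_div_atTop_nhds_zero_nat 1)
  rw [add_zero] at h
  refine tendsto_of_tendsto_of_tendsto_of_le_of_le' tendsto_const_nhds h ?_ ?_
  · filter_upwards [eventually_gt_atTop 0] with m hm
    have hm' : (0 : ℝ) < m := by exact_mod_cast hm
    rw [le_div_iff₀ hm']
    linarith [Int.lt_floor_add_one ((m : ℝ) * t)]
  · filter_upwards [eventually_gt_atTop 0] with m hm
    have hm' : (0 : ℝ) < m := by exact_mod_cast hm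
    rw [div_le_iff₀ hm']
    have := Int.floor_le ((m : ℝ) * t)
    field_simp
    linarith

theorem lt_floor_mul_add_one_div (t : ℝ) {m : ℕ} (hm : 0 < m) :
    t < ((⌊(m : ℝ) * t⌋ : ℝ) + 1) / m := by
  have hm' : (0 : ℝ) < m := by exact_mod_cast hm
  rw [lt_div_iff₀ hm']
  linarith [Int.lt_floor_add_one ((m : ℝ) * t)]

namespace IsStationarySemiMarkov

variable {Ω : Type*} [MeasurableSpace Ω] {μ : Measure Ω} [IsProbabilityMeasure μ] {M : ℕ}
  {p : Matrix (Fin M) (Fin M) ℝ} {F : Fin M → Fin M → Measure ℝ}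
  {T : ℤ → Ω → ℝ} {J : ℝ → Ω → Fin M}

theorem measurable_J_apply (hJ : IsStationarySemiMarkov μ p F T J) (t : ℝ) : Measurable (J t) :=
  hJ.measurable_J.comp measurable_prodMk_left

/-- Paths are right-continuous step functions, so their rational times determine them. Stationarity
is a statement about the product σ-algebra, and this countable code makes time integrals measurable
functions on which it can act. -/
theorem occupied_skeleton (hJ : IsStationarySemiMarkov μ p F T J) :
    ∀ᵐ ω ∂μ, ∀ (h t : ℝ) (r : Fin M),
      occupied r (skeleton J h ω) t = if J (h + t) ω = r then 1 else 0 := by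
  filter_upwards [hJ.strictMono, hJ.piecewise] with ω hmono hpw h t r
  obtain ⟨n, hn1, hn2, hn3⟩ := hpw (h + t)
  have hev : ∀ᶠ m : ℕ in atTop,
      skeleton J h ω ((⌊(m : ℝ) * t⌋ + 1 : ℚ) / m) = J (h + t) ω := by
    have h1 := (tendsto_floor_mul_add_one_div t).eventually_lt_const
      (show t < T (n + 1) ω - h by linarith)
    filter_upwards [h1, eventually_gt_atTop 0] with m hm hm0
    have h2 := lt_floor_mul_add_one_div t hm0
    unfold skeleton
    push_cast
    rw [hn3]
    exact path_eq hmono hpw (by linarith) (by linarith)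
  by_cases hr : J (h + t) ω = r
  · rw [if_pos hr]
    refine Set.indicator_of_mem (s := rightLimitSet r) ?_ _
    filter_upwards [hev] with m hm
    rw [← hr, ← hm]
  · rw [if_neg hr]
    refine Set.indicator_of_notMem (s := rightLimitSet r) (fun hmem => hr ?_) _
    obtain ⟨m, hm1, hm2⟩ := (Eventually.and hmem hev).exists
    rw [← hm1, ← hm2]

theorem measurable_skeleton (hJ : IsStationarySemiMarkov μ p F T J) (h : ℝ) :
    Measurable (skeleton J h) :=
  measurable_pi_lambda _ fun q => hJ.measurable_J_apply (q + h)

theorem map_skeleton (hJ : IsStationarySemiMarkov μ p F T J) (h : ℝ) :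
    μ.map (skeleton J h) = μ.map (skeleton J 0) := by
  have hres : Measurable fun (x : ℝ → Fin M) (q : ℚ) => x q :=
    measurable_pi_lambda _ fun q => measurable_pi_apply (q : ℝ)
  have h1 : ∀ h : ℝ, μ.map (skeleton J h) =
      (μ.map fun ω (t : ℝ) => J (t + h) ω).map fun x (q : ℚ) => x q := fun h => by
    rw [Measure.map_map hres (measurable_pi_lambda _ fun t => hJ.measurable_J_apply (t + h))]
    rfl
  rw [h1, h1, hJ.stationary h]
  simp

theorem measureReal_state (hJ : IsStationarySemiMarkov μ p F T J) (h : ℝ) (r : Fin M) :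
    μ.real {ω | J h ω = r} = μ.real {ω | J 0 ω = r} := by
  have h0 : MeasurableSet {x : ℚ → Fin M | x 0 = r} :=
    measurableSet_eq_fun (measurable_pi_apply (0 : ℚ)) measurable_const
  have h1 : ∀ h : ℝ, μ.real {ω | J h ω = r} = (μ.map (skeleton J h)).real {x | x 0 = r} :=
    fun h => by
      rw [map_measureReal_apply (hJ.measurable_skeleton h) h0]
      simp [skeleton]
  rw [h1 h, hJ.map_skeleton, ← h1 0]

theorem integral_state (hJ : IsStationarySemiMarkov μ p F T J) (h : ℝ) (r : Fin M) :
    ∫ ω, (if J h ω = r then 1 else 0 : ℝ) ∂μ = μ.real {ω | J 0 ω = r} := by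
  have hs : MeasurableSet {ω | J h ω = r} := hJ.measurable_J_apply h (measurableSet_singleton r)
  rw [← hJ.measureReal_state h r, ← integral_indicator_one hs]
  exact integral_congr_ae (ae_of_all _ fun ω => by simp [Set.indicator])

theorem measurable_occupation_integrand (hJ : IsStationarySemiMarkov μ p F T J) (r : Fin M) :
    Measurable fun z : ℝ × Ω => (if J z.1 z.2 = r then 1 else 0 : ℝ) :=
  (measurable_of_finite fun i : Fin M => (if i = r then 1 else 0 : ℝ)).comp hJ.measurable_J

theorem integral_integral_state (hJ : IsStationarySemiMarkov μ p F T J) (t : ℝ) (r : Fin M) :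
    Integrable (fun ω => ∫ s in (0 : ℝ)..t, (if J s ω = r then 1 else 0 : ℝ)) μ ∧
    ∫ ω, (∫ s in (0 : ℝ)..t, (if J s ω = r then 1 else 0 : ℝ)) ∂μ =
      t * μ.real {ω | J 0 ω = r} := by
  have hint : Integrable (Function.uncurry fun s ω => (if J s ω = r then 1 else 0 : ℝ))
      ((volume.restrict (Set.uIoc 0 t)).prod μ) := by
    have : IsFiniteMeasure (volume.restrict (Set.uIoc 0 t)) := ⟨by simp [Set.uIoc]⟩
    refine (integrable_const (1 : ℝ)).mono'
      (hJ.measurable_occupation_integrand r).aestronglyMeasurable (ae_of_all _ fun z => ?_)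
    simp only [Function.uncurry]
    split_ifs <;> simp
  constructor
  · rcases le_total 0 t with ht | ht
    · rw [Set.uIoc_of_le ht] at hint
      simp_rw [intervalIntegral.integral_of_le ht]
      exact hint.integral_prod_right
    · rw [Set.uIoc_of_ge ht] at hint
      simp_rw [intervalIntegral.integral_of_ge ht]
      exact hint.integral_prod_right.neg
  · rw [← intervalIntegral_integral_swap hint]
    simp_rw [hJ.integral_state]
    simp

/-- By stationarity the mean occupation time of `[0, N]` is exactly `N` times the probability of `r`
at time `0`. Convergence in `L¹` then forces the constant `c` to be that probability. -/
theorem tendsto_occupation (hJ : IsStationarySemiMarkov μ p F T J) (r : Fin M) :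
    Tendsto (fun N : ℕ => (∫ ω, |(∫ s in (0 : ℝ)..N, (if J s ω = r then 1 else 0 : ℝ)) -
      N * μ.real {ω | J 0 ω = r}| ∂μ) / N) atTop (𝓝 0) := by
  obtain ⟨c, hc⟩ := hJ.exists_tendsto_occupation r
  have hi : ∀ ω (a b : ℝ), IntervalIntegrable (fun s => (if J s ω = r then 1 else 0 : ℝ))
      volume a b := fun ω a b =>
    hJ.intervalIntegrable_path (fun i => (if i = r then 1 else 0 : ℝ)) ω a b
  have hc' : Tendsto (fun N : ℕ => (∫ ω, |(∫ s in (0 : ℝ)..N,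
      (if J s ω = r then 1 else 0 : ℝ)) - N * c| ∂μ) / N) atTop (𝓝 0) := by
    refine hc.congr fun N => ?_
    congr 1
    refine integral_congr_ae (ae_of_all _ fun ω => ?_)
    simp only
    rw [intervalIntegral.integral_sub (hi ω _ _) intervalIntegrable_const]
    simp
  have hle : |μ.real {ω | J 0 ω = r} - c| ≤ 0 := by
    refine ge_of_tendsto hc' ?_
    filter_upwards [eventually_gt_atTop 0] with N hN
    have hN' : (0 : ℝ) < N := by exact_mod_cast hN
    obtain ⟨h1, h2⟩ := hJ.integral_integral_state N r
    rw [le_div_iff₀ hN']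
    calc |μ.real {ω | J 0 ω = r} - c| * N
        = |∫ ω, ((∫ s in (0 : ℝ)..N, (if J s ω = r then 1 else 0 : ℝ)) - N * c) ∂μ| := by
          rw [integral_sub h1 (integrable_const _), h2]
          simp only [integral_const, probReal_univ, smul_eq_mul, one_mul]
          rw [← mul_sub, abs_mul, abs_of_pos hN', mul_comm]
      _ ≤ _ := abs_integral_le_integral_abs
  have : c = μ.real {ω | J 0 ω = r} := by
    have := abs_nonpos_iff.1 hle
    linarith
  rwa [this] at hc'

/-- The mean deviation of the time spent in `r` during an interval of length `N`, which by
stationarity is the same for all such intervals. -/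
theorem integral_occupied_skeleton (hJ : IsStationarySemiMarkov μ p F T J) (r : Fin M)
    (N : ℕ) (h : ℝ) :
    ∫ ω, |(∫ s in (0 : ℝ)..N, occupied r (skeleton J 0 ω) (h + s)) -
        N * μ.real {ω | J 0 ω = r}| ∂μ =
      ∫ ω, |(∫ s in (0 : ℝ)..N, (if J s ω = r then 1 else 0 : ℝ)) -
        N * μ.real {ω | J 0 ω = r}| ∂μ := by
  have hm : Measurable fun x : ℚ → Fin M =>
      |(∫ s in (0 : ℝ)..N, occupied r x s) - N * μ.real {ω | J 0 ω = r}| := by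
    have h1 : Measurable fun x : ℚ → Fin M => ∫ s in (0 : ℝ)..N, occupied r x s := by
      simp_rw [intervalIntegral.integral_of_le (Nat.cast_nonneg (α := ℝ) N)]
      exact (StronglyMeasurable.integral_prod_right' (f := fun z : (ℚ → Fin M) × ℝ =>
        occupied r z.1 z.2) ((measurable_occupied r).comp measurable_swap).stronglyMeasurable).measurable
    exact (h1.sub_const _).abs
  -- The deviation over the window that starts at `h` is one fixed function of the code shifted by
  -- `h`, whose law does not depend on `h`.
  have key : ∀ h : ℝ, ∫ ω, |(∫ s in (0 : ℝ)..N, (if J (h + s) ω = r then 1 else 0 : ℝ)) -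
        N * μ.real {ω | J 0 ω = r}| ∂μ = ∫ x, |(∫ s in (0 : ℝ)..N, occupied r x s) -
          N * μ.real {ω | J 0 ω = r}| ∂(μ.map (skeleton J h)) := fun h => by
    rw [integral_map (hJ.measurable_skeleton h).aemeasurable hm.aestronglyMeasurable]
    refine integral_congr_ae ?_
    filter_upwards [hJ.occupied_skeleton] with ω hω
    simp_rw [hω]
  have h0 := key 0
  rw [← hJ.map_skeleton h, ← key h] at h0
  simp_rw [zero_add] at h0
  rw [h0]
  refine integral_congr_ae ?_
  filter_upwards [hJ.occupied_skeleton] with ω hω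
  simp_rw [hω, zero_add]

end IsStationarySemiMarkov

/-! ### States seen by blocks of Poisson arrivals -/

/-- For independent variables, means of bounded functions are iterated means. -/
theorem IndepFun.integral_eq_integral_integral {Ω α β : Type*} [MeasurableSpace Ω]
    [MeasurableSpace α] [MeasurableSpace β] {μ : Measure Ω} [IsProbabilityMeasure μ]
    {X : Ω → α} {Y : Ω → β} (hX : Measurable X) (hY : Measurable Y) (hXY : IndepFun X Y μ)
    {H : α → β → ℝ} (hH : Measurable (Function.uncurry H)) {C : ℝ} (hC : ∀ x y, |H x y| ≤ C) :
    ∫ ω, H (X ω) (Y ω) ∂μ = ∫ ω, ∫ ω', H (X ω) (Y ω') ∂μ ∂μ ∧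
    ∫ ω, H (X ω) (Y ω) ∂μ = ∫ ω', ∫ ω, H (X ω) (Y ω') ∂μ ∂μ := by
  have hmap := (indepFun_iff_map_prod_eq_prod_map_map hX.aemeasurable hY.aemeasurable).1 hXY
  have hm : Measurable fun ω => (X ω, Y ω) := hX.prodMk hY
  have := Measure.isProbabilityMeasure_map (μ := μ) hX.aemeasurable
  have := Measure.isProbabilityMeasure_map (μ := μ) hY.aemeasurable
  have hint : Integrable (Function.uncurry H) ((μ.map X).prod (μ.map Y)) :=
    (integrable_const C).mono' hH.aestronglyMeasurable (ae_of_all _ fun z => hC z.1 z.2)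
  have h1 : ∫ ω, H (X ω) (Y ω) ∂μ =
      ∫ z, Function.uncurry H z ∂((μ.map X).prod (μ.map Y)) := by
    rw [← hmap, integral_map hm.aemeasurable hH.aestronglyMeasurable]
    rfl
  constructor
  · rw [h1, integral_prod _ hint]
    simp only [Function.uncurry_apply_pair]
    rw [integral_map hX.aemeasurable
      (hH.stronglyMeasurable.integral_prod_right (ν := μ.map Y)).aestronglyMeasurable]
    refine integral_congr_ae (ae_of_all _ fun ω => ?_)
    exact integral_map hY.aemeasurable
      (hH.comp (measurable_const.prodMk measurable_id)).aestronglyMeasurable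
  · rw [h1, integral_prod_symm _ hint]
    simp only [Function.uncurry_apply_pair]
    rw [integral_map hY.aemeasurable
      (hH.stronglyMeasurable.integral_prod_left (μ := μ.map X)).aestronglyMeasurable]
    refine integral_congr_ae (ae_of_all _ fun ω => ?_)
    exact integral_map hX.aemeasurable
      (hH.comp (measurable_id.prodMk measurable_const)).aestronglyMeasurable

/-- The spacing between the points number `n` and `n + 1`, the origin being number zero. -/
def spacing {Ω : Type*} (τ : ℤ → Ω → ℝ) (n : ℕ) (ω : Ω) : ℝ :=
  withOrigin τ ((n : ℤ) + 1) ω - withOrigin τ n ω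

theorem sum_spacing {Ω : Type*} (τ : ℤ → Ω → ℝ) (n : ℕ) (ω : Ω) :
    ∑ k ∈ Finset.range (n + 1), spacing τ k ω = τ ((n : ℤ) + 1) ω := by
  have h : ∀ n : ℕ, ∑ k ∈ Finset.range n, spacing τ k ω = withOrigin τ n ω := fun n => by
    induction n with
    | zero => simp [withOrigin]
    | succ n ih =>
      rw [Finset.sum_range_succ, ih, spacing]
      push_cast
      ring
  rw [h]
  simp [withOrigin, show (0 : ℤ) < (n : ℤ) + 1 by omega]

namespace IsUnitPoisson

variable {Ω : Type*} [MeasurableSpace Ω] {μ : Measure Ω} {τ : ℤ → Ω → ℝ}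

theorem measurable_withOrigin_of {m : MeasurableSpace Ω} (h : ∀ n, Measurable[m] (τ n)) (n : ℤ) :
    Measurable[m] (withOrigin τ n) := by
  unfold withOrigin
  split_ifs
  · exact h n
  · exact measurable_const
  · exact h (n + 1)

theorem measurable_spacing (hτ : IsUnitPoisson μ τ) (n : ℕ) : Measurable (spacing τ n) :=
  (measurable_withOrigin_of hτ.measurable _).sub (measurable_withOrigin_of hτ.measurable _)

theorem law_spacing (hτ : IsUnitPoisson μ τ) (n : ℕ) : HasLaw (spacing τ n) (expMeasure 1) μ :=
  hτ.law n

theorem indep_spacing (hτ : IsUnitPoisson μ τ) : iIndepFun (spacing τ) μ :=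
  hτ.indep.precomp (g := fun n : ℕ => (n : ℤ)) Nat.cast_injective

theorem spacing_pos (hτ : IsUnitPoisson μ τ) : ∀ᵐ ω ∂μ, ∀ n, 0 < spacing τ n ω := by
  refine ae_all_iff.2 fun n => ?_
  have h := expMeasure_one_ae_pos
  rw [← (hτ.law_spacing n).map_eq] at h
  exact ae_of_ae_map (hτ.measurable_spacing n).aemeasurable h

end IsUnitPoisson

namespace IsModulatedRequestProcess

variable {Ω : Type*} [MeasurableSpace Ω] {μ : Measure Ω} [IsProbabilityMeasure μ]
  {M : ℕ} {p : Matrix (Fin M) (Fin M) ℝ} {F : Fin M → Fin M → Measure ℝ} {Q : Fin M → PMF ℕ}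
  {T : ℤ → Ω → ℝ} {J : ℝ → Ω → Fin M} {τ : ℤ → Ω → ℝ} {R : ℤ → Ω → ℕ}

theorem indepFun_skeleton_spacing (hR : IsModulatedRequestProcess μ p F Q T J τ R) :
    IndepFun (skeleton J 0) (fun ω n => spacing τ n ω) μ := by
  rw [IndepFun_iff_Indep]
  refine indep_of_indep_of_le_left (indep_of_indep_of_le_right hR.indep ?_) ?_
  · rw [← measurable_iff_comap_le]
    have h : ∀ n, Measurable[arrivalInfo τ] (τ n) := fun n =>
      measurable_iff_comap_le.2 (le_iSup (fun n => MeasurableSpace.comap (τ n) inferInstance) n)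
    exact @measurable_pi_lambda _ _ _ (arrivalInfo τ) _ _ fun n =>
      (IsUnitPoisson.measurable_withOrigin_of h _).sub (IsUnitPoisson.measurable_withOrigin_of h _)
  · rw [← measurable_iff_comap_le]
    have h : ∀ t, Measurable[modulatingInfo T J] (J t) := fun t =>
      measurable_iff_comap_le.2 (le_sup_of_le_right
        (le_iSup (fun t => MeasurableSpace.comap (J t) inferInstance) t))
    exact @measurable_pi_lambda _ _ _ (modulatingInfo T J) _ _ fun q => h (q + 0)

theorem measurable_spacing (hR : IsModulatedRequestProcess μ p F Q T J τ R) :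
    Measurable fun ω n => spacing τ n ω :=
  measurable_pi_lambda _ fun n => hR.poisson.measurable_spacing n

theorem occupied_arrival (hR : IsModulatedRequestProcess μ p F Q T J τ R) :
    ∀ᵐ ω ∂μ, ∀ (n : ℕ) (r : Fin M), (if J (τ ((n : ℤ) + 1) ω) ω = r then 1 else 0 : ℝ) =
      occupied r (skeleton J 0 ω) (∑ k ∈ Finset.range (n + 1), spacing τ k ω) := by
  filter_upwards [hR.semiMarkov.occupied_skeleton] with ω hω n r
  rw [hω, zero_add, sum_spacing]

/-- With the arrival times frozen, the state at a fixed time has its stationary law. Hence an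
arrival sees the stationary law, independently of its own time. -/
theorem integral_arrival_state (hR : IsModulatedRequestProcess μ p F Q T J τ R) {A : Set ℝ}
    (hA : MeasurableSet A) (n : ℕ) (r : Fin M) :
    ∫ ω in {ω | τ ((n : ℤ) + 1) ω ∈ A}, (if J (τ ((n : ℤ) + 1) ω) ω = r then 1 else 0 : ℝ) ∂μ =
      μ.real {ω | τ ((n : ℤ) + 1) ω ∈ A} * μ.real {ω | J 0 ω = r} := by
  have hs : MeasurableSet {ω | τ ((n : ℤ) + 1) ω ∈ A} := hR.poisson.measurable _ hA
  have hsum : Measurable fun y : ℕ → ℝ => ∑ k ∈ Finset.range (n + 1), y k :=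
    Finset.measurable_sum _ fun k _ => measurable_pi_apply k
  have h := (IndepFun.integral_eq_integral_integral
    (hR.semiMarkov.measurable_skeleton 0) hR.measurable_spacing hR.indepFun_skeleton_spacing
    (H := fun x y => A.indicator (fun _ => (1 : ℝ)) (∑ k ∈ Finset.range (n + 1), y k) *
      occupied r x (∑ k ∈ Finset.range (n + 1), y k)) ?_ (C := 1) ?_).2
  · rw [← integral_indicator hs]
    have h1 : ∀ᵐ ω ∂μ, {ω | τ ((n : ℤ) + 1) ω ∈ A}.indicator
        (fun ω => (if J (τ ((n : ℤ) + 1) ω) ω = r then 1 else 0 : ℝ)) ω =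
        A.indicator (fun _ => (1 : ℝ)) (∑ k ∈ Finset.range (n + 1), spacing τ k ω) *
          occupied r (skeleton J 0 ω) (∑ k ∈ Finset.range (n + 1), spacing τ k ω) := by
      filter_upwards [hR.occupied_arrival] with ω hω
      rw [← hω, sum_spacing]
      by_cases hmem : τ ((n : ℤ) + 1) ω ∈ A <;> simp [Set.indicator, hmem]
    rw [integral_congr_ae h1, h]
    have h2 : ∀ t, ∫ ω, occupied r (skeleton J 0 ω) t ∂μ = μ.real {ω | J 0 ω = r} := fun t => by
      rw [← hR.semiMarkov.integral_state t r]
      refine integral_congr_ae ?_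
      filter_upwards [hR.semiMarkov.occupied_skeleton] with ω hω
      rw [hω, zero_add]
    simp_rw [integral_const_mul, h2, sum_spacing]
    rw [integral_mul_const, ← integral_indicator_one hs]
    rfl
  · exact ((measurable_const.indicator hA).comp (hsum.comp measurable_snd)).mul
      ((measurable_occupied r).comp ((hsum.comp measurable_snd).prodMk measurable_fst))
  · intro x y
    rw [abs_mul]
    have h1 : |A.indicator (fun _ => (1 : ℝ)) (∑ k ∈ Finset.range (n + 1), y k)| ≤ 1 := by
      by_cases hmem : ∑ k ∈ Finset.range (n + 1), y k ∈ A <;> simp [Set.indicator, hmem]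
    exact mul_le_one₀ h1 (abs_nonneg _) (abs_occupied_le_one _ _ _)

theorem measurable_integral_occupied (r : Fin M) (a B : ℕ) :
    Measurable fun z : (ℚ → Fin M) × (ℕ → ℝ) =>
      ∫ s in (0 : ℝ)..B, occupied r z.1 (∑ k ∈ Finset.range a, z.2 k + s) := by
  have hsum : Measurable fun y : ℕ → ℝ => ∑ k ∈ Finset.range a, y k :=
    Finset.measurable_sum _ fun k _ => measurable_pi_apply k
  simp_rw [intervalIntegral.integral_of_le (Nat.cast_nonneg (α := ℝ) B)]
  exact (StronglyMeasurable.integral_prod_right' (f := fun z : ((ℚ → Fin M) × (ℕ → ℝ)) × ℝ =>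
    occupied r z.1.1 (∑ k ∈ Finset.range a, z.1.2 k + z.2)) ((measurable_occupied r).comp
      (((hsum.comp (measurable_snd.comp measurable_fst)).add measurable_snd).prodMk
        (measurable_fst.comp measurable_fst))).stronglyMeasurable).measurable

/-- The expected deviation of the number of requests of a block that are made in state `r`. -/
theorem integral_block_deviation_le (hR : IsModulatedRequestProcess μ p F Q T J τ R)
    (r : Fin M) (a B : ℕ) :
    ∫ ω, |∑ k ∈ Finset.Ico a (a + B), (if J (τ ((k : ℤ) + 1) ω) ω = r then 1 else 0 : ℝ) -
        B * μ.real {ω | J 0 ω = r}| ∂μ ≤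
      2 * √(B * samplingVariance) +
        ∫ ω, |(∫ s in (0 : ℝ)..B, (if J s ω = r then 1 else 0 : ℝ)) -
          B * μ.real {ω | J 0 ω = r}| ∂μ := by
  set π := μ.real {ω | J 0 ω = r} with hπ
  have hX := hR.semiMarkov.measurable_skeleton 0
  have hY := hR.measurable_spacing
  have hXY := hR.indepFun_skeleton_spacing
  -- The deviation is split at the occupation time of the window of deterministic length `B` that
  -- starts at the `a`-th arrival. `H₁` is the sampling error and `H₂` the fluctuation of the path.
  set H₁ : (ℚ → Fin M) → (ℕ → ℝ) → ℝ := fun x y =>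
    |∑ k ∈ Finset.Ico a (a + B), occupied r x (∑ l ∈ Finset.range (k + 1), y l) -
      ∫ s in (0 : ℝ)..B, occupied r x (∑ k ∈ Finset.range a, y k + s)| with hH₁
  set H₂ : (ℚ → Fin M) → (ℕ → ℝ) → ℝ := fun x y =>
    |(∫ s in (0 : ℝ)..B, occupied r x (∑ k ∈ Finset.range a, y k + s)) - B * π| with hH₂
  have hI : ∀ (x : ℚ → Fin M) (y : ℕ → ℝ), |∫ s in (0 : ℝ)..B, occupied r x (∑ k ∈ Finset.range a, y k + s)| ≤ B :=
    fun x y => by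
      have := intervalIntegral.norm_integral_le_of_norm_le_const (a := 0) (b := B) (C := 1)
        (f := fun s => occupied r x (∑ k ∈ Finset.range a, y k + s))
        fun s _ => abs_occupied_le_one r x _
      simpa using this
  have hS : ∀ (x : ℚ → Fin M) (y : ℕ → ℝ), |∑ k ∈ Finset.Ico a (a + B),
      occupied r x (∑ l ∈ Finset.range (k + 1), y l)| ≤ B := fun x y => by
    refine (Finset.abs_sum_le_sum_abs _ _).trans ?_
    refine (Finset.sum_le_card_nsmul _ _ 1 fun k _ => abs_occupied_le_one r x _).trans_eq ?_
    simp
  have hm₁ : Measurable (Function.uncurry H₁) := by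
    refine Measurable.abs (Measurable.sub (Finset.measurable_sum _ fun k _ => ?_)
      (measurable_integral_occupied r a B))
    have hsum : Measurable fun y : ℕ → ℝ => ∑ l ∈ Finset.range (k + 1), y l :=
      Finset.measurable_sum _ fun l _ => measurable_pi_apply l
    exact (measurable_occupied r).comp ((hsum.comp measurable_snd).prodMk measurable_fst)
  have hm₂ : Measurable (Function.uncurry H₂) :=
    ((measurable_integral_occupied r a B).sub_const _).abs
  have hC₁ : ∀ x y, |H₁ x y| ≤ 2 * B := fun x y => by
    rw [hH₁]
    simp only
    rw [abs_abs]
    refine (abs_sub _ _).trans ?_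
    linarith [hI x y, hS x y]
  have hC₂ : ∀ x y, |H₂ x y| ≤ 2 * B := fun x y => by
    rw [hH₂]
    simp only
    rw [abs_abs]
    refine (abs_sub _ _).trans ?_
    have h1 : |(B : ℝ) * π| ≤ B := by
      rw [abs_of_nonneg (by positivity)]
      exact mul_le_of_le_one_right (Nat.cast_nonneg _) measureReal_le_one
    linarith [hI x y]
  have hi : ∀ (x : ℚ → Fin M) (a b : ℝ), IntervalIntegrable (occupied r x) volume a b :=
    fun x a b => (intervalIntegrable_const (c := (1 : ℝ))).mono_fun'
      (measurable_occupied_left r x).aestronglyMeasurable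
      (ae_of_all _ fun s => abs_occupied_le_one r x s)
  have hint : ∀ {H : (ℚ → Fin M) → (ℕ → ℝ) → ℝ}, Measurable (Function.uncurry H) →
      (∀ x y, |H x y| ≤ 2 * B) →
      Integrable (fun ω => H (skeleton J 0 ω) fun n => spacing τ n ω) μ := fun hm hC =>
    (integrable_const (2 * B : ℝ)).mono' (hm.comp (hX.prodMk hY)).aestronglyMeasurable
      (ae_of_all _ fun ω => hC _ _)
  have e1 : ∫ ω, H₁ (skeleton J 0 ω) (fun n => spacing τ n ω) ∂μ ≤
      2 * √(B * samplingVariance) := by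
    -- Here the path is frozen and the arrivals are averaged. Replacing the true duration of the
    -- block by `B` costs a second term of order `√B`, hence the factor `2`.
    rw [(IndepFun.integral_eq_integral_integral hX hY hXY hm₁ hC₁).1]
    have h1 : ∀ x, ∫ ω', H₁ x (fun n => spacing τ n ω') ∂μ ≤ 2 * √(B * samplingVariance) :=
        fun x => by
      have s1 := integral_abs_sampling_le (μ := μ) hR.poisson.measurable_spacing
        hR.poisson.law_spacing hR.poisson.indep_spacing (measurable_occupied_left r x)
        (occupied_nonneg r x) (occupied_le_one r x) a B
      have s2 := integral_abs_sum_sub_le (μ := μ) hR.poisson.measurable_spacing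
        hR.poisson.law_spacing hR.poisson.indep_spacing a B
      have hms : ∀ n : ℕ, Measurable fun ω => ∑ k ∈ Finset.range n, spacing τ k ω := fun n =>
        Finset.measurable_sum _ fun k _ => hR.poisson.measurable_spacing k
      have hsi : ∀ n : ℕ, Integrable (fun ω => ∑ k ∈ Finset.range n, spacing τ k ω) μ := fun n => by
        refine integrable_finsetSum _ fun k _ => ?_
        have h := memLp_two_id_expMeasure.integrable one_le_two
        rw [← (hR.poisson.law_spacing k).map_eq] at h
        exact h.comp_measurable (hR.poisson.measurable_spacing k)
      have i2 : Integrable (fun ω => |∑ l ∈ Finset.range (a + B), spacing τ l ω -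
          ∑ l ∈ Finset.range a, spacing τ l ω - B|) μ :=
        (((hsi (a + B)).sub (hsi a)).sub (integrable_const _)).abs
      have hcont := continuous_primitive_of_bounded (measurable_occupied_left r x)
        (abs_occupied_le_one r x)
      have i1 : Integrable (fun ω => |∑ k ∈ Finset.Ico a (a + B),
          occupied r x (∑ l ∈ Finset.range (k + 1), spacing τ l ω) -
          ((∫ s in (0 : ℝ)..(∑ l ∈ Finset.range (a + B), spacing τ l ω), occupied r x s) -
            ∫ s in (0 : ℝ)..(∑ l ∈ Finset.range a, spacing τ l ω), occupied r x s)|) μ := by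
        have i3 : Integrable (fun ω => ∑ k ∈ Finset.Ico a (a + B),
            occupied r x (∑ l ∈ Finset.range (k + 1), spacing τ l ω)) μ :=
          (integrable_const (B : ℝ)).mono' (Finset.measurable_sum _ fun k _ =>
            (measurable_occupied_left r x).comp (hms _)).aestronglyMeasurable
            (ae_of_all _ fun ω => hS x _)
        have i4 : Integrable (fun ω =>
            (∫ s in (0 : ℝ)..(∑ l ∈ Finset.range (a + B), spacing τ l ω), occupied r x s) -
            ∫ s in (0 : ℝ)..(∑ l ∈ Finset.range a, spacing τ l ω), occupied r x s) μ := by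
          refine ((hsi (a + B)).sub (hsi a)).abs.mono' ((hcont.measurable.comp (hms _)).sub
            (hcont.measurable.comp (hms _))).aestronglyMeasurable (ae_of_all _ fun ω => ?_)
          exact abs_primitive_sub_le (measurable_occupied_left r x) (abs_occupied_le_one r x) _ _
        exact (i3.sub i4).abs
      calc ∫ ω', H₁ x (fun n => spacing τ n ω') ∂μ
          ≤ ∫ ω, (|∑ k ∈ Finset.Ico a (a + B),
              occupied r x (∑ l ∈ Finset.range (k + 1), spacing τ l ω) -
              ((∫ s in (0 : ℝ)..(∑ l ∈ Finset.range (a + B), spacing τ l ω), occupied r x s) -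
              ∫ s in (0 : ℝ)..(∑ l ∈ Finset.range a, spacing τ l ω), occupied r x s)| +
              |∑ l ∈ Finset.range (a + B), spacing τ l ω -
                ∑ l ∈ Finset.range a, spacing τ l ω - B|) ∂μ := by
            refine integral_mono_of_nonneg (ae_of_all _ fun ω => abs_nonneg _) (i1.add i2)
              (ae_of_all _ fun ω => ?_)
            simp only [hH₁]
            rw [intervalIntegral.integral_comp_add_left, add_zero,
              ← intervalIntegral.integral_interval_sub_left (hi x 0 _) (hi x 0 _)]
            have h3 := abs_primitive_sub_le (measurable_occupied_left r x) (abs_occupied_le_one r x)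
              (∑ k ∈ Finset.range a, spacing τ k ω + B)
              (∑ l ∈ Finset.range (a + B), spacing τ l ω)
            rw [← sub_sub] at h3
            refine le_trans ?_ (add_le_add_right h3 _)
            refine le_trans (le_of_eq ?_) (abs_add_le _ _)
            congr 1
            ring
        _ ≤ 2 * √(B * samplingVariance) := by
            rw [integral_add i1 i2]
            linarith
    have hb := norm_integral_le_of_norm_le_const (μ := μ) (C := 2 * √(B * samplingVariance))
      (f := fun ω => ∫ ω', H₁ (skeleton J 0 ω) (fun n => spacing τ n ω') ∂μ)
      (ae_of_all _ fun ω => by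
        rw [Real.norm_of_nonneg (integral_nonneg fun ω' => abs_nonneg _)]
        exact h1 _)
    rw [probReal_univ, mul_one] at hb
    exact (le_abs_self _).trans hb
  have e2 : ∫ ω, H₂ (skeleton J 0 ω) (fun n => spacing τ n ω) ∂μ =
      ∫ ω, |(∫ s in (0 : ℝ)..B, (if J s ω = r then 1 else 0 : ℝ)) - B * π| ∂μ := by
    -- Here the arrivals are frozen and the path is averaged, so stationarity removes the starting
    -- point of the window.
    rw [(IndepFun.integral_eq_integral_integral hX hY hXY hm₂ hC₂).2]
    have h1 : ∀ ω', ∫ ω, H₂ (skeleton J 0 ω) (fun n => spacing τ n ω') ∂μ =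
        ∫ ω, |(∫ s in (0 : ℝ)..B, (if J s ω = r then 1 else 0 : ℝ)) - B * π| ∂μ := fun ω' =>
      hR.semiMarkov.integral_occupied_skeleton r B (∑ k ∈ Finset.range a, spacing τ k ω')
    simp_rw [h1]
    simp
  calc _ ≤ ∫ ω, (H₁ (skeleton J 0 ω) (fun n => spacing τ n ω) +
        H₂ (skeleton J 0 ω) (fun n => spacing τ n ω)) ∂μ := by
        refine integral_mono_of_nonneg (ae_of_all _ fun ω => abs_nonneg _)
          ((hint hm₁ hC₁).add (hint hm₂ hC₂)) ?_
        filter_upwards [hR.occupied_arrival] with ω hω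
        simp_rw [hω]
        exact abs_sub_le _ _ _
    _ ≤ _ := by
        rw [integral_add (hint hm₁ hC₁) (hint hm₂ hC₂), e2]
        gcongr

/-- Uniformly over the blocks of `B` consecutive requests, the numbers of requests made in the
different states deviate from their means by `o(B)`. -/
theorem exists_block_deviation (hR : IsModulatedRequestProcess μ p F Q T J τ R) {ε : ℝ}
    (hε : 0 < ε) : ∃ B : ℕ, 0 < B ∧ ∀ a : ℕ, ∀ r,
      ∫ ω, |∑ k ∈ Finset.Ico a (a + B), (if J (τ ((k : ℤ) + 1) ω) ω = r then 1 else 0 : ℝ) -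
        B * μ.real {ω | J 0 ω = r}| ∂μ ≤ ε * B := by
  have h : ∀ r, ∀ᶠ B : ℕ in atTop, 2 * (√(B * samplingVariance) / B) +
      (∫ ω, |(∫ s in (0 : ℝ)..B, (if J s ω = r then 1 else 0 : ℝ)) -
          B * μ.real {ω | J 0 ω = r}| ∂μ) / B < ε := fun r => by
    have h1 := ((tendsto_sqrt_mul_div samplingVariance).const_mul 2).add
      (hR.semiMarkov.tendsto_occupation r)
    exact h1.eventually_lt_const (by simpa using hε)
  obtain ⟨B, hB, hB0⟩ := ((eventually_all.2 h).and (eventually_gt_atTop 0)).exists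
  refine ⟨B, hB0, fun a r => (hR.integral_block_deviation_le r a B).trans ?_⟩
  have hB' : (0 : ℝ) < B := by exact_mod_cast hB0
  have h2 := hB r
  rw [← mul_div_assoc, ← add_div, div_lt_iff₀ hB'] at h2
  exact h2.le

end IsModulatedRequestProcess

/-! ### Request rates and popularities -/

/-- The conditional probability, given the modulating process and the request times, that request
number `k` is for document `i`. -/
def requestRate {Ω : Type*} {M : ℕ} (Q : Fin M → PMF ℕ) (J : ℝ → Ω → Fin M) (τ : ℤ → Ω → ℝ)
    (k : ℤ) (i : ℕ) (ω : Ω) : ℝ :=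
  (Q (J (τ k ω) ω) i).toReal

/-- The sum of the reciprocals of the (positive) stationary probabilities of the states. -/
def rateBound {Ω : Type*} [MeasurableSpace Ω] (μ : Measure Ω) {M : ℕ} (J : ℝ → Ω → Fin M) : ℝ :=
  ∑ r : Fin M, (μ.real {ω | J 0 ω = r})⁻¹
namespace IsModulatedRequestProcess

variable {Ω : Type*} [MeasurableSpace Ω] {μ : Measure Ω} [IsProbabilityMeasure μ]
  {M : ℕ} {p : Matrix (Fin M) (Fin M) ℝ} {F : Fin M → Fin M → Measure ℝ} {Q : Fin M → PMF ℕ}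
  {T : ℤ → Ω → ℝ} {J : ℝ → Ω → Fin M} {τ : ℤ → Ω → ℝ} {R : ℤ → Ω → ℕ}

theorem info_le (hR : IsModulatedRequestProcess μ p F Q T J τ R) :
    modulatingInfo T J ⊔ arrivalInfo τ ≤ ‹MeasurableSpace Ω› :=
  sup_le (sup_le (iSup_le fun n => (hR.semiMarkov.measurable_T n).comap_le)
    (iSup_le fun t => (hR.semiMarkov.measurable_J_apply t).comap_le))
    (iSup_le fun n => (hR.poisson.measurable n).comap_le)

theorem measurable_state_arrival (hR : IsModulatedRequestProcess μ p F Q T J τ R) (k : ℤ) :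
    Measurable fun ω => J (τ k ω) ω :=
  hR.semiMarkov.measurable_J.comp ((hR.poisson.measurable k).prodMk measurable_id)

theorem measurable_requestRate (hR : IsModulatedRequestProcess μ p F Q T J τ R) (k : ℤ)
    (i : ℕ) : Measurable (requestRate Q J τ k i) :=
  (measurable_of_finite fun r : Fin M => (Q r i).toReal).comp (hR.measurable_state_arrival k)

theorem requestRate_nonneg (k : ℤ) (i : ℕ) (ω : Ω) : 0 ≤ requestRate Q J τ k i ω :=
  ENNReal.toReal_nonneg

theorem requestRate_le_one (k : ℤ) (i : ℕ) (ω : Ω) : requestRate Q J τ k i ω ≤ 1 :=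
  ENNReal.toReal_le_of_le_ofReal zero_le_one (by simpa using PMF.coe_le_one _ _)

theorem prod_requestRate_mem (S : Finset ℤ) (i : ℤ → ℕ) (ω : Ω) :
    0 ≤ ∏ l ∈ S, requestRate Q J τ l (i l) ω ∧ ∏ l ∈ S, requestRate Q J τ l (i l) ω ≤ 1 :=
  ⟨Finset.prod_nonneg fun l _ => requestRate_nonneg l (i l) ω,
    Finset.prod_le_one (fun l _ => requestRate_nonneg l (i l) ω)
      fun l _ => requestRate_le_one l (i l) ω⟩

theorem measurable_prod_requestRate (hR : IsModulatedRequestProcess μ p F Q T J τ R)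
    (S : Finset ℤ) (i : ℤ → ℕ) : Measurable fun ω => ∏ l ∈ S, requestRate Q J τ l (i l) ω :=
  Finset.measurable_prod _ fun l _ => hR.measurable_requestRate l (i l)

theorem integrable_prod_requestRate (hR : IsModulatedRequestProcess μ p F Q T J τ R)
    (S : Finset ℤ) (i : ℤ → ℕ) :
    Integrable (fun ω => ∏ l ∈ S, requestRate Q J τ l (i l) ω) μ :=
  (integrable_const (1 : ℝ)).mono' (hR.measurable_prod_requestRate S i).aestronglyMeasurable
    (ae_of_all _ fun ω => by
      rw [Real.norm_of_nonneg (prod_requestRate_mem S i ω).1]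
      exact (prod_requestRate_mem S i ω).2)

theorem measurableSet_requests (hR : IsModulatedRequestProcess μ p F Q T J τ R) (S : Finset ℤ)
    (i : ℤ → ℕ) : MeasurableSet {ω | ∀ l ∈ S, R l ω = i l} := by
  have : {ω | ∀ l ∈ S, R l ω = i l} = ⋂ l ∈ S, R l ⁻¹' {i l} := by ext; simp
  rw [this]
  exact Finset.measurableSet_biInter S fun l _ => hR.measurable_R l (measurableSet_singleton _)

theorem aestronglyMeasurable_prod_requestRate (hR : IsModulatedRequestProcess μ p F Q T J τ R)
    (S : Finset ℤ) (i : ℤ → ℕ) :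
    AEStronglyMeasurable[modulatingInfo T J ⊔ arrivalInfo τ]
      (fun ω => ∏ l ∈ S, requestRate Q J τ l (i l) ω) μ :=
  ⟨_, stronglyMeasurable_condExp, (hR.conditional_law S i).symm⟩

theorem setIntegral_requestRate (hR : IsModulatedRequestProcess μ p F Q T J τ R) {A : Set Ω}
    (hA : MeasurableSet[modulatingInfo T J ⊔ arrivalInfo τ] A) (S : Finset ℤ) (i : ℤ → ℕ) :
    ∫ ω in A, ∏ l ∈ S, requestRate Q J τ l (i l) ω ∂μ =
      μ.real (A ∩ {ω | ∀ l ∈ S, R l ω = i l}) := by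
  have hs := hR.measurableSet_requests S i
  have h1 := setIntegral_condExp hR.info_le (μ := μ)
    (f := {ω | ∀ l ∈ S, R l ω = i l}.indicator fun _ => (1 : ℝ))
    ((integrable_const 1).indicator hs) hA
  rw [setIntegral_indicator hs, setIntegral_const, smul_eq_mul, mul_one] at h1
  rw [← h1]
  exact setIntegral_congr_ae (hR.info_le _ hA)
    ((hR.conditional_law S i).mono fun ω hω _ => hω.symm)

/-- Conditioning on states and arrival times turns both sides into the mean of the product of the
rates over `S ∪ S'`. -/
theorem setIntegral_requestRate_requests (hR : IsModulatedRequestProcess μ p F Q T J τ R)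
    {S S' : Finset ℤ} (hS : Disjoint S S') (i : ℤ → ℕ) :
    ∫ ω in {ω | ∀ l ∈ S, R l ω = i l}, ∏ l ∈ S', requestRate Q J τ l (i l) ω ∂μ =
      μ.real ({ω | ∀ l ∈ S, R l ω = i l} ∩ {ω | ∀ l ∈ S', R l ω = i l}) := by
  have hs := hR.measurableSet_requests S i
  set g : Ω → ℝ := {ω | ∀ l ∈ S, R l ω = i l}.indicator fun _ => (1 : ℝ) with hg
  set f : Ω → ℝ := fun ω => ∏ l ∈ S', requestRate Q J τ l (i l) ω with hf
  have hgi : Integrable g μ := (integrable_const 1).indicator hs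
  have hfg : Integrable (f * g) μ := by
    refine hgi.bdd_mul (c := 1) (hR.measurable_prod_requestRate S' i).aestronglyMeasurable
      (ae_of_all _ fun ω => ?_)
    rw [Real.norm_of_nonneg (prod_requestRate_mem S' i ω).1]
    exact (prod_requestRate_mem S' i ω).2
  have h1 := condExp_mul_of_aestronglyMeasurable_left
    (hR.aestronglyMeasurable_prod_requestRate S' i) hfg hgi
  have h2 : ∫ ω, (f * g) ω ∂μ = ∫ ω in {ω | ∀ l ∈ S, R l ω = i l}, f ω ∂μ := by
    rw [← integral_indicator hs]
    refine integral_congr_ae (ae_of_all _ fun ω => ?_)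
    by_cases h : ∀ l ∈ S, R l ω = i l <;> simp [g, Set.indicator, h]
  have hinter : {ω | ∀ l ∈ S, R l ω = i l} ∩ {ω | ∀ l ∈ S', R l ω = i l} =
      Set.univ ∩ {ω | ∀ l ∈ S ∪ S', R l ω = i l} := by
    ext ω
    simp only [Set.mem_inter_iff, Set.mem_ofPred_eq, Finset.mem_union, Set.mem_univ, true_and]
    exact ⟨fun h l hl => hl.elim (h.1 l) (h.2 l), fun h => ⟨fun l hl => h l (Or.inl hl),
      fun l hl => h l (Or.inr hl)⟩⟩
  rw [← h2, ← integral_condExp hR.info_le, hinter,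
    ← hR.setIntegral_requestRate MeasurableSet.univ, setIntegral_univ]
  refine integral_congr_ae ?_
  filter_upwards [h1, hR.conditional_law S i] with ω hω1 hω2
  rw [hω1, Pi.mul_apply, hω2, Finset.prod_union hS, mul_comm]
  rfl

/-- The vector of the first `a` requests. -/
def requestVector (R : ℤ → Ω → ℕ) (a : ℕ) (ω : Ω) (l : Fin a) : ℕ := R ((l : ℕ) + 1) ω

theorem measurable_requestVector (hR : IsModulatedRequestProcess μ p F Q T J τ R) (a : ℕ) :
    Measurable (requestVector R a) :=
  measurable_pi_lambda _ fun _ => hR.measurable_R _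

/-- Given the first `a` requests, the later ones are still governed by the modulating process. -/
theorem setIntegral_requestRate_vector (hR : IsModulatedRequestProcess μ p F Q T J τ R) {a : ℕ}
    (𝒲 : Set (Fin a → ℕ)) {S : Finset ℤ} (hS : ∀ l ∈ S, (a : ℤ) + 1 ≤ l) (i : ℤ → ℕ) :
    ∫ ω in requestVector R a ⁻¹' 𝒲, ∏ l ∈ S, requestRate Q J τ l (i l) ω ∂μ =
      μ.real (requestVector R a ⁻¹' 𝒲 ∩ {ω | ∀ l ∈ S, R l ω = i l}) := by
  have hv := hR.measurable_requestVector a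
  have hs := hR.measurableSet_requests S i
  have hm : ∀ 𝒲 : Set (Fin a → ℕ), MeasurableSet 𝒲 := fun 𝒲 => 𝒲.to_countable.measurableSet
  have hnn : ∀ ω, 0 ≤ ∏ l ∈ S, requestRate Q J τ l (i l) ω := fun ω =>
    (prod_requestRate_mem S i ω).1
  have hset : ∀ 𝒲 : Set (Fin a → ℕ),
      ∫⁻ ω in requestVector R a ⁻¹' 𝒲, ENNReal.ofReal (∏ l ∈ S, requestRate Q J τ l (i l) ω) ∂μ =
      ENNReal.ofReal (∫ ω in requestVector R a ⁻¹' 𝒲,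
        ∏ l ∈ S, requestRate Q J τ l (i l) ω ∂μ) := fun 𝒲 =>
    (ofReal_integral_eq_lintegral_ofReal (hR.integrable_prod_requestRate S i).integrableOn
      (ae_of_all _ hnn)).symm
  -- The request vectors form a countable space, so the two measures need comparing only at single
  -- vectors `w`, where the finite-dimensional conditional law applies.
  have hmeas : (μ.withDensity fun ω =>
      ENNReal.ofReal (∏ l ∈ S, requestRate Q J τ l (i l) ω)).map (requestVector R a) =
      (μ.restrict {ω | ∀ l ∈ S, R l ω = i l}).map (requestVector R a) := by
    refine Measure.ext_of_singleton fun w => ?_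
    rw [Measure.map_apply hv (hm _), Measure.map_apply hv (hm _),
      withDensity_apply _ (hv (hm _)), Measure.restrict_apply (hv (hm _)), hset,
      ← ofReal_measureReal]
    congr 1
    set S₀ : Finset ℤ := (Finset.univ : Finset (Fin a)).image fun l : Fin a => ((l : ℕ) : ℤ) + 1 with hS₀
    have hS₀a : ∀ l ∈ S₀, l < (a : ℤ) + 1 := fun l hl => by
      obtain ⟨m, -, rfl⟩ := Finset.mem_image.1 hl
      have := m.2
      omega
    have hdisj : Disjoint S₀ S := by
      rw [Finset.disjoint_left]
      intro l hl hl'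
      exact absurd (hS l hl') (not_le.2 (hS₀a l hl))
    -- `j` prescribes `w` for the requests `1, …, a` and `i` for all others.
    let j : ℤ → ℕ := fun l => if h : l - 1 < a ∧ 0 ≤ l - 1 then w ⟨(l - 1).toNat, by omega⟩ else i l
    have hj : ∀ l ∈ S, j l = i l := fun l hl => by
      have := hS l hl
      exact dif_neg (by omega)
    have hjw : ∀ l : Fin a, j (((l : ℕ) : ℤ) + 1) = w l := fun l => by
      have := l.2
      simp [j]
    have h1 : requestVector R a ⁻¹' {w} = {ω | ∀ l ∈ S₀, R l ω = j l} := by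
      ext ω
      simp only [Set.mem_preimage, Set.mem_singleton_iff, Set.mem_ofPred_eq, hS₀,
        Finset.mem_image, Finset.mem_univ, true_and, forall_exists_index,
        forall_apply_eq_imp_iff, hjw]
      exact funext_iff
    have h2 : {ω | ∀ l ∈ S, R l ω = i l} = {ω | ∀ l ∈ S, R l ω = j l} := by
      ext ω
      exact forall₂_congr fun l hl => by rw [hj l hl]
    have h3 : ∀ ω, ∏ l ∈ S, requestRate Q J τ l (i l) ω =
        ∏ l ∈ S, requestRate Q J τ l (j l) ω := fun ω =>
      Finset.prod_congr rfl fun l hl => by rw [hj l hl]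
    simp_rw [h1, h2, h3]
    exact hR.setIntegral_requestRate_requests hdisj j
  have h := DFunLike.congr_fun hmeas 𝒲
  rw [Measure.map_apply hv (hm _), Measure.map_apply hv (hm _),
      withDensity_apply _ (hv (hm _)), Measure.restrict_apply (hv (hm _)), hset,
      ← ofReal_measureReal] at h
  exact (ENNReal.ofReal_eq_ofReal_iff (integral_nonneg hnn) measureReal_nonneg).1 h

theorem requestRate_eq_sum (k : ℤ) (i : ℕ) (ω : Ω) : requestRate Q J τ k i ω =
    ∑ r, (Q r i).toReal * if J (τ k ω) ω = r then 1 else 0 := by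
  simp [requestRate]

theorem integrable_state_arrival (hR : IsModulatedRequestProcess μ p F Q T J τ R) (k : ℤ)
    (r : Fin M) : Integrable (fun ω => (if J (τ k ω) ω = r then 1 else 0 : ℝ)) μ :=
  (integrable_const (1 : ℝ)).mono' ((measurable_of_finite fun i : Fin M =>
    (if i = r then 1 else 0 : ℝ)).comp (hR.measurable_state_arrival k)).aestronglyMeasurable
    (ae_of_all _ fun ω => by split_ifs <;> simp)

theorem measureReal_request_mem_sum (hR : IsModulatedRequestProcess μ p F Q T J τ R) {A : Set ℝ}
    (hA : MeasurableSet A) (n i : ℕ) :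
    μ.real ({ω | τ ((n : ℤ) + 1) ω ∈ A} ∩ {ω | R ((n : ℤ) + 1) ω = i}) =
      μ.real {ω | τ ((n : ℤ) + 1) ω ∈ A} *
        ∑ r, (Q r i).toReal * μ.real {ω | J 0 ω = r} := by
  have hτ : MeasurableSet[modulatingInfo T J ⊔ arrivalInfo τ]
      {ω | τ ((n : ℤ) + 1) ω ∈ A} := by
    have h : Measurable[modulatingInfo T J ⊔ arrivalInfo τ] (τ ((n : ℤ) + 1)) :=
      measurable_iff_comap_le.2 (le_sup_of_le_right
        (le_iSup (fun n => MeasurableSpace.comap (τ n) inferInstance) ((n : ℤ) + 1)))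
    exact h hA
  have h := hR.setIntegral_requestRate hτ {(n : ℤ) + 1} fun _ => i
  simp only [Finset.prod_singleton, Finset.mem_singleton, forall_eq] at h
  rw [← h]
  simp_rw [requestRate_eq_sum]
  rw [integral_finsetSum _ fun r _ =>
    ((hR.integrable_state_arrival _ r).const_mul _).integrableOn, Finset.mul_sum]
  refine Finset.sum_congr rfl fun r _ => ?_
  rw [integral_const_mul, hR.integral_arrival_state hA]
  ring

theorem popularity_eq_sum (hR : IsModulatedRequestProcess μ p F Q T J τ R) (i : ℕ) :
    popularity μ R i = ∑ r, (Q r i).toReal * μ.real {ω | J 0 ω = r} := by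
  have h := hR.measureReal_request_mem_sum MeasurableSet.univ 0 i
  simpa [popularity] using h

theorem measureReal_request_mem (hR : IsModulatedRequestProcess μ p F Q T J τ R) {A : Set ℝ}
    (hA : MeasurableSet A) (n i : ℕ) :
    μ.real ({ω | τ ((n : ℤ) + 1) ω ∈ A} ∩ {ω | R ((n : ℤ) + 1) ω = i}) =
      μ.real {ω | τ ((n : ℤ) + 1) ω ∈ A} * popularity μ R i := by
  rw [hR.measureReal_request_mem_sum hA, hR.popularity_eq_sum]

theorem rateBound_nonneg : 0 ≤ rateBound μ J :=
  Finset.sum_nonneg fun _ _ => inv_nonneg.2 measureReal_nonneg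

/-- Popularity is the stationary mixture of the `Q r`, so it dominates `Q r` times the weight of
`r`. This bounds repetitions and makes the errors proportional to the popularity. -/
theorem pmf_le (hR : IsModulatedRequestProcess μ p F Q T J τ R) {r : Fin M}
    (hr : μ.real {ω | J 0 ω = r} ≠ 0) (i : ℕ) :
    (Q r i).toReal ≤ rateBound μ J * popularity μ R i := by
  have hpos : 0 < μ.real {ω | J 0 ω = r} := lt_of_le_of_ne measureReal_nonneg hr.symm
  have h1 : (Q r i).toReal * μ.real {ω | J 0 ω = r} ≤ popularity μ R i := by
    rw [hR.popularity_eq_sum]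
    exact Finset.single_le_sum (f := fun r => (Q r i).toReal * μ.real {ω | J 0 ω = r})
      (fun r _ => mul_nonneg ENNReal.toReal_nonneg measureReal_nonneg) (Finset.mem_univ r)
  have h2 : (μ.real {ω | J 0 ω = r})⁻¹ ≤ rateBound μ J :=
    Finset.single_le_sum (f := fun r => (μ.real {ω | J 0 ω = r})⁻¹)
      (fun r _ => inv_nonneg.2 measureReal_nonneg) (Finset.mem_univ r)
  calc (Q r i).toReal
      = (μ.real {ω | J 0 ω = r})⁻¹ * ((Q r i).toReal * μ.real {ω | J 0 ω = r}) := by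
        field_simp
    _ ≤ rateBound μ J * popularity μ R i :=
        mul_le_mul h2 h1 (mul_nonneg ENNReal.toReal_nonneg measureReal_nonneg) rateBound_nonneg

/-- Almost surely no arrival from `τ 1` on sees a state of zero stationary probability. This makes a
proof that every state has positive probability unnecessary. -/
theorem ae_state_ne_zero (hR : IsModulatedRequestProcess μ p F Q T J τ R) :
    ∀ᵐ ω ∂μ, ∀ n : ℕ, μ.real {ω' | J 0 ω' = J (τ ((n : ℤ) + 1) ω) ω} ≠ 0 := by
  refine ae_all_iff.2 fun n => ?_
  have h : ∀ r : Fin M, ∀ᵐ ω ∂μ, J (τ ((n : ℤ) + 1) ω) ω = r → μ.real {ω' | J 0 ω' = r} ≠ 0 := by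
    intro r
    by_cases hr : μ.real {ω' | J 0 ω' = r} = 0
    · have h1 := hR.integral_arrival_state MeasurableSet.univ n r
      rw [hr, mul_zero] at h1
      simp only [Set.mem_univ, Set.ofPred_true, setIntegral_univ] at h1
      rw [integral_eq_zero_iff_of_nonneg (fun ω => by simp only [Pi.zero_apply]; split_ifs <;> simp)
        (hR.integrable_state_arrival _ r)] at h1
      filter_upwards [h1] with ω hω hω'
      simp [hω'] at hω
    · exact ae_of_all _ fun ω _ => hr
  filter_upwards [ae_all_iff.2 h] with ω hω
  exact hω _ rfl

theorem ae_requestRate_le (hR : IsModulatedRequestProcess μ p F Q T J τ R) :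
    ∀ᵐ ω ∂μ, ∀ (n i : ℕ), requestRate Q J τ ((n : ℤ) + 1) i ω ≤
      rateBound μ J * popularity μ R i := by
  filter_upwards [hR.ae_state_ne_zero] with ω hω n i
  exact hR.pmf_le (hω n) i

/-- The rates sum to `Q r i` times the number of arrivals in state `r`, summed over `r`. Each count
is at least its mean minus its deviation, and `pmf_le` extracts the common factor `popularity μ R
i`. What is left is a random factor common to all documents, and this is what disposes of the
correlation with the content. -/
theorem ae_sum_requestRate_ge (hR : IsModulatedRequestProcess μ p F Q T J τ R) (a B : ℕ) :
    ∀ᵐ ω ∂μ, ∀ i : ℕ, popularity μ R i * (B - rateBound μ J *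
      ∑ r, |∑ k ∈ Finset.Ico a (a + B), (if J (τ ((k : ℤ) + 1) ω) ω = r then 1 else 0 : ℝ) -
        B * μ.real {ω | J 0 ω = r}|) ≤
      ∑ k ∈ Finset.Ico a (a + B), requestRate Q J τ ((k : ℤ) + 1) i ω := by
  filter_upwards [hR.ae_state_ne_zero] with ω hω i
  simp_rw [requestRate_eq_sum]
  rw [Finset.sum_comm]
  simp_rw [← Finset.mul_sum]
  have h1 : ∀ r, (Q r i).toReal * (B * μ.real {ω | J 0 ω = r}) -
      rateBound μ J * popularity μ R i *
        |∑ k ∈ Finset.Ico a (a + B), (if J (τ ((k : ℤ) + 1) ω) ω = r then 1 else 0 : ℝ) -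
          B * μ.real {ω | J 0 ω = r}| ≤
      (Q r i).toReal *
        ∑ k ∈ Finset.Ico a (a + B), (if J (τ ((k : ℤ) + 1) ω) ω = r then 1 else 0 : ℝ) := by
    intro r
    set N := ∑ k ∈ Finset.Ico a (a + B), (if J (τ ((k : ℤ) + 1) ω) ω = r then 1 else 0 : ℝ)
      with hN
    by_cases hr : μ.real {ω | J 0 ω = r} = 0
    · have : N = 0 := Finset.sum_eq_zero fun k _ =>
        if_neg fun h : J (τ ((k : ℤ) + 1) ω) ω = r => hω k (by rw [h, hr])
      rw [this, hr]
      simp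
    · have h2 := mul_le_mul_of_nonneg_right (hR.pmf_le hr i)
        (abs_nonneg (N - B * μ.real {ω | J 0 ω = r}))
      have h3 := mul_le_mul_of_nonneg_left (neg_abs_le (N - B * μ.real {ω | J 0 ω = r}))
        (ENNReal.toReal_nonneg (a := Q r i))
      linarith
  refine le_trans (le_of_eq ?_) (Finset.sum_le_sum fun r _ => h1 r)
  rw [Finset.sum_sub_distrib, ← Finset.mul_sum, mul_sub]
  congr 1
  · rw [hR.popularity_eq_sum, Finset.sum_mul]
    exact Finset.sum_congr rfl fun r _ => by ring
  · ring

end IsModulatedRequestProcess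

/-! ### How a content evolves during a block -/

namespace CachingPolicy

variable {s : ℕ → ℝ} {x : ℝ≥0}

theorem state_congr (π : CachingPolicy s x) (u : I) {r r' : ℕ → ℕ} {k : ℕ}
    (h : ∀ l < k, r l = r' l) : π.state u r k = π.state u r' k := by
  induction k with
  | zero => rfl
  | succ k ih =>
    simp only [state]
    rw [ih fun l hl => h l (by omega), h k (Nat.lt_succ_self k)]

theorem content_congr (π : CachingPolicy s x) (u : I) {r r' : ℕ → ℕ} {k : ℕ}
    (h : ∀ l < k, r l = r' l) : π.content u r k = π.content u r' k := by
  rw [content, content, π.state_congr u h]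

theorem size_content (π : CachingPolicy s x) (u : I) (r : ℕ → ℕ) (k : ℕ) :
    ∑ i ∈ π.content u r k, s i ≤ x := by
  induction k with
  | zero => exact π.size_init u
  | succ k ih => exact π.size_next u _ _ _ ih

theorem content_succ_subset (π : CachingPolicy s x) (u : I) (r : ℕ → ℕ) (k : ℕ) :
    π.content u r (k + 1) ⊆ insert (r k) (π.content u r k) := by
  by_cases h : r k ∈ π.content u r k
  · have h1 : π.content u r (k + 1) = π.content u r k := π.hit u _ _ _ h
    rw [h1]
    exact Finset.subset_insert _ _
  · exact π.fault u _ _ _ h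

/-- The only use of the demand-driven nature of a policy: documents enter the content only when
requested. -/
theorem mem_content_of_le (π : CachingPolicy s x) (u : I) (r : ℕ → ℕ) {a k : ℕ} (hak : a ≤ k)
    {i : ℕ} (hi : i ∈ π.content u r k) :
    i ∈ π.content u r a ∨ ∃ l ∈ Finset.Ico a k, r l = i := by
  induction k, hak using Nat.le_induction with
  | base => exact Or.inl hi
  | succ k hak ih =>
    rcases Finset.mem_insert.1 (π.content_succ_subset u r k hi) with h | h
    · exact Or.inr ⟨k, Finset.mem_Ico.2 ⟨hak, Nat.lt_succ_self k⟩, h.symm⟩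
    · rcases ih h with h1 | ⟨l, hl, h1⟩
      · exact Or.inl h1
      · rw [Finset.mem_Ico] at hl
        exact Or.inr ⟨l, Finset.mem_Ico.2 ⟨hl.1, by omega⟩, h1⟩

/-- A request for a document outside the content at time `a` that has not been asked for since
time `a` is a fault. -/
theorem sum_le_fault (π : CachingPolicy s x) (u : I) (r : ℕ → ℕ) {a k : ℕ} (hak : a ≤ k)
    (D : Finset ℕ) :
    ∑ i ∈ D, (if i ∉ π.content u r a then
        (if r k = i then (1 : ℝ) else 0) -
          ∑ l ∈ Finset.Ico a k, (if r k = i ∧ r l = i then 1 else 0) else 0) ≤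
      if r k ∉ π.content u r k then 1 else 0 := by
  have hnn : ∀ i, 0 ≤ ∑ l ∈ Finset.Ico a k, (if r k = i ∧ r l = i then (1 : ℝ) else 0) := fun i =>
    Finset.sum_nonneg fun l _ => by split_ifs <;> simp
  have hterm : ∀ i ∈ D, i ≠ r k → (if i ∉ π.content u r a then
        (if r k = i then (1 : ℝ) else 0) -
          ∑ l ∈ Finset.Ico a k, (if r k = i ∧ r l = i then 1 else 0) else 0) = 0 := by
    intro i _ hi
    simp [hi.symm]
  by_cases hD : r k ∈ D
  · rw [Finset.sum_eq_single_of_mem (r k) hD hterm]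
    by_cases hf : r k ∈ π.content u r k
    · rw [if_neg (not_not.2 hf)]
      rcases π.mem_content_of_le u r hak hf with h | ⟨l, hl, h⟩
      · rw [if_neg (not_not.2 h)]
      · have h2 : (1 : ℝ) ≤ ∑ l ∈ Finset.Ico a k, if r k = r k ∧ r l = r k then 1 else 0 :=
          le_trans (by simp [h]) (Finset.single_le_sum
            (f := fun l : ℕ => if r k = r k ∧ r l = r k then (1 : ℝ) else 0)
            (fun l _ => by positivity) hl)
        rw [if_pos rfl]
        split_ifs <;> linarith
    · have := hnn (r k)
      rw [if_pos hf, if_pos rfl]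
      split_ifs <;> linarith
  · rw [Finset.sum_eq_zero fun i hi => hterm i hi fun h => hD (h ▸ hi)]
    split_ifs <;> simp

end CachingPolicy

/-! ### Lower bound for the faults in a block -/

namespace IsModulatedRequestProcess

variable {Ω : Type*} [MeasurableSpace Ω] {μ : Measure Ω} [IsProbabilityMeasure μ]
  {M : ℕ} {p : Matrix (Fin M) (Fin M) ℝ} {F : Fin M → Fin M → Measure ℝ} {Q : Fin M → PMF ℕ}
  {T : ℤ → Ω → ℝ} {J : ℝ → Ω → Fin M} {τ : ℤ → Ω → ℝ} {R : ℤ → Ω → ℕ}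
  {s : ℕ → ℝ} {x : ℝ≥0}

/-- For a fixed seed the content is a function on the countable space of request vectors. This gives
measurability and lets `setIntegral_requestRate_vector` apply to events about the content. -/
theorem exists_content_eq (π : CachingPolicy s x) (u : I) (R : ℤ → Ω → ℕ) (a : ℕ) :
    ∃ g : (Fin a → ℕ) → Finset ℕ, ∀ ω,
      π.content u (fun l : ℕ => R (l + 1) ω) a = g (requestVector R a ω) := by
  refine ⟨fun w => π.content u (fun l => if h : l < a then w ⟨l, h⟩ else 0) a, fun ω => ?_⟩
  refine π.content_congr u fun l hl => ?_
  simp [hl, requestVector]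

/-- The event that request number `k + 1` is a fault. -/
def faultSet (π : CachingPolicy s x) (u : I) (R : ℤ → Ω → ℕ) (k : ℕ) : Set Ω :=
  {ω | R (k + 1) ω ∉ π.content u (fun l : ℕ => R (l + 1) ω) k}

theorem measurableSet_content (hR : IsModulatedRequestProcess μ p F Q T J τ R)
    (π : CachingPolicy s x) (u : I) (a i : ℕ) :
    MeasurableSet {ω | i ∉ π.content u (fun l : ℕ => R (l + 1) ω) a} := by
  obtain ⟨g, hg⟩ := exists_content_eq π u R a
  simp_rw [hg]
  exact hR.measurable_requestVector a (Set.to_countable {w | i ∉ g w}).measurableSet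

theorem measurableSet_faultSet (hR : IsModulatedRequestProcess μ p F Q T J τ R)
    (π : CachingPolicy s x) (u : I) (k : ℕ) : MeasurableSet (faultSet π u R k) := by
  obtain ⟨g, hg⟩ := exists_content_eq π u R k
  unfold faultSet
  simp_rw [hg]
  exact ((hR.measurable_R _).prodMk (hR.measurable_requestVector k))
    (Set.to_countable {z : ℕ × (Fin k → ℕ) | z.1 ∉ g z.2}).measurableSet

theorem setIntegral_not_mem_content (hR : IsModulatedRequestProcess μ p F Q T J τ R)
    (π : CachingPolicy s x) (u : I) {a : ℕ} (i : ℕ) {S : Finset ℤ}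
    (hS : ∀ l ∈ S, (a : ℤ) + 1 ≤ l) :
    ∫ ω in {ω | i ∉ π.content u (fun l : ℕ => R (l + 1) ω) a},
        ∏ l ∈ S, requestRate Q J τ l i ω ∂μ =
      μ.real ({ω | i ∉ π.content u (fun l : ℕ => R (l + 1) ω) a} ∩ {ω | ∀ l ∈ S, R l ω = i}) := by
  obtain ⟨g, hg⟩ := exists_content_eq π u R a
  simp_rw [hg]
  exact hR.setIntegral_requestRate_vector {w | i ∉ g w} hS fun _ => i

/-- A lower bound for the probability that a request within a block of requests is a fault. -/
theorem sum_setIntegral_le_measureReal_faultSet (hR : IsModulatedRequestProcess μ p F Q T J τ R)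
    (π : CachingPolicy s x) (u : I) {a B k : ℕ} (hk : k ∈ Finset.Ico a (a + B)) (D : Finset ℕ)
    {η : ℝ} (hη : ∀ i ∈ D, B * (rateBound μ J * popularity μ R i) ≤ η) :
    (1 - η) * ∑ i ∈ D, ∫ ω in {ω | i ∉ π.content u (fun l : ℕ => R (l + 1) ω) a},
      requestRate Q J τ ((k : ℤ) + 1) i ω ∂μ ≤ μ.real (faultSet π u R k) := by
  have hak := (Finset.mem_Ico.1 hk).1
  have hkB := (Finset.mem_Ico.1 hk).2
  set E : ℕ → Set Ω := fun i => {ω | i ∉ π.content u (fun l : ℕ => R (l + 1) ω) a} with hE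
  have hEm : ∀ i, MeasurableSet (E i) := fun i => hR.measurableSet_content π u a i
  have hRm : ∀ (l : ℕ) (i : ℕ), MeasurableSet {ω | R ((l : ℤ) + 1) ω = i} := fun l i =>
    hR.measurable_R _ (measurableSet_singleton i)
  have h1 : ∀ i, μ.real (E i ∩ {ω | R ((k : ℤ) + 1) ω = i}) =
      ∫ ω in E i, requestRate Q J τ ((k : ℤ) + 1) i ω ∂μ := fun i => by
    have h := hR.setIntegral_not_mem_content π u (a := a) i (S := {(k : ℤ) + 1})
      (by simp only [Finset.mem_singleton, forall_eq]; omega)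
    simp only [Finset.prod_singleton, Finset.mem_singleton, forall_eq] at h
    exact h.symm
  have hint : ∀ (l : ℕ) i, Integrable (requestRate Q J τ ((l : ℤ) + 1) i) μ := fun l i => by
    simpa using hR.integrable_prod_requestRate {(l : ℤ) + 1} fun _ => i
  -- A repetition costs one more rate, bounded uniformly by a multiple of the popularity. Fewer than
  -- `B` earlier requests of the block can be repeated, hence the factor `1 - η`.
  have h2 : ∀ i, ∀ l ∈ Finset.Ico a k,
      μ.real (E i ∩ ({ω | R ((k : ℤ) + 1) ω = i} ∩ {ω | R ((l : ℤ) + 1) ω = i})) ≤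
      (rateBound μ J * popularity μ R i) * ∫ ω in E i, requestRate Q J τ ((k : ℤ) + 1) i ω ∂μ :=
    fun i l hl => by
      rw [Finset.mem_Ico] at hl
      have hne : ((k : ℤ) + 1) ∉ ({(l : ℤ) + 1} : Finset ℤ) := by
        rw [Finset.mem_singleton]; omega
      have h := hR.setIntegral_not_mem_content π u (a := a) i
        (S := insert ((k : ℤ) + 1) {(l : ℤ) + 1})
        (by
          simp only [Finset.mem_insert, Finset.mem_singleton, forall_eq_or_imp, forall_eq]
          omega)
      simp only [Finset.prod_insert hne, Finset.prod_singleton, Finset.mem_insert,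
        Finset.mem_singleton, forall_eq_or_imp, forall_eq] at h
      have h3 : {ω | R ((k : ℤ) + 1) ω = i} ∩ {ω | R ((l : ℤ) + 1) ω = i} =
          {ω | R ((k : ℤ) + 1) ω = i ∧ R ((l : ℤ) + 1) ω = i} := rfl
      rw [h3, ← h, ← integral_const_mul]
      refine integral_mono_of_nonneg (ae_of_all _ fun ω =>
        mul_nonneg (requestRate_nonneg _ _ ω) (requestRate_nonneg _ _ ω))
        ((hint k i).const_mul _).integrableOn (ae_restrict_of_ae ?_)
      filter_upwards [hR.ae_requestRate_le] with ω hω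
      rw [mul_comm]
      exact mul_le_mul_of_nonneg_right (hω l i) (requestRate_nonneg _ _ ω)
  have hpt : ∀ ω, ∑ i ∈ D, ((E i ∩ {ω | R ((k : ℤ) + 1) ω = i}).indicator (fun _ => (1 : ℝ)) ω -
      ∑ l ∈ Finset.Ico a k, (E i ∩ ({ω | R ((k : ℤ) + 1) ω = i} ∩
        {ω | R ((l : ℤ) + 1) ω = i})).indicator (fun _ => (1 : ℝ)) ω) ≤
      (faultSet π u R k).indicator (fun _ => (1 : ℝ)) ω := fun ω => by
    have h := π.sum_le_fault u (fun l : ℕ => R (l + 1) ω) hak D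
    have hrhs : (faultSet π u R k).indicator (fun _ => (1 : ℝ)) ω =
        if R (k + 1) ω ∉ π.content u (fun l : ℕ => R (l + 1) ω) k then 1 else 0 := by
      by_cases h : R (k + 1) ω ∈ π.content u (fun l : ℕ => R (l + 1) ω) k <;>
        simp [Set.indicator, faultSet, h]
    rw [hrhs]
    refine le_trans (le_of_eq (Finset.sum_congr rfl fun i _ => ?_)) h
    by_cases hi : i ∈ π.content u (fun l : ℕ => R (l + 1) ω) a
    · simp [Set.indicator, hE, hi]
    · simp [Set.indicator, hE, hi]
  have hi1 : ∀ i, Integrable ((E i ∩ {ω | R ((k : ℤ) + 1) ω = i}).indicator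
      fun _ => (1 : ℝ)) μ := fun i =>
    (integrable_const 1).indicator ((hEm i).inter (hRm k i))
  have hi2 : ∀ i (l : ℕ), Integrable ((E i ∩ ({ω | R ((k : ℤ) + 1) ω = i} ∩
      {ω | R ((l : ℤ) + 1) ω = i})).indicator fun _ => (1 : ℝ)) μ := fun i l =>
    (integrable_const 1).indicator ((hEm i).inter ((hRm k i).inter (hRm l i)))
  have hi3 : ∀ i, Integrable (fun ω => (E i ∩ {ω | R ((k : ℤ) + 1) ω = i}).indicator
      (fun _ => (1 : ℝ)) ω - ∑ l ∈ Finset.Ico a k, (E i ∩ ({ω | R ((k : ℤ) + 1) ω = i} ∩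
        {ω | R ((l : ℤ) + 1) ω = i})).indicator (fun _ => (1 : ℝ)) ω) μ := fun i =>
    (hi1 i).sub (integrable_finsetSum (Finset.Ico a k) fun l _ => hi2 i l)
  have hI := integral_mono (μ := μ) (integrable_finsetSum D fun i _ => hi3 i)
    ((integrable_const (1 : ℝ)).indicator (hR.measurableSet_faultSet π u k)) hpt
  rw [integral_finsetSum _ fun i _ => hi3 i, integral_indicator (hR.measurableSet_faultSet π u k), setIntegral_const, smul_eq_mul,
    mul_one] at hI
  refine le_trans ?_ hI
  rw [Finset.mul_sum]
  refine Finset.sum_le_sum fun i hi => ?_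
  rw [integral_sub (hi1 i) (integrable_finsetSum (Finset.Ico a k) fun l _ => hi2 i l),
    integral_finsetSum _ fun l _ => hi2 i l, integral_indicator ((hEm i).inter (hRm k i)),
    setIntegral_const, smul_eq_mul, mul_one, h1]
  have h4 : ∑ l ∈ Finset.Ico a k, ∫ ω, (E i ∩ ({ω | R ((k : ℤ) + 1) ω = i} ∩
        {ω | R ((l : ℤ) + 1) ω = i})).indicator (fun _ => (1 : ℝ)) ω ∂μ ≤
      η * ∫ ω in E i, requestRate Q J τ ((k : ℤ) + 1) i ω ∂μ := by
    have hI0 : 0 ≤ ∫ ω in E i, requestRate Q J τ ((k : ℤ) + 1) i ω ∂μ :=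
      integral_nonneg fun ω => requestRate_nonneg _ _ ω
    have hq0 : 0 ≤ rateBound μ J * popularity μ R i :=
      mul_nonneg rateBound_nonneg measureReal_nonneg
    calc _ ≤ ∑ l ∈ Finset.Ico a k, (rateBound μ J * popularity μ R i) *
          ∫ ω in E i, requestRate Q J τ ((k : ℤ) + 1) i ω ∂μ := by
          refine Finset.sum_le_sum fun l hl => ?_
          rw [integral_indicator ((hEm i).inter ((hRm k i).inter (hRm l i))),
            setIntegral_const, smul_eq_mul, mul_one]
          exact h2 i l hl
      _ = ((k - a : ℕ) : ℝ) * (rateBound μ J * popularity μ R i) *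
          ∫ ω in E i, requestRate Q J τ ((k : ℤ) + 1) i ω ∂μ := by
          rw [Finset.sum_const, Nat.card_Ico, nsmul_eq_mul]
          ring
      _ ≤ (B * (rateBound μ J * popularity μ R i)) *
          ∫ ω in E i, requestRate Q J τ ((k : ℤ) + 1) i ω ∂μ := by
          gcongr
          omega
      _ ≤ _ := mul_le_mul_of_nonneg_right (hη i hi) hI0
  linarith

/-- The expected number of faults in a block of requests is at least, up to small errors, the
length of the block times the popularity missed by the best content. -/
theorem block_faults_ge (hR : IsModulatedRequestProcess μ p F Q T J τ R)
    (π : CachingPolicy s x) (u : I) {a B : ℕ} (D : Finset ℕ)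
    {η ε W : ℝ} (hη1 : η ≤ 1) (hη : ∀ i ∈ D, B * (rateBound μ J * popularity μ R i) ≤ η)
    (hW0 : 0 ≤ W) (hW : ∀ C : Finset ℕ, ∑ i ∈ C, s i ≤ x → W ≤ ∑ i ∈ D \ C, popularity μ R i)
    (hdev : ∀ r, ∫ ω, |∑ k ∈ Finset.Ico a (a + B),
      (if J (τ ((k : ℤ) + 1) ω) ω = r then 1 else 0 : ℝ) -
        B * μ.real {ω | J 0 ω = r}| ∂μ ≤ ε * B) :
    B * ((1 - η) * (W * (1 - rateBound μ J * (M * ε)))) ≤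
      ∑ k ∈ Finset.Ico a (a + B), μ.real (faultSet π u R k) := by
  set E : ℕ → Set Ω := fun i => {ω | i ∉ π.content u (fun l : ℕ => R (l + 1) ω) a} with hE
  have hEm : ∀ i, MeasurableSet (E i) := fun i => hR.measurableSet_content π u a i
  have hint : ∀ (l : ℕ) i, Integrable (requestRate Q J τ ((l : ℤ) + 1) i) μ := fun l i => by
    simpa using hR.integrable_prod_requestRate {(l : ℤ) + 1} fun _ => i
  set V : Ω → ℝ := fun ω => B - rateBound μ J *
      ∑ r, |∑ k ∈ Finset.Ico a (a + B), (if J (τ ((k : ℤ) + 1) ω) ω = r then 1 else 0 : ℝ) -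
        B * μ.real {ω | J 0 ω = r}| with hV
  have hdi : ∀ r, Integrable (fun ω => |∑ k ∈ Finset.Ico a (a + B),
      (if J (τ ((k : ℤ) + 1) ω) ω = r then 1 else 0 : ℝ) - B * μ.real {ω | J 0 ω = r}|) μ :=
    fun r => ((integrable_finsetSum _ fun k _ => hR.integrable_state_arrival _ r).sub
      (integrable_const _)).abs
  have hVi : Integrable V μ :=
    (integrable_const _).sub ((integrable_finsetSum _ fun r _ => hdi r).const_mul _)
  have hVE : B * (1 - rateBound μ J * (M * ε)) ≤ ∫ ω, V ω ∂μ := by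
    rw [hV, integral_sub (integrable_const _)
      ((integrable_finsetSum _ fun r _ => hdi r).const_mul _), integral_const_mul,
      integral_finsetSum _ fun r _ => hdi r, integral_const, probReal_univ, one_smul]
    have h1 : ∑ r, ∫ ω, |∑ k ∈ Finset.Ico a (a + B),
        (if J (τ ((k : ℤ) + 1) ω) ω = r then 1 else 0 : ℝ) - B * μ.real {ω | J 0 ω = r}| ∂μ ≤
        M * (ε * B) :=
      (Finset.sum_le_card_nsmul _ _ _ fun r _ => hdev r).trans_eq (by simp)
    have h2 := mul_le_mul_of_nonneg_left h1 (rateBound_nonneg (μ := μ) (J := J))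
    linarith
  have hVp : Integrable (fun ω => max (V ω) 0) μ := hVi.sup (integrable_zero _ _ _)
  have hsize : ∀ ω, W ≤ ∑ i ∈ D, (E i).indicator (fun _ => popularity μ R i) ω := fun ω => by
    refine (hW _ (π.size_content u (fun l : ℕ => R (l + 1) ω) a)).trans_eq ?_
    rw [← Finset.filter_notMem_eq_sdiff, Finset.sum_filter]
    exact Finset.sum_congr rfl fun i _ => by simp [Set.indicator, hE]
  -- `V` is negative on blocks of large deviation. Its positive part preserves the inequality when
  -- the missed popularity, which depends on `ω`, is replaced by its lower bound `W`.
  have hmain : W * ∫ ω, max (V ω) 0 ∂μ ≤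
      ∑ i ∈ D, ∫ ω in E i, ∑ k ∈ Finset.Ico a (a + B),
        requestRate Q J τ ((k : ℤ) + 1) i ω ∂μ := by
    have hri : ∀ i, Integrable (fun ω => ∑ k ∈ Finset.Ico a (a + B),
        requestRate Q J τ ((k : ℤ) + 1) i ω) μ := fun i =>
      integrable_finsetSum _ fun k _ => hint k i
    calc W * ∫ ω, max (V ω) 0 ∂μ = ∫ ω, W * max (V ω) 0 ∂μ := (integral_const_mul _ _).symm
      _ ≤ ∫ ω, ∑ i ∈ D, (E i).indicator (fun ω => ∑ k ∈ Finset.Ico a (a + B),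
            requestRate Q J τ ((k : ℤ) + 1) i ω) ω ∂μ := by
          refine integral_mono_ae (hVp.const_mul W)
            (integrable_finsetSum _ fun i _ => (hri i).indicator (hEm i)) ?_
          filter_upwards [hR.ae_sum_requestRate_ge a B] with ω hω
          refine (mul_le_mul_of_nonneg_right (hsize ω) (le_max_right _ _)).trans ?_
          rw [Finset.sum_mul]
          refine Finset.sum_le_sum fun i _ => ?_
          by_cases hi : ω ∈ E i
          · have hp : 0 ≤ popularity μ R i := measureReal_nonneg
            rw [Set.indicator_of_mem hi, Set.indicator_of_mem hi, mul_max_of_nonneg _ _ hp, mul_zero]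
            exact max_le (hω i) (Finset.sum_nonneg fun k _ => requestRate_nonneg _ _ ω)
          · rw [Set.indicator_of_notMem hi, Set.indicator_of_notMem hi, zero_mul]
      _ = _ := by
          rw [integral_finsetSum _ fun i _ => (hri i).indicator (hEm i)]
          exact Finset.sum_congr rfl fun i _ => integral_indicator (hEm i)
  have hVmax : ∫ ω, V ω ∂μ ≤ ∫ ω, max (V ω) 0 ∂μ :=
    integral_mono hVi hVp fun ω => le_max_left _ _
  calc B * ((1 - η) * (W * (1 - rateBound μ J * (M * ε))))
      = (1 - η) * (W * (B * (1 - rateBound μ J * (M * ε)))) := by ring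
    _ ≤ (1 - η) * (W * ∫ ω, max (V ω) 0 ∂μ) := by
        have : 0 ≤ 1 - η := by linarith
        gcongr
        exact hVE.trans hVmax
    _ ≤ (1 - η) * ∑ i ∈ D, ∫ ω in E i, ∑ k ∈ Finset.Ico a (a + B),
        requestRate Q J τ ((k : ℤ) + 1) i ω ∂μ :=
        mul_le_mul_of_nonneg_left hmain (by linarith)
    _ = ∑ k ∈ Finset.Ico a (a + B), (1 - η) * ∑ i ∈ D,
        ∫ ω in E i, requestRate Q J τ ((k : ℤ) + 1) i ω ∂μ := by
        rw [← Finset.mul_sum, Finset.sum_comm]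
        congr 1
        exact Finset.sum_congr rfl fun i _ => integral_finsetSum _ fun k _ => (hint k i).integrableOn
    _ ≤ _ := Finset.sum_le_sum fun k hk =>
        hR.sum_setIntegral_le_measureReal_faultSet π u hk D hη

end IsModulatedRequestProcess

/-! ### From numbers of requests to the long-run fault probability -/

theorem IsUnitPoisson.measureReal_lt_sum_spacing {Ω : Type*} [MeasurableSpace Ω] {μ : Measure Ω}
    [IsProbabilityMeasure μ] {τ : ℤ → Ω → ℝ} (hτ : IsUnitPoisson μ τ) {δ : ℝ} (hδ : 0 < δ)
    {n : ℕ} (hn : 0 < n) :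
    μ.real {ω | (1 + δ) * n < ∑ k ∈ Finset.range n, spacing τ k ω} ≤
      √(n * samplingVariance) / n / δ := by
  have hn' : (0 : ℝ) < n := Nat.cast_pos.2 hn
  have h := integral_abs_sum_sub_le (μ := μ) hτ.measurable_spacing hτ.law_spacing
    hτ.indep_spacing 0 n
  simp only [Finset.range_zero, Finset.sum_empty, sub_zero, zero_add] at h
  have hsi : Integrable (fun ω => ∑ k ∈ Finset.range n, spacing τ k ω) μ := by
    refine integrable_finsetSum _ fun k _ => ?_
    have h := memLp_two_id_expMeasure.integrable one_le_two
    rw [← (hτ.law_spacing k).map_eq] at h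
    exact h.comp_measurable (hτ.measurable_spacing k)
  have h1 := mul_meas_ge_le_integral_of_nonneg (μ := μ)
    (f := fun ω => |∑ k ∈ Finset.range n, spacing τ k ω - n|) (ae_of_all _ fun ω => abs_nonneg _)
    (hsi.sub (integrable_const _)).abs (δ * n)
  have h2 : μ.real {ω | (1 + δ) * n < ∑ k ∈ Finset.range n, spacing τ k ω} ≤
      μ.real {ω | δ * n ≤ |∑ k ∈ Finset.range n, spacing τ k ω - n|} := by
    refine measureReal_mono fun ω hω => ?_
    rw [Set.mem_ofPred_eq] at hω ⊢
    exact le_trans (by linarith) (le_abs_self _)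
  rw [div_div, le_div_iff₀ (by positivity)]
  calc _ ≤ μ.real {ω | δ * n ≤ |∑ k ∈ Finset.range n, spacing τ k ω - n|} * (n * δ) := by gcongr
    _ = δ * n * μ.real {ω | δ * n ≤ |∑ k ∈ Finset.range n, spacing τ k ω - n|} := by ring
    _ ≤ _ := h1.trans h

namespace IsModulatedRequestProcess

variable {Ω : Type*} [MeasurableSpace Ω] {μ : Measure Ω} [IsProbabilityMeasure μ]
  {M : ℕ} {p : Matrix (Fin M) (Fin M) ℝ} {F : Fin M → Fin M → Measure ℝ} {Q : Fin M → PMF ℕ}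
  {T : ℤ → Ω → ℝ} {J : ℝ → Ω → Fin M} {τ : ℤ → Ω → ℝ} {R : ℤ → Ω → ℕ}
  {s : ℕ → ℝ} {x : ℝ≥0}

theorem lintegral_faults (hR : IsModulatedRequestProcess μ p F Q T J τ R)
    (π : CachingPolicy s x) (u : I) (t : ℝ) :
    ∫⁻ ω, π.faults τ R t u ω ∂μ =
      ∑' k : ℕ, μ ({ω | τ ((k : ℤ) + 1) ω ∈ Set.Icc 0 t} ∩ faultSet π u R k) := by
  have hm : ∀ k : ℕ, MeasurableSet ({ω | τ ((k : ℤ) + 1) ω ∈ Set.Icc 0 t} ∩ faultSet π u R k) :=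
    fun k => (hR.poisson.measurable _ measurableSet_Icc).inter (hR.measurableSet_faultSet π u k)
  have h : ∀ ω, π.faults τ R t u ω = ∑' k : ℕ,
      ({ω | τ ((k : ℤ) + 1) ω ∈ Set.Icc 0 t} ∩ faultSet π u R k).indicator 1 ω := fun ω => by
    unfold CachingPolicy.faults
    refine tsum_congr fun k => ?_
    simp only [Set.indicator, faultSet, Set.mem_inter_iff, Set.mem_ofPred_eq, Pi.one_apply]
  simp_rw [h]
  rw [lintegral_tsum fun k => (measurable_one.indicator (hm k)).aemeasurable]
  exact tsum_congr fun k => lintegral_indicator_one (hm k)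

/-- Unless the `n`-th arrival comes after `t`, the first `n` requests all count. The exceptional
event costs at most `n` faults. -/
theorem lintegral_faults_ge (hR : IsModulatedRequestProcess μ p F Q T J τ R)
    (π : CachingPolicy s x) (u : I) (t : ℝ) (n : ℕ) :
    ENNReal.ofReal (∑ k ∈ Finset.range n, μ.real (faultSet π u R k) -
      n * μ.real {ω | t < ∑ k ∈ Finset.range n, spacing τ k ω}) ≤
      ∫⁻ ω, π.faults τ R t u ω ∂μ := by
  rw [hR.lintegral_faults]
  refine le_trans ?_ (ENNReal.sum_le_tsum (Finset.range n))
  have h : ∀ k ∈ Finset.range n, μ.real (faultSet π u R k) -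
      μ.real {ω | t < ∑ k ∈ Finset.range n, spacing τ k ω} ≤
      μ.real ({ω | τ ((k : ℤ) + 1) ω ∈ Set.Icc 0 t} ∩ faultSet π u R k) := fun k hk => by
    rw [sub_le_iff_le_add]
    refine le_trans (ENNReal.toReal_mono (measure_ne_top _ _) (measure_mono_ae ?_))
      (measureReal_union_le _ _)
    filter_upwards [hR.poisson.spacing_pos] with ω hω hf
    by_cases ht : t < ∑ k ∈ Finset.range n, spacing τ k ω
    · exact Or.inr ht
    · refine Or.inl ⟨?_, hf⟩
      rw [Set.mem_ofPred_eq, ← sum_spacing τ k ω]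
      exact ⟨Finset.sum_nonneg fun l _ => (hω l).le, le_trans
        (Finset.sum_le_sum_of_subset_of_nonneg
          (Finset.range_subset_range.2 (Finset.mem_range.1 hk)) fun l _ _ => (hω l).le)
        (not_lt.1 ht)⟩
  have h2 := Finset.sum_le_sum h
  rw [Finset.sum_sub_distrib, Finset.sum_const, Finset.card_range, nsmul_eq_mul] at h2
  refine (ENNReal.ofReal_le_ofReal h2).trans (le_of_eq ?_)
  rw [ENNReal.ofReal_sum_of_nonneg fun k _ => measureReal_nonneg]
  exact Finset.sum_congr rfl fun k _ => ofReal_measureReal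

/-- A lower bound for the number of faults in long runs of requests bounds the long-run fault
probability. -/
theorem ofReal_le_faultProb (hR : IsModulatedRequestProcess μ p F Q T J τ R)
    (π : CachingPolicy s x) {B : ℕ} (hB : 0 < B) {κ : ℝ}
    (hκ : ∀ (u : I) (m : ℕ), (m * B : ℕ) * κ ≤
      ∑ k ∈ Finset.range (m * B), μ.real (faultSet π u R k)) :
    ENNReal.ofReal κ ≤ π.faultProb μ τ R := by
  have hlim : Tendsto (fun δ : ℝ => ENNReal.ofReal ((κ - δ) / (1 + δ))) (𝓝[>] 0)
      (𝓝 (ENNReal.ofReal κ)) := by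
    refine (ENNReal.continuous_ofReal.tendsto _).comp ?_
    have h : ContinuousAt (fun δ : ℝ => (κ - δ) / (1 + δ)) 0 :=
      ContinuousAt.div (by fun_prop) (by fun_prop) (by norm_num)
    have h2 := h.tendsto.mono_left (nhdsWithin_le_nhds (s := Set.Ioi 0))
    simpa using h2
  refine le_of_tendsto hlim ?_
  filter_upwards [self_mem_nhdsWithin] with δ hδ
  have hδ : 0 < δ := hδ
  -- Since `faultProb` is an upper limit, it is enough to look at the times `(1 + δ) * (m * B)`, by
  -- which the first `m * B` requests have most likely arrived.
  refine le_limsup_of_frequently_le' ?_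
  have hmB : Tendsto (fun m : ℕ => m * B) atTop atTop := tendsto_id.atTop_mul_const' hB
  have ht : Tendsto (fun m : ℕ => (1 + δ) * ((m * B : ℕ) : ℝ)) atTop atTop :=
    (tendsto_natCast_atTop_atTop.comp hmB).const_mul_atTop (by linarith)
  have hsq := (tendsto_sqrt_mul_div samplingVariance).comp hmB
  refine ht.frequently (Eventually.frequently ?_)
  filter_upwards [hsq.eventually_le_const (show (0 : ℝ) < δ * δ by positivity),
    hmB.eventually_gt_atTop 0] with m hm hpos
  have hn : (0 : ℝ) < (m * B : ℕ) := Nat.cast_pos.2 hpos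
  have hprob := (hR.poisson.measureReal_lt_sum_spacing hδ hpos).trans
    ((div_le_iff₀ hδ).2 hm)
  have key : ∀ u : I, ENNReal.ofReal ((m * B : ℕ) * (κ - δ)) ≤
      ∫⁻ ω, π.faults τ R ((1 + δ) * (m * B : ℕ)) u ω ∂μ := fun u => by
    refine le_trans (ENNReal.ofReal_le_ofReal ?_) (hR.lintegral_faults_ge π u _ (m * B))
    have h1 := hκ u m
    have h2 := mul_le_mul_of_nonneg_left hprob hn.le
    linarith
  have h3 : ENNReal.ofReal ((m * B : ℕ) * (κ - δ)) ≤
      ∫⁻ u : I, ∫⁻ ω, π.faults τ R ((1 + δ) * (m * B : ℕ)) u ω ∂μ := by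
    refine le_trans (le_of_eq ?_) (lintegral_mono key)
    rw [lintegral_const, measure_univ, mul_one]
  have h4 : (κ - δ) / (1 + δ) = ((m * B : ℕ) * (κ - δ)) / ((1 + δ) * (m * B : ℕ)) := by
    field_simp
  rw [h4, ENNReal.ofReal_div_of_pos (by positivity)]
  gcongr

/-- A lower bound for the number of faults in every block of requests bounds the long-run fault
probability. -/
theorem ofReal_le_faultProb_of_block (hR : IsModulatedRequestProcess μ p F Q T J τ R)
    (π : CachingPolicy s x) {B : ℕ} (hB : 0 < B) {κ : ℝ}
    (hκ : ∀ (u : I) (a : ℕ), B * κ ≤ ∑ k ∈ Finset.Ico a (a + B), μ.real (faultSet π u R k)) :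
    ENNReal.ofReal κ ≤ π.faultProb μ τ R := by
  refine hR.ofReal_le_faultProb π hB fun u m => ?_
  induction m with
  | zero => simp
  | succ m ih =>
    have h := hκ u (m * B)
    have h2 := Finset.sum_range_add_sum_Ico (fun k => μ.real (faultSet π u R k))
      (Nat.le_add_right (m * B) B)
    rw [Nat.succ_mul, ← h2]
    push_cast at ih ⊢
    linarith

theorem hasSum_popularity (hR : IsModulatedRequestProcess μ p F Q T J τ R) :
    HasSum (popularity μ R) 1 := by
  have : IsProbabilityMeasure (μ.map (R 1)) :=
    Measure.isProbabilityMeasure_map (hR.measurable_R 1).aemeasurable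
  have h1 : ∀ i, popularity μ R i = ((μ.map (R 1)) {i}).toReal := fun i => by
    rw [Measure.map_apply (hR.measurable_R 1) (measurableSet_singleton i)]
    rfl
  have h2 : ∑' i, (μ.map (R 1)) {i} = 1 := by
    rw [← measure_iUnion (fun i j h => by simpa using h) fun i => measurableSet_singleton i, Set.iUnion_of_singleton, measure_univ]
  have h3 : popularity μ R = fun i => ((μ.map (R 1)) {i}).toReal := funext h1
  rw [h3, ← ENNReal.toReal_one, ← h2, ENNReal.tsum_toReal_eq fun i => measure_ne_top _ _]
  exact ENNReal.hasSum_toReal (by rw [h2]; exact ENNReal.one_ne_top)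

/-- The identity of a request is independent of its time, so the popularities of `0, …, K - 1` can
be subtracted from one even on the event that the request falls in `[0, t]`. -/
theorem measure_static_fault (hR : IsModulatedRequestProcess μ p F Q T J τ R) (t : ℝ)
    (k K : ℕ) :
    μ ({ω | τ ((k : ℤ) + 1) ω ∈ Set.Icc 0 t} ∩ {ω | R ((k : ℤ) + 1) ω ∉ Finset.range K}) =
      ENNReal.ofReal (μ.real {ω | τ ((k : ℤ) + 1) ω ∈ Set.Icc 0 t} *
        ∑' j, popularity μ R (K + j)) := by
  set A : Set Ω := {ω | τ ((k : ℤ) + 1) ω ∈ Set.Icc 0 t} with hA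
  have hAm : MeasurableSet A := hR.poisson.measurable _ measurableSet_Icc
  have hRm : ∀ i, MeasurableSet {ω | R ((k : ℤ) + 1) ω = i} := fun i =>
    hR.measurable_R _ (measurableSet_singleton i)
  have hSm : MeasurableSet {ω | R ((k : ℤ) + 1) ω ∈ Finset.range K} :=
    hR.measurable_R _ (Finset.range K).measurableSet
  have h1 : μ.real (A ∩ {ω | R ((k : ℤ) + 1) ω ∈ Finset.range K}) =
      μ.real A * ∑ i ∈ Finset.range K, popularity μ R i := by
    have hU : A ∩ {ω | R ((k : ℤ) + 1) ω ∈ Finset.range K} =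
        ⋃ i ∈ Finset.range K, A ∩ {ω | R ((k : ℤ) + 1) ω = i} := by
      ext ω
      simp
    rw [hU, measureReal_biUnion_finset ?_ fun i _ => hAm.inter (hRm i), Finset.mul_sum]
    · exact Finset.sum_congr rfl fun i _ => hR.measureReal_request_mem measurableSet_Icc k i
    · intro i _ j _ hij
      refine Set.disjoint_left.2 fun ω h h' => hij ?_
      exact h.2.symm.trans h'.2
  have h2 : ∑ i ∈ Finset.range K, popularity μ R i + ∑' j, popularity μ R (K + j) = 1 := by
    rw [← hR.hasSum_popularity.tsum_eq, ← hR.hasSum_popularity.summable.sum_add_tsum_nat_add K]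
    simp_rw [add_comm K]
  have h3 := measureReal_inter_add_sdiff (μ := μ) (s := A) hSm
  have h4 : A \ {ω | R ((k : ℤ) + 1) ω ∈ Finset.range K} =
      A ∩ {ω | R ((k : ℤ) + 1) ω ∉ Finset.range K} := rfl
  rw [← ofReal_measureReal, ← h4]
  congr 1
  rw [h1] at h3
  have h5 : μ.real A * (∑ i ∈ Finset.range K, popularity μ R i + ∑' j, popularity μ R (K + j)) =
      μ.real A := by rw [h2, mul_one]
  linarith

theorem staticPolicy_content (u : I) (r : ℕ → ℕ) (k : ℕ) :
    (staticPolicy s x).content u r k = Finset.range (staticCount s x) := by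
  induction k with
  | zero => rfl
  | succ k ih => exact ih

/-- The static policy misses exactly the documents that it does not keep. -/
theorem faultProb_staticPolicy_le (hR : IsModulatedRequestProcess μ p F Q T J τ R) :
    (staticPolicy s x).faultProb μ τ R ≤
      ENNReal.ofReal (∑' j, popularity μ R (staticCount s x + j)) := by
  have htail : 0 ≤ ∑' j, popularity μ R (staticCount s x + j) :=
    tsum_nonneg fun _ => measureReal_nonneg
  refine limsup_le_of_le (by isBoundedDefault) ?_
  filter_upwards [eventually_gt_atTop 0] with t ht
  refine ENNReal.div_le_of_le_mul ?_
  have key : ∀ u : I, ∫⁻ ω, (staticPolicy s x).faults τ R t u ω ∂μ ≤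
      ENNReal.ofReal (∑' j, popularity μ R (staticCount s x + j)) * ENNReal.ofReal t := fun u => by
    rw [hR.lintegral_faults]
    refine ENNReal.tsum_le_of_sum_range_le fun n => ?_
    have h1 : ∀ k ∈ Finset.range n,
        μ ({ω | τ ((k : ℤ) + 1) ω ∈ Set.Icc 0 t} ∩ faultSet (staticPolicy s x) u R k) =
        ENNReal.ofReal (μ.real {ω | τ ((k : ℤ) + 1) ω ∈ Set.Icc 0 t} *
          ∑' j, popularity μ R (staticCount s x + j)) := fun k _ => by
      rw [← hR.measure_static_fault]
      simp only [faultSet, staticPolicy_content]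
    rw [Finset.sum_congr rfl h1, ← ENNReal.ofReal_sum_of_nonneg fun k _ =>
      mul_nonneg measureReal_nonneg htail, ← ENNReal.ofReal_mul htail, ← Finset.sum_mul, mul_comm]
    refine ENNReal.ofReal_le_ofReal (mul_le_mul_of_nonneg_left ?_ htail)
    have h2 := sum_measureReal_le (μ := μ) hR.poisson.measurable_spacing hR.poisson.law_spacing
      hR.poisson.indep_spacing ht.le n
    simp_rw [sum_spacing] at h2
    exact h2
  refine (lintegral_mono key).trans (le_of_eq ?_)
  rw [lintegral_const, measure_univ, mul_one]

end IsModulatedRequestProcess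

/-! ### The knapsack bound for large caches -/

section Knapsack

variable {s q : ℕ → ℝ}

/-- The sets `range k` are optimal for the continuous knapsack problem. -/
theorem sum_le_sum_range_add (hs : ∀ i, 0 < s i) (horder : Antitone fun i => q i / s i)
    (C : Finset ℕ) (k : ℕ) :
    ∑ i ∈ C, q i ≤ ∑ i ∈ Finset.range k, q i +
      q k / s k * (∑ i ∈ C, s i - ∑ i ∈ Finset.range k, s i) := by
  -- After subtracting the price `q k / s k` per unit of size, documents from `k` on have
  -- nonpositive value and those before `k` nonnegative value.
  have h1 : ∑ i ∈ C \ Finset.range k, (q i - q k / s k * s i) ≤ 0 :=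
    Finset.sum_nonpos fun i hi => by
      have hki : k ≤ i := by simpa using (Finset.mem_sdiff.1 hi).2
      have := (div_le_iff₀ (hs i)).1 (horder hki)
      linarith
  have h2 : 0 ≤ ∑ i ∈ Finset.range k \ C, (q i - q k / s k * s i) :=
    Finset.sum_nonneg fun i hi => by
      have hik : i ≤ k := (Finset.mem_range.1 (Finset.mem_sdiff.1 hi).1).le
      have := (le_div_iff₀ (hs i)).1 (horder hik)
      linarith
  have h3 := Finset.sum_sdiff_sub_sum_sdiff (s₁ := C) (s₂ := Finset.range k)
    (f := fun i => q i - q k / s k * s i)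
  simp only [Finset.sum_sub_distrib, ← Finset.mul_sum] at h1 h2 h3
  rw [mul_sub]
  linarith

theorem exists_lower_bound_of_finite_range (hs : ∀ i, 0 < s i) (hfin : (Set.range s).Finite) :
    ∃ c, 0 < c ∧ ∀ i, c ≤ s i := by
  obtain ⟨_, ⟨j, rfl⟩, hmin⟩ := hfin.exists_minimal (Set.range_nonempty s)
  exact ⟨s j, hs j, fun i => (le_total (s j) (s i)).elim id fun h => hmin ⟨i, rfl⟩ h⟩

theorem bddAbove_fitting {c : ℝ} (hc : 0 < c) (hcs : ∀ i, c ≤ s i) (x : ℝ≥0) :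
    BddAbove {k : ℕ | ∑ i ∈ Finset.range k, s i ≤ x} := by
  refine ⟨⌈(x : ℝ) / c⌉₊, fun k hk => ?_⟩
  have h1 : (k : ℝ) * c ≤ ∑ i ∈ Finset.range k, s i := by
    simpa using Finset.card_nsmul_le_sum (Finset.range k) s c fun i _ => hcs i
  have h2 : (k : ℝ) ≤ x / c := (le_div_iff₀ hc).2 (h1.trans hk)
  exact_mod_cast h2.trans (Nat.le_ceil _)

theorem lt_sum_range_staticCount_succ {c : ℝ} (hc : 0 < c) (hcs : ∀ i, c ≤ s i) (x : ℝ≥0) :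
    (x : ℝ) < ∑ i ∈ Finset.range (staticCount s x + 1), s i := by
  by_contra! h
  exact absurd (le_csSup (bddAbove_fitting hc hcs x) h) (by unfold staticCount; omega)

theorem tendsto_staticCount {c : ℝ} (hc : 0 < c) (hcs : ∀ i, c ≤ s i) :
    Tendsto (staticCount s) atTop atTop := by
  refine tendsto_atTop.2 fun K => ?_
  filter_upwards [eventually_ge_atTop (∑ i ∈ Finset.range K, s i).toNNReal] with x hx
  exact le_csSup (bddAbove_fitting hc hcs x) (Real.toNNReal_le_iff_le_coe.1 hx)

/-- One minus the ratio of consecutive tails is `q i` divided by the tail from `i`. -/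
theorem tendsto_div_tail (hq : ∀ i, 0 < q i) (hsum : Summable q)
    (htail : Tendsto (fun i : ℕ => (∑' j : ℕ, q (i + 1 + j)) / ∑' j : ℕ, q (i + j))
      atTop (𝓝 1)) :
    Tendsto (fun i : ℕ => q i / ∑' j : ℕ, q (i + j)) atTop (𝓝 0) := by
  have h := tendsto_const_nhds (x := (1 : ℝ)).sub htail
  rw [sub_self] at h
  refine h.congr fun i => ?_
  have hsi : Summable fun j => q (i + j) := hsum.comp_injective (add_right_injective i)
  have hpos : 0 < ∑' j, q (i + j) := hsi.tsum_pos (fun j => (hq _).le) 0 (hq _)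
  have h1 : ∑' j, q (i + j) = q i + ∑' j, q (i + 1 + j) := by
    rw [hsi.tsum_eq_zero_add, add_zero]
    exact congrArg _ (tsum_congr fun j => congrArg q (by omega))
  rw [eq_div_iff hpos.ne', sub_mul, div_mul_cancel₀ _ hpos.ne']
  linarith

/-- No content that fits into a large cache misses much less than the static one, even when only
documents of large index count. -/
theorem eventually_exists_missed_ge (hs : ∀ i, 0 < s i) (hfin : (Set.range s).Finite)
    (hq : ∀ i, 0 < q i) (hsum : Summable q) (horder : Antitone fun i => q i / s i)
    (htail : Tendsto (fun i : ℕ => (∑' j : ℕ, q (i + 1 + j)) / ∑' j : ℕ, q (i + j))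
      atTop (𝓝 1)) {ε : ℝ} (hε : 0 < ε) (i₀ : ℕ) :
    ∀ᶠ x : ℝ≥0 in atTop, ∃ D : Finset ℕ, (∀ i ∈ D, i₀ ≤ i) ∧
      ∀ C : Finset ℕ, ∑ i ∈ C, s i ≤ x →
        (1 - ε) * ∑' j, q (staticCount s x + j) ≤ ∑ i ∈ D \ C, q i := by
  obtain ⟨c, hc, hcs⟩ := exists_lower_bound_of_finite_range hs hfin
  set X := ∑ i ∈ Finset.range i₀, s i with hX
  have hX0 : 0 ≤ X := Finset.sum_nonneg fun i _ => (hs i).le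
  have hlim := ((tendsto_div_tail hq hsum htail).mul_const (1 + X / c)).comp
    (tendsto_staticCount hc hcs)
  rw [zero_mul] at hlim
  filter_upwards [hlim.eventually_lt_const (half_pos hε)] with x hx
  set k := staticCount s x with hk
  have hsk : Summable fun j => q (k + j) := hsum.comp_injective (add_right_injective k)
  have hpos : 0 < ∑' j, q (k + j) := hsk.tsum_pos (fun j => (hq _).le) 0 (hq _)
  have hx : q k * (1 + X / c) < ε / 2 * ∑' j, q (k + j) := by
    have h : q k / (∑' j, q (k + j)) * (1 + X / c) < ε / 2 := hx
    rw [div_mul_eq_mul_div, div_lt_iff₀ hpos] at h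
    exact h
  have hN : ∀ᶠ N in atTop, (1 - ε / 2) * ∑' j, q (k + j) < ∑ j ∈ Finset.range N, q (k + j) :=
    hsk.hasSum.tendsto_sum_nat.eventually_const_lt (by nlinarith)
  obtain ⟨N, hN⟩ := hN.exists
  -- `N` is such that the documents `k, …, k + N - 1` carry all but a fraction `ε / 2` of the tail.
  -- The other `ε / 2` pays for the boundary term.
  refine ⟨Finset.Ico i₀ (k + N), fun i hi => (Finset.mem_Ico.1 hi).1, fun C hC => ?_⟩
  -- Ignoring the documents below `i₀` amounts to caching them for free. The enlarged set exceeds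
  -- the size of `range k` by at most `s k + X`, which at the price `q k / s k` is worth at most `q
  -- k * (1 + X / c)`.
  have h1 := sum_le_sum_range_add hs horder (C ∪ Finset.range i₀) k
  have h2 : ∑ i ∈ C ∪ Finset.range i₀, s i ≤ x + X := by
    have h := Finset.sum_union_inter (s₁ := C) (s₂ := Finset.range i₀) (f := s)
    have h0 : 0 ≤ ∑ i ∈ C ∩ Finset.range i₀, s i := Finset.sum_nonneg fun i _ => (hs i).le
    linarith
  have h3 := lt_sum_range_staticCount_succ hc hcs x
  rw [← hk, Finset.sum_range_succ] at h3
  have h4 : q k / s k * (∑ i ∈ C ∪ Finset.range i₀, s i - ∑ i ∈ Finset.range k, s i) ≤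
      q k * (1 + X / c) := by
    calc _ ≤ q k / s k * (s k + X) := by
          refine mul_le_mul_of_nonneg_left (by linarith) (div_pos (hq k) (hs k)).le
      _ = q k * (1 + X / s k) := by
          have := (hs k).ne'
          field_simp
      _ ≤ q k * (1 + X / c) := by
          have := (hq k).le
          have := hcs k
          gcongr
  have h5 : ∑ i ∈ Finset.range (k + N), q i ≤
      ∑ i ∈ C ∪ Finset.range i₀, q i + ∑ i ∈ Finset.Ico i₀ (k + N) \ C, q i := by
    rw [← Finset.sum_union ?_]
    · refine Finset.sum_le_sum_of_subset_of_nonneg (fun i hi => ?_) fun i _ _ => (hq i).le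
      simp only [Finset.mem_union, Finset.mem_sdiff, Finset.mem_Ico, Finset.mem_range] at hi ⊢
      by_cases hiC : i ∈ C
      · exact Or.inl (Or.inl hiC)
      · rcases lt_or_ge i i₀ with h | h
        · exact Or.inl (Or.inr h)
        · exact Or.inr ⟨⟨h, hi⟩, hiC⟩
    · refine Finset.disjoint_left.2 fun i hi hi' => ?_
      simp only [Finset.mem_union, Finset.mem_sdiff, Finset.mem_Ico, Finset.mem_range] at hi hi'
      rcases hi with h | h
      · exact hi'.2 h
      · exact absurd hi'.1.1 (not_le.2 h)
  rw [Finset.sum_range_add] at h5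
  linarith

end Knapsack

/-! ### Assembly of the lower bound -/

theorem IsModulatedRequestProcess.eventually_faultProb_ge {Ω : Type*} [MeasurableSpace Ω]
    {μ : Measure Ω} [IsProbabilityMeasure μ] {M : ℕ} {p : Matrix (Fin M) (Fin M) ℝ}
    {F : Fin M → Fin M → Measure ℝ} {Q : Fin M → PMF ℕ} {T : ℤ → Ω → ℝ} {J : ℝ → Ω → Fin M}
    {τ : ℤ → Ω → ℝ} {R : ℤ → Ω → ℕ} {s : ℕ → ℝ}
    (hR : IsModulatedRequestProcess μ p F Q T J τ R)
    (hq : ∀ i, 0 < popularity μ R i) (hs : ∀ i, 0 < s i) (hfin : (Set.range s).Finite)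
    (horder : Antitone (fun i => popularity μ R i / s i))
    (htail : Tendsto
      (fun i : ℕ => (∑' j : ℕ, popularity μ R (i + 1 + j)) / ∑' j : ℕ, popularity μ R (i + j))
      atTop (𝓝 1)) {ε : ℝ} (hε : 0 < ε) (hε1 : ε ≤ 1) :
    ∀ᶠ x : ℝ≥0 in atTop, ∀ π : CachingPolicy s x,
      ENNReal.ofReal ((1 - ε) ^ 3 * ∑' j, popularity μ R (staticCount s x + j)) ≤
        π.faultProb μ τ R := by
  set b := rateBound μ J * M with hb
  have hb0 : 0 ≤ b := mul_nonneg rateBound_nonneg (Nat.cast_nonneg M)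
  -- The tolerance per state is chosen so that the total loss `b * (ε / (b + 1))` is at most `ε`;
  -- adding one allows `b = 0`.
  have hε' : 0 < ε / (b + 1) := div_pos hε (by linarith)
  obtain ⟨B, hB, hdev⟩ := hR.exists_block_deviation hε'
  have hbε : rateBound μ J * (M * (ε / (b + 1))) ≤ ε := by
    rw [← mul_assoc, ← hb, mul_div_assoc', div_le_iff₀ (by linarith)]
    nlinarith
  have hq0 : Tendsto (fun i => B * (rateBound μ J * popularity μ R i)) atTop (𝓝 0) := by
    simpa using
      (hR.hasSum_popularity.summable.tendsto_atTop_zero.const_mul (rateBound μ J)).const_mul (B : ℝ)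
  -- The order of choices is `B`, then `i₀` in terms of `B`, then `x`.
  obtain ⟨i₀, hi₀⟩ := eventually_atTop.1 (hq0.eventually_le_const hε)
  filter_upwards [eventually_exists_missed_ge hs hfin hq hR.hasSum_popularity.summable horder
    htail hε i₀] with x hx π
  obtain ⟨D, hD, hW⟩ := hx
  have htail0 : 0 ≤ ∑' j, popularity μ R (staticCount s x + j) := tsum_nonneg fun _ => (hq _).le
  have h1 : 0 ≤ 1 - ε := by linarith
  refine le_trans (ENNReal.ofReal_le_ofReal ?_) (hR.ofReal_le_faultProb_of_block π hB
    fun u a => hR.block_faults_ge π u D hε1 (fun i hi => hi₀ i (hD i hi))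
      (mul_nonneg h1 htail0) hW (hdev a))
  -- The three factors account for repetitions within a block, the knapsack bound and the deviation
  -- of the state counts.
  calc _ = (1 - ε) * ((1 - ε) * (∑' j, popularity μ R (staticCount s x + j)) * (1 - ε)) := by ring
    _ ≤ _ := by gcongr
end

theorem mainTheorem3 {Ω : Type*} [MeasurableSpace Ω] (μ : Measure Ω) [IsProbabilityMeasure μ]
    {M : ℕ} (p : Matrix (Fin M) (Fin M) ℝ) (F : Fin M → Fin M → Measure ℝ) (Q : Fin M → PMF ℕ)
    (T : ℤ → Ω → ℝ) (J : ℝ → Ω → Fin M) (τ : ℤ → Ω → ℝ) (R : ℤ → Ω → ℕ)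
    (hR : IsModulatedRequestProcess μ p F Q T J τ R)
    (hq : ∀ i, 0 < popularity μ R i)
    (s : ℕ → ℝ) (hs : ∀ i, 0 < s i) (hfin : (Set.range s).Finite)
    (horder : Antitone (fun i => popularity μ R i / s i))
    (htail : Tendsto
      (fun i : ℕ => (∑' j : ℕ, popularity μ R (i + 1 + j)) / ∑' j : ℕ, popularity μ R (i + j))
      atTop (𝓝 1)) :
    Tendsto
      (fun x : ℝ≥0 =>
        (⨅ π : CachingPolicy s x, π.faultProb μ τ R) / (staticPolicy s x).faultProb μ τ R)
      atTop (𝓝 1) := by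
  have hpop := hR.hasSum_popularity.summable
  refine tendsto_order.2 ⟨fun a ha => ?_, fun a ha => Eventually.of_forall fun x => ?_⟩
  · have hlim : Tendsto (fun ε : ℝ => ENNReal.ofReal ((1 - ε) ^ 3)) (𝓝[>] 0) (𝓝 1) := by
      have h : Continuous fun ε : ℝ => ENNReal.ofReal ((1 - ε) ^ 3) :=
        ENNReal.continuous_ofReal.comp (by fun_prop)
      simpa using (h.tendsto 0).mono_left (nhdsWithin_le_nhds (s := Set.Ioi 0))
    have hε1 : ∀ᶠ ε : ℝ in 𝓝[>] 0, ε ≤ 1 :=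
      nhdsWithin_le_nhds (eventually_le_nhds zero_lt_one)
    obtain ⟨ε, haε, hε1, hε⟩ := ((hlim.eventually_const_lt ha).and
      (hε1.and self_mem_nhdsWithin)).exists
    have hε : 0 < ε := hε
    filter_upwards [hR.eventually_faultProb_ge hq hs hfin horder htail hε hε1] with x hx
    have hpos : 0 < ∑' j, popularity μ R (staticCount s x + j) :=
      (hpop.comp_injective (add_right_injective _)).tsum_pos (fun j => (hq _).le) 0 (hq _)
    refine haε.trans_le ?_
    calc ENNReal.ofReal ((1 - ε) ^ 3)
        = ENNReal.ofReal ((1 - ε) ^ 3 * ∑' j, popularity μ R (staticCount s x + j)) /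
            ENNReal.ofReal (∑' j, popularity μ R (staticCount s x + j)) := by
          rw [← ENNReal.ofReal_div_of_pos hpos, mul_div_cancel_right₀ _ hpos.ne']
      _ ≤ _ := ENNReal.div_le_div (le_iInf hx) hR.faultProb_staticPolicy_le
  -- The upper bound holds for every `x`, as the static policy takes part in the infimum.
  · exact ((ENNReal.div_le_div_right (iInf_le _ (staticPolicy s x)) _).trans
      ENNReal.div_self_le_one).trans_lt ha
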